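/- **Lemma (Trace inequalities for OSNAP).** There is an absolute constant $c>0$ such that the following holds. Let $m,n,d,s$ be natural numbers and $p\in(0,1]$ with $s=pm$ and $s\mid m$. Let $\xi=(\xi_{(l,\gamma)})$, $\mu=(\mu_{(l,\gamma)})$, $(l,\gamma)\in[n]\times[s]$, be mutually independent random variables such that each $\xi_{(l,\gamma)}$ is Rademacher and each $\mu_{(l,\gamma)}$ is uniformly distributed on $\{(m/s)(\gamma-1)+1,\dots,(m/s)\gamma\}$; put $\mathcal Z=(\xi,\mu)$. The law of $\sum_{l,\gamma}\xi_{(l,\gamma)}e_{\mu_{(l,\gamma)}}e_l^{\top}\in\mathbb R^{m\times n}$ is called the fully independent unscaled OSNAP distribution with parameter $p$. Let $S_1,S_2,G_1,G_2$ be mutually independent random $m\times n$ matrices on a probability space, where $S_1,S_2$ have this OSNAP distribution and $G_1,G_2$ have i.i.d. centred Gaussian entries of variance $p$. For $t\in[0,1]$ let $S_i(t)=\sqrt t\,S_i+\sqrt{1-t}\,G_i$. Let $U\in\mathbb R^{n\times d}$ satisfy $U^{\top}U=I_d$, let $u_l^{\top}$ be its $l$-th row, and let $$\Gamma(t)=(S_1(t)U)^{\top}S_2(t)U+(S_2(t)U)^{\top}S_1(t)U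 .$$ Let $q,k$ be integers with $q\ge\max\{2,\tfrac12\log(pm)\}$ and $3\le k\le 2q$. For a $d\times d$ matrix $M$ write $\operatorname{tr}M=\frac1d\sum_iM_{ii}$ and $|M|=\sqrt{M^{\top}M}$; for a random $d\times d$ matrix put $\|M\|_\beta=(\mathbb E\operatorname{tr}|M|^\beta)^{1/\beta}$ if $\beta<\infty$, and let $\|M\|_\infty$ be the essential supremum of the operator norm of $M$. For $\lambda\in[k]$ let $\mathcal Z_\lambda=(\xi_{(l,\gamma),\lambda},\mu_{(l,\gamma),\lambda})_{(l,\gamma)\in[n]\times[s]}$ be (possibly dependent) random elements, each with the same distribution as $\mathcal Z$, and let $\Upsilon_1,\dots,\Upsilon_k$ be random $d\times d$ matrices with $\|\Upsilon_\lambda\|_\infty<\infty$. Assume that $(\mathcal Z_\lambda)_{\lambda\in[k]}$ is independent of $(S_1,S_2,G_1,G_2,\Upsilon_1,\dots,\Upsilon_k)$ (the $\Upsilon_\lambda$ may depend on one another and on $S_1,S_2,G_1,G_2$). Define the row vectors $$\Theta_{(l,\gamma),\lambda,1}=\xi_{(l,\gamma),\lambda}\,u_l^{\top},\qquad \Theta_{(l,\gamma),\lambda,2}=e_{\mu_{(l,\gamma),\lambda}}^{\top}S_2(t)U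 .$$ Then for all $\beta_1,\dots,\beta_k\in[0,\infty]$ with $\sum_{\lambda=1}^k\frac1{\beta_\lambda}=1-\frac k{2q}$ and all permutations $\tau_1,\dots,\tau_k$ of $\{1,2\}$, the random variables under the expectations below are integrable and $$\sum_{(l,\gamma)\in[n]\times[s]}\mathbb E\operatorname{tr}\Bigl[\Theta_{(l,\gamma),1,\tau_1(1)}^{\top}\Theta_{(l,\gamma),1,\tau_1(2)}\Upsilon_1\,\Theta_{(l,\gamma),2,\tau_2(1)}^{\top}\Theta_{(l,\gamma),2,\tau_2(2)}\Upsilon_2\cdots\Theta_{(l,\gamma),k,\tau_k(1)}^{\top}\Theta_{(l,\gamma),k,\tau_k(2)}\Upsilon_k\Bigr]$$ $$\le\bigl(c\sqrt{\max\{pd,q\}}\bigr)^{\frac{2qk-4q}{2q-2}}\bigl(\mathbb E\operatorname{tr}\Gamma(t)^{2q}\bigr)^{\frac1q\cdot\frac{2q-k}{2q-2}}\prod_{\lambda=1}^k\|\Upsilon_\lambda\|_{\beta_\lambda}.$$ -/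

import Mathlib

open MeasureTheory ProbabilityTheory Matrix
open scoped MatrixOrder ENNReal

noncomputable section

namespace OSNAP

/-- Random matrices are measured entrywise. -/
instance instMeasurableSpaceMatrix {a b : ℕ} : MeasurableSpace (Matrix (Fin a) (Fin b) ℝ) :=
  inferInstanceAs (MeasurableSpace (Fin a → Fin b → ℝ))

/-! ### Distributions -/

/-- The Rademacher distribution: the values `1` and `-1` have probability `1/2` each. -/
def rademacher : Measure ℝ :=
  (2⁻¹ : ℝ≥0∞) • Measure.dirac 1 + (2⁻¹ : ℝ≥0∞) • Measure.dirac (-1)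

/-- The `γ`-th block of `m / s` consecutive row indices (everything is indexed from `0`). -/
def block (m s : ℕ) (γ : Fin s) : Set (Fin m) :=
  {i | m / s * (γ : ℕ) ≤ (i : ℕ) ∧ (i : ℕ) < m / s * ((γ : ℕ) + 1)}

/-- The values of the variables that generate an OSNAP matrix: the signs `ξ_{(l,γ)}` (first
component) and the row indices `μ_{(l,γ)}` (second component). -/
abbrev Gen (m n s : ℕ) : Type := (Fin n × Fin s → ℝ) × (Fin n × Fin s → Fin m)

/-- The joint law of the generating variables of a fully independent unscaled OSNAP matrix: all
the variables are independent, each `ξ_{(l,γ)}` is Rademacher, and each `μ_{(l,γ)}` is uniform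
on the `γ`-th block of rows. -/
def genLaw (m n s : ℕ) : Measure (Gen m n s) :=
  (Measure.pi fun _ : Fin n × Fin s => rademacher).prod
    (Measure.pi fun x : Fin n × Fin s => uniformOn (block m s x.2))

/-- The matrix `∑_{(l,γ)} ξ_{(l,γ)} e_{μ_{(l,γ)}} e_lᵀ`. -/
def genMatrix {m n s : ℕ} (z : Gen m n s) : Matrix (Fin m) (Fin n) ℝ :=
  ∑ x : Fin n × Fin s, Matrix.single (z.2 x) x.1 (z.1 x)

/-- The fully independent unscaled OSNAP distribution on `m × n` matrices with `s` nonzero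
entries in each column. -/
def law (m n s : ℕ) : Measure (Matrix (Fin m) (Fin n) ℝ) :=
  (genLaw m n s).map genMatrix

/-- `G` is a random matrix with i.i.d. centred Gaussian entries of variance `v`. -/
structure IsGaussianMatrix {Ω : Type*} [MeasurableSpace Ω] {m n : ℕ}
    (G : Ω → Matrix (Fin m) (Fin n) ℝ) (v : NNReal) (P : Measure Ω) : Prop where
  hasLaw : ∀ i j, HasLaw (fun ω => G ω i j) (gaussianReal 0 v) P
  indep : iIndepFun (fun (x : Fin m × Fin n) ω => G ω x.1 x.2) P

/-! ### Trace and norms of random matrices -/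

/-- The normalized trace. -/
def ntr {d : ℕ} (M : Matrix (Fin d) (Fin d) ℝ) : ℝ := (d : ℝ)⁻¹ * M.trace

/-- The operator norm of a matrix with respect to the Euclidean norm. -/
def opNorm {d : ℕ} (M : Matrix (Fin d) (Fin d) ℝ) : ℝ :=
  ‖Matrix.toEuclideanCLM (n := Fin d) (𝕜 := ℝ) M‖

/-- `M` is a random matrix in `L_∞(S_∞^d)`. -/
def MemLinfty {Ω : Type*} [MeasurableSpace Ω] {d : ℕ}
    (M : Ω → Matrix (Fin d) (Fin d) ℝ) (P : Measure Ω) : Prop :=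
  AEMeasurable M P ∧ MemLp (fun ω => opNorm (M ω)) ∞ P

/-- The norm of `L_β(S_β^d)`: `(E tr |M|^β)^{1/β}` for `β < ∞`, where `|M| = √(Mᵀ M)`, and the
essential supremum of the operator norm for `β = ∞`. -/
def schattenNorm {Ω : Type*} [MeasurableSpace Ω] {d : ℕ} (β : ℝ≥0∞)
    (M : Ω → Matrix (Fin d) (Fin d) ℝ) (P : Measure Ω) : ℝ :=
  if β = ∞ then (eLpNorm (fun ω => opNorm (M ω)) ∞ P).toReal
  else (∫ ω, ntr (CFC.abs (M ω) ^ β.toReal) ∂P) ^ (1 / β.toReal)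

/-! ### The matrices of the trace inequality -/

/-- The interpolation `√t S + √(1-t) G`. -/
def interp {m n : ℕ} (t : ℝ) (S G : Matrix (Fin m) (Fin n) ℝ) : Matrix (Fin m) (Fin n) ℝ :=
  √t • S + √(1 - t) • G

/-- `(M₁ U)ᵀ (M₂ U) + (M₂ U)ᵀ (M₁ U)`. -/
def Gam {m n d : ℕ} (U : Matrix (Fin n) (Fin d) ℝ) (M₁ M₂ : Matrix (Fin m) (Fin n) ℝ) :
    Matrix (Fin d) (Fin d) ℝ :=
  (M₁ * U)ᵀ * (M₂ * U) + (M₂ * U)ᵀ * (M₁ * U)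

/-- The row vectors `Θ_{(l,γ),1} = ξ_{(l,γ)} u_lᵀ` (index `0`) and
`Θ_{(l,γ),2} = e_{μ_{(l,γ)}}ᵀ M₂ U` (index `1`), where `u_lᵀ` is the `l`-th row of `U`. -/
def Theta {m n s d : ℕ} (U : Matrix (Fin n) (Fin d) ℝ) (M₂ : Matrix (Fin m) (Fin n) ℝ)
    (z : Gen m n s) (x : Fin n × Fin s) : Fin 2 → Fin d → ℝ :=
  ![z.1 x • U x.1, (M₂ * U) (z.2 x)]

/-- The ordered product `(Θ_{1,τ₁(1)}ᵀ Θ_{1,τ₁(2)}) Υ₁ ⋯ (Θ_{k,τ_k(1)}ᵀ Θ_{k,τ_k(2)}) Υ_k` for the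
index `x = (l,γ)`. -/
def traceProd {m n s d k : ℕ} (U : Matrix (Fin n) (Fin d) ℝ) (M₂ : Matrix (Fin m) (Fin n) ℝ)
    (z : Fin k → Gen m n s) (τ : Fin k → Equiv.Perm (Fin 2))
    (Y : Fin k → Matrix (Fin d) (Fin d) ℝ) (x : Fin n × Fin s) : Matrix (Fin d) (Fin d) ℝ :=
  (List.ofFn fun i : Fin k =>
    Matrix.vecMulVec (Theta U M₂ (z i) x (τ i 0)) (Theta U M₂ (z i) x (τ i 1)) * Y i).prod

end OSNAP

end

noncomputable section

namespace OSNAP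

/-! ### Spectral calculus of real matrices -/

/-! Write `X = S₂(t) U` and `q' = q / (q - 1)`. Each matrix `Θᵀ Θ` has rank one, so the trace is a
cyclic product of `k` bilinear forms `bᵀ Υ v`, where `b` and `v` are signed rows `± u_l` of `U` or
random rows `X_μ` of `X` (`trace_list_prod_vecMulVec_mul`). Cauchy-Schwarz bounds a form by the
geometric mean of `bᵀ |Υᵀ| b` and `vᵀ |Υ| v`, and Jensen for the spectral measure replaces `|Υ|` by
`H = |Υ|^{β/q'}` at the price of a power of the squared norm (`abs_dotProduct_mulVec_le_absPow`);
for `β = ∞` the operator norm is used instead. All quantities are now quadratic, so the signs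
disappear.

It remains to bound the sum over `(l,γ)` of expected products of powers of `|u_l|²`, `|X_μ|²`, `u_lᵀ
H u_l` and `X_μᵀ H X_μ`. One application of Hölder (`sum_lintegral_prod_le`) gives weight `θ = (k -
2) / (2q - 2)` to the products `|u_l|^{2q} |X_μ|^{2q}` and weight `1 - θ` to the mixed products
`|u_l|² X_μᵀ H X_μ` and `|X_μ|² u_lᵀ H u_l`. Each of these involves a single `Z_λ`, so no assumption
on the dependence among the `Z_λ` is needed. As `μ` is uniform on its block, the sum over `(l,γ)`
becomes `p` times the sum over all `l` and all rows (`sum_lintegral_index`).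

The mixed products are where `Γ` enters. For fixed `X` and `H`, averaging over `S₁(t)` gives `E Tr(H
Γ²) = p ((d + 2) Tr(H Xᵀ X) + Tr(Xᵀ X) Tr H)`, with `Tr` the unnormalized trace
(`lintegral_trace_absPow_mul_Gam_sq`); the two summands dominate the two kinds of mixed sums. Hölder
for traces then yields `(E Tr |Υ|^β)^{1/q'} (E Tr Γ^{2q})^{1/q}`. Since `Υ` may depend on `S₁`, the
averaging uses an independent copy of `S₁(t)`, which leaves the law of `Γ` unchanged
(`lintegral_weighted_le`).

For the products of weight `θ`, use `|u_l| ≤ 1`, `∑ |u_l|² = d` and the bound `(24 max{pd, q})^q` on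
the `q`-th moment of `|X_i|²` (`lintegral_row_pow_le`). The latter comes from exponential moments:
given the positions, a row of `S U` is a Rademacher sum with covariance at most `1`, and the trace
of that covariance is a sum of independent terms of total mean `pd`. The sum over `(l,γ)` costs a
factor `s = pm ≤ e^{2q}`, which the constant absorbs. Collecting exponents, all powers of `d` cancel
against the normalization of the trace. -/

instance instBorelSpaceMatrix {a b : ℕ} : BorelSpace (Matrix (Fin a) (Fin b) ℝ) :=
  inferInstanceAs (BorelSpace (Fin a → Fin b → ℝ))

section Matrices

variable {d : ℕ}

/-- A single eigenbasis serves all functions `g`, so different powers of the same matrix can be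
compared eigenvalue by eigenvalue. -/
lemma exists_orthogonal_diagonalization {A : Matrix (Fin d) (Fin d) ℝ} (hA : A.IsHermitian) :
    ∃ (a : Fin d → ℝ) (W : Matrix (Fin d) (Fin d) ℝ), Wᵀ * W = 1 ∧ W * Wᵀ = 1 ∧
      ∀ g : ℝ → ℝ, cfc g A = W * diagonal (g ∘ a) * Wᵀ := by
  refine ⟨hA.eigenvalues, (hA.eigenvectorUnitary : Matrix (Fin d) (Fin d) ℝ), ?_, ?_, fun g => ?_⟩
  · have := Unitary.coe_star_mul_self hA.eigenvectorUnitary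
    rwa [star_eq_conjTranspose, conjTranspose_eq_transpose_of_trivial] at this
  · have := Unitary.coe_mul_star_self hA.eigenvectorUnitary
    rwa [Unitary.coe_star, star_eq_conjTranspose, conjTranspose_eq_transpose_of_trivial] at this
  · rw [hA.cfc_eq, Matrix.IsHermitian.cfc, Unitary.conjStarAlgAut_apply]
    rw [star_eq_conjTranspose, conjTranspose_eq_transpose_of_trivial]
    rfl

lemma dotProduct_conj_diagonal (W : Matrix (Fin d) (Fin d) ℝ) (b : Fin d → ℝ) (v : Fin d → ℝ) :
    v ⬝ᵥ ((W * diagonal b * Wᵀ) *ᵥ v) = ∑ k, b k * (Wᵀ *ᵥ v) k ^ 2 := by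
  rw [← mulVec_mulVec, ← mulVec_mulVec, dotProduct_mulVec, ← mulVec_transpose, dotProduct]
  refine Finset.sum_congr rfl fun k _ => ?_
  rw [mulVec_diagonal]; ring

lemma trace_conj_diagonal {W : Matrix (Fin d) (Fin d) ℝ} (hW : Wᵀ * W = 1) (b : Fin d → ℝ) :
    (W * diagonal b * Wᵀ).trace = ∑ k, b k := by
  rw [trace_mul_comm, ← mul_assoc, hW, one_mul, trace_diagonal]

lemma dotProduct_self_orthogonal {W : Matrix (Fin d) (Fin d) ℝ} (hW : W * Wᵀ = 1)
    (v : Fin d → ℝ) : v ⬝ᵥ v = ∑ k, (Wᵀ *ᵥ v) k ^ 2 := by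
  have := dotProduct_conj_diagonal W (fun _ => 1) v
  rw [diagonal_one, mul_one, hW, one_mulVec] at this
  simpa using this

/-- The matrix `|M|^r = (Mᵀ M)^{r/2}`. -/
def absPow (r : ℝ) (M : Matrix (Fin d) (Fin d) ℝ) : Matrix (Fin d) (Fin d) ℝ :=
  cfc (fun x : ℝ => x ^ (r / 2)) (Mᵀ * M)

lemma isHermitian_transpose_mul (M : Matrix (Fin d) (Fin d) ℝ) : (Mᵀ * M).IsHermitian := by
  rw [← conjTranspose_eq_transpose_of_trivial]
  exact isHermitian_conjTranspose_mul_self M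

lemma abs_rpow_eq_absPow {r : ℝ} (hr : 0 < r) (M : Matrix (Fin d) (Fin d) ℝ) :
    CFC.abs M ^ r = absPow r M := by
  have h0 : (0 : Matrix (Fin d) (Fin d) ℝ) ≤ star M * M := star_mul_self_nonneg M
  rw [CFC.abs, CFC.sqrt_eq_rpow, CFC.rpow_rpow_of_exponent_nonneg _ _ _ (by norm_num) hr.le,
    CFC.rpow_eq_cfc_real, absPow, star_eq_conjTranspose, conjTranspose_eq_transpose_of_trivial]
  congr 1
  ext x
  congr 1
  ring

/-- Simultaneous diagonalization of `Mᵀ M` and `M Mᵀ`. -/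
lemma exists_singular_decomposition (M : Matrix (Fin d) (Fin d) ℝ) :
    ∃ (a e : Fin d → ℝ) (W V C : Matrix (Fin d) (Fin d) ℝ),
      Wᵀ * W = 1 ∧ W * Wᵀ = 1 ∧ Vᵀ * V = 1 ∧ V * Vᵀ = 1 ∧ M = V * C * Wᵀ ∧
      (∀ g : ℝ → ℝ, cfc g (Mᵀ * M) = W * diagonal (g ∘ a) * Wᵀ) ∧
      (∀ g : ℝ → ℝ, cfc g (M * Mᵀ) = V * diagonal (g ∘ e) * Vᵀ) ∧
      Cᵀ * C = diagonal a ∧ C * Cᵀ = diagonal e ∧ (∀ j k, C j k ≠ 0 → e j = a k) ∧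
      (∀ k, 0 ≤ a k) ∧ ∀ j, 0 ≤ e j := by
  obtain ⟨a, W, hW, hW', hg⟩ := exists_orthogonal_diagonalization (isHermitian_transpose_mul M)
  have hM' : (M * Mᵀ).IsHermitian := by simpa using isHermitian_transpose_mul Mᵀ
  obtain ⟨e, V, hV, hV', hg'⟩ := exists_orthogonal_diagonalization hM'
  have ha : Mᵀ * M = W * diagonal a * Wᵀ := by
    have := hg id
    rwa [cfc_id ℝ _ (isHermitian_transpose_mul M).isSelfAdjoint] at this
  have he : M * Mᵀ = V * diagonal e * Vᵀ := by
    have := hg' id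
    rwa [cfc_id ℝ _ hM'.isSelfAdjoint] at this
  have h1 : (Vᵀ * M * W)ᵀ * (Vᵀ * M * W) = diagonal a := by
    calc (Vᵀ * M * W)ᵀ * (Vᵀ * M * W) = Wᵀ * (Mᵀ * (V * Vᵀ) * M) * W := by
          simp only [transpose_mul, transpose_transpose, mul_assoc]
      _ = (Wᵀ * W) * diagonal a * (Wᵀ * W) := by
          rw [hV', mul_one, ha]; simp only [mul_assoc]
      _ = diagonal a := by rw [hW]; simp
  have h2 : (Vᵀ * M * W) * (Vᵀ * M * W)ᵀ = diagonal e := by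
    calc (Vᵀ * M * W) * (Vᵀ * M * W)ᵀ = Vᵀ * (M * (W * Wᵀ) * Mᵀ) * V := by
          simp only [transpose_mul, transpose_transpose, mul_assoc]
      _ = (Vᵀ * V) * diagonal e * (Vᵀ * V) := by
          rw [hW', mul_one, he]; simp only [mul_assoc]
      _ = diagonal e := by rw [hV]; simp
  refine ⟨a, e, W, V, Vᵀ * M * W, hW, hW', hV, hV', ?_, hg, hg', h1, h2, fun j k hjk => ?_,
    fun k => ?_, fun j => ?_⟩
  · calc M = (V * Vᵀ) * M * (W * Wᵀ) := by rw [hV', hW']; simp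
      _ = _ := by simp only [mul_assoc]
  -- The identity `(M Mᵀ) M = M (Mᵀ M)` makes `C` intertwine the two diagonal matrices, so a nonzero
  -- entry joins equal eigenvalues. This takes the place of a full singular value decomposition.
  · have h3 : diagonal e * (Vᵀ * M * W) = (Vᵀ * M * W) * diagonal a := by
      rw [← h1, ← h2, mul_assoc]
    have := congrFun (congrFun h3 j) k
    rw [diagonal_mul, mul_diagonal, mul_comm] at this
    exact mul_left_cancel₀ hjk this
  · have := congrFun (congrFun h1 k) k
    rw [diagonal_apply_eq, mul_apply] at this
    rw [← this]
    exact Finset.sum_nonneg fun j _ => mul_self_nonneg _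
  · have := congrFun (congrFun h2 j) j
    rw [diagonal_apply_eq, mul_apply] at this
    rw [← this]
    exact Finset.sum_nonneg fun j _ => mul_self_nonneg _

/-- For `f` with `f 0 = 0`, `∑ f(a_k) = ∑ (f(a_k) / a_k) C_{jk}²`. Where `C_{jk} ≠ 0` one has `e_j =
a_k`, so the double sum is symmetric in the two spectra. Positivity of `r` gives `f 0 = 0`. -/
lemma trace_absPow_transpose {r : ℝ} (hr : 0 < r) (M : Matrix (Fin d) (Fin d) ℝ) :
    (absPow r Mᵀ).trace = (absPow r M).trace := by
  obtain ⟨a, e, W, V, C, hW, -, hV, -, -, hg, hg', h1, h2, hC, ha, he⟩ :=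
    exists_singular_decomposition M
  rw [absPow, absPow, transpose_transpose, hg, hg', trace_conj_diagonal hW,
    trace_conj_diagonal hV]
  have key : ∀ x : ℝ, 0 ≤ x → x ^ (r / 2) = x ^ (r / 2) / x * x := by
    intro x hx
    rcases hx.eq_or_lt with rfl | hx
    · rw [Real.zero_rpow (by positivity)]; simp
    · field_simp
  have ha' : ∀ k, a k = ∑ j, C j k ^ 2 := fun k => by
    have := congrFun (congrFun h1 k) k
    rw [diagonal_apply_eq, mul_apply] at this
    rw [← this]; exact Finset.sum_congr rfl fun j _ => by rw [transpose_apply]; ring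
  have he' : ∀ j, e j = ∑ k, C j k ^ 2 := fun j => by
    have := congrFun (congrFun h2 j) j
    rw [diagonal_apply_eq, mul_apply] at this
    rw [← this]; exact Finset.sum_congr rfl fun j _ => by rw [transpose_apply]; ring
  have L : ∀ j, ((fun x : ℝ => x ^ (r / 2)) ∘ e) j = ∑ k, e j ^ (r / 2) / e j * C j k ^ 2 := by
    intro j
    rw [← Finset.mul_sum, ← he', Function.comp_apply, ← key _ (he j)]
  have R : ∀ k, ((fun x : ℝ => x ^ (r / 2)) ∘ a) k = ∑ j, a k ^ (r / 2) / a k * C j k ^ 2 := by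
    intro k
    rw [← Finset.mul_sum, ← ha', Function.comp_apply, ← key _ (ha k)]
  simp_rw [L, R]
  rw [Finset.sum_comm]
  refine Finset.sum_congr rfl fun k _ => Finset.sum_congr rfl fun j _ => ?_
  by_cases h : C j k = 0
  · simp [h]
  · rw [hC j k h]

lemma dotProduct_absPow_nonneg (r : ℝ) (M : Matrix (Fin d) (Fin d) ℝ) (v : Fin d → ℝ) :
    0 ≤ v ⬝ᵥ (absPow r M *ᵥ v) := by
  obtain ⟨a, e, W, V, C, hW, -, hV, -, -, hg, hg', h1, h2, hC, ha, he⟩ :=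
    exists_singular_decomposition M
  rw [absPow, hg, dotProduct_conj_diagonal]
  exact Finset.sum_nonneg fun k _ => mul_nonneg (Real.rpow_nonneg (ha k) _) (sq_nonneg _)

lemma trace_absPow_nonneg (r : ℝ) (M : Matrix (Fin d) (Fin d) ℝ) :
    0 ≤ (absPow r M).trace :=
  Finset.sum_nonneg fun i _ => by
    simpa using dotProduct_absPow_nonneg r M (Pi.single i 1)

/-- Jensen for the spectral measure of `v`: the weights `(Wᵀ v)_k²` have total mass `v ⬝ᵥ v`. -/
lemma dotProduct_absPow_one_le {r : ℝ} (hr : 1 ≤ r) (M : Matrix (Fin d) (Fin d) ℝ)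
    (v : Fin d → ℝ) :
    v ⬝ᵥ (absPow 1 M *ᵥ v) ≤ (v ⬝ᵥ v) ^ (1 - r⁻¹) * (v ⬝ᵥ (absPow r M *ᵥ v)) ^ r⁻¹ := by
  obtain ⟨a, e, W, V, C, hW, hW', hV, -, -, hg, hg', h1, h2, hC, ha, he⟩ :=
    exists_singular_decomposition M
  rw [absPow, absPow, hg, hg, dotProduct_conj_diagonal, dotProduct_conj_diagonal,
    dotProduct_self_orthogonal hW' v]
  have := Real.inner_le_weight_mul_Lp_of_nonneg Finset.univ (p := r) hr
    (fun k => (Wᵀ *ᵥ v) k ^ 2) (fun k => a k ^ ((1 : ℝ) / 2)) (fun k => sq_nonneg _)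
    (fun k => Real.rpow_nonneg (ha k) _)
  refine le_trans (le_of_eq ?_) (this.trans (le_of_eq ?_))
  · exact Finset.sum_congr rfl fun k _ => by simp [mul_comm]
  · congr 2
    refine Finset.sum_congr rfl fun k _ => ?_
    rw [← Real.rpow_mul (ha k), Function.comp_apply, mul_comm]
    congr 2; ring

/-- The mixed Cauchy-Schwarz inequality: write `bᵀ M v = (bᵀ M |M|^{-1/2}) (|M|^{1/2} v)` and use `M
|M|⁻¹ Mᵀ = |Mᵀ|`, with the inverse taken off the kernel. Everything is done in the two eigenbases.
-/
lemma abs_dotProduct_mulVec_le_absPow_one (M : Matrix (Fin d) (Fin d) ℝ) (b v : Fin d → ℝ) :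
    |b ⬝ᵥ (M *ᵥ v)| ≤ √(b ⬝ᵥ (absPow 1 Mᵀ *ᵥ b)) * √(v ⬝ᵥ (absPow 1 M *ᵥ v)) := by
  obtain ⟨a, e, W, V, C, hW, hW', hV, -, hM, hg, hg', h1, h2, hC, ha, he⟩ :=
    exists_singular_decomposition M
  rw [absPow, absPow, transpose_transpose, hg, hg', dotProduct_conj_diagonal,
    dotProduct_conj_diagonal]
  set x := Vᵀ *ᵥ b
  set z := Wᵀ *ᵥ v
  have hb : b ⬝ᵥ (M *ᵥ v) = ∑ k, (∑ j, x j * C j k) * z k := by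
    rw [hM, ← mulVec_mulVec, ← mulVec_mulVec, dotProduct_mulVec, ← mulVec_transpose,
      dotProduct_mulVec]
    rfl
  have hs : ∀ y : ℝ, y ^ ((1 : ℝ) / 2) = √y := fun y => (Real.sqrt_eq_rpow y).symm
  simp only [Function.comp_def, hs]
  rw [hb]
  -- Columns of `C` with eigenvalue zero vanish, so the convention `x / 0 = 0` in the quotients
  -- below loses nothing.
  have hy0 : ∀ k, a k = 0 → ∑ j, x j * C j k = 0 := by
    intro k hk
    refine Finset.sum_eq_zero fun j _ => ?_
    have := congrFun (congrFun h1 k) k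
    rw [diagonal_apply_eq, mul_apply, hk] at this
    have := (Finset.sum_eq_zero_iff_of_nonneg fun j _ => mul_self_nonneg (C j k)).1 this j
      (Finset.mem_univ j)
    rw [mul_self_eq_zero.1 this, mul_zero]
  -- This is `M |M|⁻¹ Mᵀ = |Mᵀ|` as a quadratic form: `a_k` may be replaced by `e_j` wherever
  -- `C_{jk} ≠ 0`, and then `C Cᵀ` is diagonal.
  have hsum : ∑ k, (∑ j, x j * C j k) ^ 2 / √(a k) = ∑ j, √(e j) * x j ^ 2 := by
    have : ∀ k, (∑ j, x j * C j k) ^ 2 / √(a k)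
        = ∑ j, ∑ j', x j * x j' / √(e j) * (C j k * C j' k) := by
      intro k
      rw [sq, Finset.sum_mul_sum, Finset.sum_div]
      refine Finset.sum_congr rfl fun j _ => ?_
      rw [Finset.sum_div]
      refine Finset.sum_congr rfl fun j' _ => ?_
      by_cases h : C j k = 0
      · simp [h]
      · rw [hC j k h]; ring
    simp_rw [this]
    rw [Finset.sum_comm]
    refine Finset.sum_congr rfl fun j _ => ?_
    rw [Finset.sum_comm]
    have h3 : ∀ j', ∑ k, x j * x j' / √(e j) * (C j k * C j' k)
        = if j = j' then √(e j) * x j ^ 2 else 0 := by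
      intro j'
      have h4 := congrFun (congrFun h2 j) j'
      rw [mul_apply] at h4
      simp only [transpose_apply] at h4
      rw [← Finset.mul_sum, h4, diagonal_apply]
      split_ifs with h
      · subst h
        have : √(e j) * √(e j) = e j := Real.mul_self_sqrt (he j)
        by_cases h0 : √(e j) = 0
        · rw [h0] at this ⊢; rw [← this]; simp
        · calc x j * x j / √(e j) * e j = x j * x j / √(e j) * (√(e j) * √(e j)) := by rw [this]
            _ = √(e j) * x j ^ 2 := by field_simp
      · simp
    simp [h3]
  have hcs := Finset.sum_mul_sq_le_sq_mul_sq Finset.univ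
    (fun k => (∑ j, x j * C j k) / √(√(a k))) (fun k => √(√(a k)) * z k)
  have e1 : ∀ k, (∑ j, x j * C j k) / √(√(a k)) * (√(√(a k)) * z k)
      = (∑ j, x j * C j k) * z k := by
    intro k
    by_cases h : a k = 0
    · simp [hy0 k h]
    · have : √(√(a k)) ≠ 0 :=
        (Real.sqrt_pos.2 (Real.sqrt_pos.2 (lt_of_le_of_ne (ha k) (Ne.symm h)))).ne'
      field_simp
  simp only [e1, div_pow, mul_pow, Real.sq_sqrt (Real.sqrt_nonneg _)] at hcs
  rw [hsum] at hcs
  rw [← Real.sqrt_mul (Finset.sum_nonneg fun j _ => by positivity)]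
  exact Real.abs_le_sqrt hcs

lemma abs_dotProduct_mulVec_le_absPow {r : ℝ} (hr : 1 ≤ r) (M : Matrix (Fin d) (Fin d) ℝ)
    (b v : Fin d → ℝ) :
    |b ⬝ᵥ (M *ᵥ v)| ≤
      ((b ⬝ᵥ b) ^ (1 / 2 - (2 * r)⁻¹) * (b ⬝ᵥ (absPow r Mᵀ *ᵥ b)) ^ (2 * r)⁻¹) *
      ((v ⬝ᵥ v) ^ (1 / 2 - (2 * r)⁻¹) * (v ⬝ᵥ (absPow r M *ᵥ v)) ^ (2 * r)⁻¹) := by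
  have key : ∀ (N : Matrix (Fin d) (Fin d) ℝ) (x : Fin d → ℝ), √(x ⬝ᵥ (absPow 1 N *ᵥ x)) ≤
      (x ⬝ᵥ x) ^ (1 / 2 - (2 * r)⁻¹) * (x ⬝ᵥ (absPow r N *ᵥ x)) ^ (2 * r)⁻¹ := by
    intro N x
    have h0 : 0 ≤ x ⬝ᵥ x := Finset.sum_nonneg fun i _ => mul_self_nonneg _
    have h1 := dotProduct_absPow_nonneg r N x
    refine (Real.sqrt_le_sqrt (dotProduct_absPow_one_le hr N x)).trans (le_of_eq ?_)
    rw [Real.sqrt_eq_rpow, Real.mul_rpow (Real.rpow_nonneg h0 _) (Real.rpow_nonneg h1 _),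
      ← Real.rpow_mul h0, ← Real.rpow_mul h1]
    congr 2
    · rw [mul_inv]; ring
    · rw [mul_inv]; ring
  refine (abs_dotProduct_mulVec_le_absPow_one M b v).trans ?_
  exact mul_le_mul (key _ _) (key _ _) (Real.sqrt_nonneg _)
    ((Real.sqrt_nonneg _).trans (key _ _))

/-- Hölder for the trace of a product of two functions of symmetric matrices. If `c` is the
orthogonal matrix of overlaps of the two eigenbases, the trace is `∑ a_k^{r/2} γ_j² c_{jk}²`. The
squares `c_{jk}²` are doubly stochastic, so the scalar Hölder inequality with these weights returns
both full traces. -/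
lemma trace_absPow_mul_sq_le {r q q' : ℝ} {n : ℕ} (hn : (n : ℝ) = q) (hq : q'.HolderConjugate q)
    (M G : Matrix (Fin d) (Fin d) ℝ) (hG : G.IsHermitian) :
    (absPow r M * (G * G)).trace ≤
      (absPow (r * q') M).trace ^ (1 / q') * (G ^ (2 * n)).trace ^ (1 / q) := by
  obtain ⟨a, e, W, V, C, hW, hW', hV, -, -, hg, hg', h1, h2, hC, ha, he⟩ :=
    exists_singular_decomposition M
  obtain ⟨γ, X, hX, hX', hγ⟩ := exists_orthogonal_diagonalization hG
  have hG2 : G * G = X * diagonal (fun i => γ i ^ 2) * Xᵀ := by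
    have := hγ (fun x => x ^ 2)
    rw [cfc_pow_id _ _ hG.isSelfAdjoint] at this
    rw [← sq, this]; rfl
  have hGn : (G ^ (2 * n)).trace = ∑ i, γ i ^ (2 * n) := by
    rw [← cfc_pow_id (R := ℝ) G (2 * n) hG.isSelfAdjoint, hγ, trace_conj_diagonal hX]; rfl
  set c : Matrix (Fin d) (Fin d) ℝ := Xᵀ * W with hc
  have hcc : cᵀ * c = 1 := by
    rw [hc, transpose_mul, transpose_transpose, mul_assoc, ← mul_assoc X, hX', one_mul, hW]
  have hcc' : c * cᵀ = 1 := by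
    rw [hc, transpose_mul, transpose_transpose, mul_assoc, ← mul_assoc W, hW', one_mul, hX]
  have hcol : ∀ k, ∑ j, c j k ^ 2 = 1 := fun k => by
    have := congrFun (congrFun hcc k) k
    rw [mul_apply, one_apply_eq] at this
    rw [← this]; exact Finset.sum_congr rfl fun j _ => by rw [transpose_apply]; ring
  have hrow : ∀ j, ∑ k, c j k ^ 2 = 1 := fun k => by
    have := congrFun (congrFun hcc' k) k
    rw [mul_apply, one_apply_eq] at this
    rw [← this]; exact Finset.sum_congr rfl fun j _ => by rw [transpose_apply]; ring
  have htr : (absPow r M * (G * G)).trace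
      = ∑ x : Fin d × Fin d, a x.1 ^ (r / 2) * γ x.2 ^ 2 * c x.2 x.1 ^ 2 := by
    have : (absPow r M * (G * G)).trace = (diagonal ((fun x : ℝ => x ^ (r / 2)) ∘ a) *
        (cᵀ * diagonal (fun i => γ i ^ 2) * c)).trace := by
      rw [absPow, hg, hG2, hc, transpose_mul, transpose_transpose, mul_assoc W,
        mul_assoc W, trace_mul_comm W]
      simp only [mul_assoc]
    rw [this, trace, Fintype.sum_prod_type]
    refine Finset.sum_congr rfl fun k _ => ?_
    rw [diag_apply, diagonal_mul, mul_apply, Finset.mul_sum]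
    refine Finset.sum_congr rfl fun j _ => ?_
    rw [mul_diagonal, transpose_apply, Function.comp_apply]
    ring
  have h := Real.inner_le_Lp_mul_Lq_of_nonneg Finset.univ hq
    (f := fun x : Fin d × Fin d => a x.1 ^ (r / 2) * (c x.2 x.1 ^ 2) ^ (1 / q'))
    (g := fun x => γ x.2 ^ 2 * (c x.2 x.1 ^ 2) ^ (1 / q))
    (fun x _ => mul_nonneg (Real.rpow_nonneg (ha _) _) (Real.rpow_nonneg (sq_nonneg _) _))
    (fun x _ => mul_nonneg (sq_nonneg _) (Real.rpow_nonneg (sq_nonneg _) _))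
  rw [htr]
  refine le_trans (le_of_eq ?_) (h.trans (le_of_eq ?_))
  · refine Finset.sum_congr rfl fun x _ => ?_
    have : (c x.2 x.1 ^ 2) = (c x.2 x.1 ^ 2) ^ (1 / q') * (c x.2 x.1 ^ 2) ^ (1 / q) := by
      rw [← Real.rpow_add_of_nonneg (sq_nonneg _) (one_div_nonneg.2 hq.nonneg)
        (one_div_nonneg.2 hq.symm.nonneg), one_div, one_div, hq.inv_add_inv_eq_one, Real.rpow_one]
    conv_lhs => rw [this]
    ring
  · congr 2
    · rw [absPow, hg, trace_conj_diagonal hW, Fintype.sum_prod_type]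
      refine Finset.sum_congr rfl fun k _ => ?_
      have : ∀ j, (a k ^ (r / 2) * (c j k ^ 2) ^ (1 / q')) ^ q' = a k ^ (r * q' / 2) * c j k ^ 2 := by
        intro j
        rw [Real.mul_rpow (Real.rpow_nonneg (ha _) _) (Real.rpow_nonneg (sq_nonneg _) _),
          ← Real.rpow_mul (ha k), ← Real.rpow_mul (sq_nonneg _), one_div,
          inv_mul_cancel₀ hq.ne_zero, Real.rpow_one]
        congr 2; ring
      simp_rw [this]
      rw [← Finset.mul_sum, hcol, mul_one, Function.comp_apply]
    · rw [hGn, Fintype.sum_prod_type, Finset.sum_comm]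
      refine Finset.sum_congr rfl fun j _ => ?_
      have : ∀ k, (γ j ^ 2 * (c j k ^ 2) ^ (1 / q)) ^ q = γ j ^ (2 * n) * c j k ^ 2 := by
        intro k
        rw [Real.mul_rpow (sq_nonneg _) (Real.rpow_nonneg (sq_nonneg _) _),
          ← Real.rpow_mul (sq_nonneg _), one_div,
          inv_mul_cancel₀ hq.symm.ne_zero, Real.rpow_one, ← hn, Real.rpow_natCast, pow_mul]
      simp_rw [this]
      rw [← Finset.mul_sum, hrow, mul_one]

/-- The functional calculus is a pointwise limit of polynomials in `Mᵀ M`: polynomials within `1 /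
(n + 1)` of `g` on `[-n, n]` converge to it at every eigenvalue. -/
lemma measurable_cfc_transpose_mul {g : ℝ → ℝ} (hg : Continuous g) :
    Measurable fun M : Matrix (Fin d) (Fin d) ℝ => cfc g (Mᵀ * M) := by
  have hex : ∀ n : ℕ, ∃ p : Polynomial ℝ, ∀ x ∈ Set.Icc (-(n : ℝ)) n,
      |p.eval x - g x| < 1 / ((n : ℝ) + 1) := fun n =>
    exists_polynomial_near_of_continuousOn _ _ g hg.continuousOn _ (by positivity)
  choose p hp using hex
  have hlim : ∀ x, Filter.Tendsto (fun n => (p n).eval x) Filter.atTop (nhds (g x)) := by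
    intro x
    rw [tendsto_iff_dist_tendsto_zero]
    refine squeeze_zero' (Filter.Eventually.of_forall fun _ => dist_nonneg) ?_
      (tendsto_one_div_add_atTop_nhds_zero_nat (𝕜 := ℝ))
    filter_upwards [Filter.eventually_ge_atTop ⌈|x|⌉₊] with n hn
    have : |x| ≤ n := (Nat.le_ceil _).trans (by exact_mod_cast hn)
    exact (hp n x (abs_le.1 this)).le
  have : TopologicalSpace.PseudoMetrizableSpace (Matrix (Fin d) (Fin d) ℝ) :=
    inferInstanceAs (TopologicalSpace.PseudoMetrizableSpace (Fin d → Fin d → ℝ))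
  refine measurable_of_tendsto_metrizable (f := fun n (M : Matrix (Fin d) (Fin d) ℝ) =>
    Polynomial.aeval (Mᵀ * M) (p n)) (fun n => ?_) ?_
  · refine Continuous.measurable ?_
    simp only [Polynomial.aeval_eq_sum_range]
    fun_prop
  · rw [tendsto_pi_nhds]
    intro M
    obtain ⟨a, W, hW, hW', h⟩ := exists_orthogonal_diagonalization (isHermitian_transpose_mul M)
    have : ∀ n, Polynomial.aeval (Mᵀ * M) (p n)
        = W * diagonal ((fun x => (p n).eval x) ∘ a) * Wᵀ := fun n => by
      rw [← h, cfc_polynomial _ _ (isHermitian_transpose_mul M).isSelfAdjoint]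
    simp_rw [this, h]
    have hd : Filter.Tendsto (fun n => diagonal ((fun x => (p n).eval x) ∘ a)) Filter.atTop
        (nhds (diagonal (g ∘ a))) := by
      refine (Continuous.matrix_diagonal continuous_id).continuousAt.tendsto.comp ?_
      rw [tendsto_pi_nhds]
      exact fun i => hlim (a i)
    exact (hd.const_mul W).mul_const Wᵀ

lemma measurable_absPow {r : ℝ} (hr : 0 ≤ r) :
    Measurable (absPow r : Matrix (Fin d) (Fin d) ℝ → _) :=
  measurable_cfc_transpose_mul (Real.continuous_rpow_const (by positivity))

lemma toEuclideanCLM_ofLp (M : Matrix (Fin d) (Fin d) ℝ) (v : Fin d → ℝ) :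
    ‖WithLp.toLp 2 (M *ᵥ v)‖ ≤ opNorm M * ‖WithLp.toLp 2 v‖ := by
  have := (Matrix.toEuclideanCLM (n := Fin d) (𝕜 := ℝ) M).le_opNorm (WithLp.toLp 2 v)
  simpa [opNorm] using this

lemma norm_toLp_eq_sqrt (v : Fin d → ℝ) : ‖WithLp.toLp 2 v‖ = √(v ⬝ᵥ v) := by
  rw [EuclideanSpace.norm_eq]
  simp [dotProduct, sq]

lemma abs_dotProduct_mulVec_le_opNorm (M : Matrix (Fin d) (Fin d) ℝ) (b v : Fin d → ℝ) :
    |b ⬝ᵥ (M *ᵥ v)| ≤ opNorm M * ((b ⬝ᵥ b) ^ ((1 : ℝ) / 2) * (v ⬝ᵥ v) ^ ((1 : ℝ) / 2)) := by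
  rw [← Real.sqrt_eq_rpow, ← Real.sqrt_eq_rpow, ← norm_toLp_eq_sqrt, ← norm_toLp_eq_sqrt]
  have h := abs_real_inner_le_norm (WithLp.toLp 2 b) (WithLp.toLp 2 (M *ᵥ v))
  have h2 : inner ℝ (WithLp.toLp 2 b) (WithLp.toLp 2 (M *ᵥ v)) = b ⬝ᵥ (M *ᵥ v) := by
    rw [EuclideanSpace.inner_toLp_toLp]; simp [dotProduct_comm]
  rw [h2] at h
  refine h.trans ?_
  calc _ ≤ ‖WithLp.toLp 2 b‖ * (opNorm M * ‖WithLp.toLp 2 v‖) := by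
        gcongr; exact toEuclideanCLM_ofLp M v
    _ = _ := by ring

lemma abs_entry_le_opNorm (M : Matrix (Fin d) (Fin d) ℝ) (i j : Fin d) : |M i j| ≤ opNorm M := by
  have := abs_dotProduct_mulVec_le_opNorm M (Pi.single i 1) (Pi.single j 1)
  simpa using this

end Matrices

/-! ### Exponential moments of squared norms -/

lemma lintegral_pi_prod {ι : Type*} [Fintype ι] {E : ι → Type*} [∀ i, MeasurableSpace (E i)]
    (ν : ∀ i, Measure (E i)) [∀ i, IsProbabilityMeasure (ν i)] {f : ∀ i, E i → ℝ≥0∞}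
    (hf : ∀ i, Measurable (f i)) :
    ∫⁻ x, ∏ i, f i (x i) ∂(Measure.pi ν) = ∏ i, ∫⁻ y, f i y ∂(ν i) := by
  refine (lintegral_prod_eq_prod_lintegral_of_indepFun Finset.univ
    (fun i (x : ∀ i, E i) => f i (x i))
    (iIndepFun_pi (X := f) fun i => (hf i).aemeasurable)
    fun i => (hf i).comp (measurable_pi_apply i)).trans ?_
  exact Finset.prod_congr rfl fun i _ => (measurePreserving_eval ν i).lintegral_comp (hf i)

lemma lintegral_prod_of_iIndepFun {Ω ι : Type*} [Fintype ι] [MeasurableSpace Ω] {P : Measure Ω}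
    {E : ι → Type*} [∀ i, MeasurableSpace (E i)] {ν : ∀ i, Measure (E i)}
    [∀ i, IsProbabilityMeasure (ν i)] {X : ∀ i, Ω → E i} (hX : ∀ i, HasLaw (X i) (ν i) P)
    (hind : iIndepFun X P) {f : ∀ i, E i → ℝ≥0∞} (hf : ∀ i, Measurable (f i)) :
    ∫⁻ ω, ∏ i, f i (X i ω) ∂P = ∏ i, ∫⁻ y, f i y ∂(ν i) := by
  have := hind.isProbabilityMeasure
  have h := (iIndepFun_iff_map_fun_eq_pi_map fun i => (hX i).aemeasurable).1 hind
  simp_rw [(hX _).map_eq] at h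
  rw [← lintegral_pi_prod ν hf, ← h, lintegral_map']
  · exact (Finset.univ.measurable_prod fun i _ =>
      (hf i).comp (measurable_pi_apply i)).aemeasurable
  · exact aemeasurable_pi_lambda _ fun i => (hX i).aemeasurable

lemma lintegral_exp_mul_gaussianReal (v : NNReal) (t : ℝ) :
    ∫⁻ x, ENNReal.ofReal (Real.exp (t * x)) ∂(gaussianReal 0 v)
      = ENNReal.ofReal (Real.exp (v * t ^ 2 / 2)) := by
  rw [← ofReal_integral_eq_lintegral_ofReal (integrable_exp_mul_gaussianReal t)
    (Filter.Eventually.of_forall fun _ => (Real.exp_pos _).le)]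
  have := mgf_gaussianReal (p := gaussianReal 0 v) (X := id) (μ := 0) (v := v) (by simp) t
  rw [mgf] at this
  simp only [id_eq] at this
  rw [this]; simp

lemma inv_sqrt_one_sub_le {x : ℝ} (h0 : 0 ≤ x) (h1 : x ≤ 1 / 2) :
    √(1 / (1 - x)) ≤ Real.exp x := by
  rw [Real.sqrt_le_left (Real.exp_pos _).le, ← Real.exp_nat_mul, div_le_iff₀ (by linarith)]
  have := Real.add_one_le_exp ((2 : ℕ) * x)
  push_cast at *
  nlinarith

lemma lintegral_exp_mul_sq_gaussianReal {a : ℝ} (h0 : 0 ≤ a) (h1 : a ≤ 1 / 4) :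
    ∫⁻ x, ENNReal.ofReal (Real.exp (a * x ^ 2)) ∂(gaussianReal 0 1)
      ≤ ENNReal.ofReal (Real.exp (2 * a)) := by
  rw [gaussianReal_of_var_ne_zero _ one_ne_zero, lintegral_withDensity_eq_lintegral_mul _
    (measurable_gaussianPDF _ _) (by fun_prop)]
  have hb : 0 < 1 / 2 - a := by linarith
  have e : ∀ x : ℝ, (gaussianPDF 0 1 * fun x => ENNReal.ofReal (Real.exp (a * x ^ 2))) x
      = ENNReal.ofReal ((√(2 * Real.pi))⁻¹ * Real.exp (-(1 / 2 - a) * x ^ 2)) := by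
    intro x
    rw [Pi.mul_apply, gaussianPDF, ← ENNReal.ofReal_mul (gaussianPDFReal_nonneg _ _ _),
      gaussianPDFReal, mul_assoc, ← Real.exp_add]
    congr 1
    simp only [NNReal.coe_one, mul_one, sub_zero]
    congr 2
    ring
  simp_rw [e]
  rw [← ofReal_integral_eq_lintegral_ofReal ((integrable_exp_neg_mul_sq hb).const_mul _)
    (Filter.Eventually.of_forall fun _ => by positivity), integral_const_mul, integral_gaussian]
  refine ENNReal.ofReal_le_ofReal ?_
  have : (√(2 * Real.pi))⁻¹ * √(Real.pi / (1 / 2 - a)) = √(1 / (1 - 2 * a)) := by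
    rw [← Real.sqrt_inv, ← Real.sqrt_mul (by positivity)]
    congr 1
    have := Real.pi_pos.ne'
    have : 1 - 2 * a ≠ 0 := by linarith
    have : 1 / 2 - a ≠ 0 := by linarith
    field_simp
  rw [this]
  exact inv_sqrt_one_sub_le (by linarith) (by linarith)

/-- Gaussian linearization: `exp(l |x|²)` is the average of `exp(√(2l) ⟨W h, x⟩)` over standard
Gaussian `h`. After Fubini the hypothesis on linear exponentials applies, and in the eigenbasis `W`
of `A` a product of one-dimensional integrals of `exp(l a_k h_k²)` remains. The bounds `0 ≤ A ≤ 1`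
and `l ≤ 1/4` keep these in the range where they are at most `exp(2 l a_k)`. -/
lemma lintegral_exp_dotProduct_self_le {Ω : Type*} [MeasurableSpace Ω] {P : Measure Ω} [SFinite P]
    {d : ℕ} {w : Ω → Fin d → ℝ} (hw : AEMeasurable w P) {A : Matrix (Fin d) (Fin d) ℝ}
    (hA : A.IsHermitian) (hA0 : ∀ v, 0 ≤ v ⬝ᵥ (A *ᵥ v)) (hA1 : ∀ v, v ⬝ᵥ (A *ᵥ v) ≤ v ⬝ᵥ v)
    (hmgf : ∀ c, ∫⁻ ω, ENNReal.ofReal (Real.exp (c ⬝ᵥ w ω)) ∂P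
      ≤ ENNReal.ofReal (Real.exp (c ⬝ᵥ (A *ᵥ c) / 2)))
    {l : ℝ} (hl0 : 0 ≤ l) (hl1 : l ≤ 1 / 4) :
    ∫⁻ ω, ENNReal.ofReal (Real.exp (l * (w ω ⬝ᵥ w ω))) ∂P
      ≤ ENNReal.ofReal (Real.exp (2 * l * A.trace)) := by
  obtain ⟨a, W, hW, hW', hg⟩ := exists_orthogonal_diagonalization hA
  have hAd : A = W * diagonal a * Wᵀ := by
    have := hg id
    rwa [cfc_id ℝ _ hA.isSelfAdjoint] at this
  have hquad : ∀ v, v ⬝ᵥ (A *ᵥ v) = ∑ k, a k * (Wᵀ *ᵥ v) k ^ 2 := fun v => by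
    rw [hAd, dotProduct_conj_diagonal]
  have hWW : ∀ h, Wᵀ *ᵥ (W *ᵥ h) = h := fun h => by rw [mulVec_mulVec, hW, one_mulVec]
  have hsingle : ∀ k, ∑ j, a j * (Pi.single k (1 : ℝ) : Fin d → ℝ) j ^ 2 = a k := fun k => by
    rw [Finset.sum_eq_single k]
    · simp
    · intro j _ hj; simp [hj]
    · simp
  have ha0 : ∀ k, 0 ≤ a k := fun k => by
    have := hA0 (W *ᵥ Pi.single k 1)
    rwa [hquad, hWW, hsingle] at this
  have ha1 : ∀ k, a k ≤ 1 := fun k => by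
    have := hA1 (W *ᵥ Pi.single k 1)
    rw [hquad, hWW, hsingle, dotProduct_self_orthogonal hW', hWW] at this
    have e : ∑ j, (Pi.single k (1 : ℝ) : Fin d → ℝ) j ^ 2 = 1 := by
      rw [Finset.sum_eq_single k]
      · simp
      · intro j _ hj; simp [hj]
      · simp
    rwa [e] at this
  have htr : A.trace = ∑ k, a k := by rw [hAd, trace_conj_diagonal hW]
  have hsq : √(2 * l) ^ 2 = 2 * l := Real.sq_sqrt (by positivity)
  have h1 : ∀ x : Fin d → ℝ, ENNReal.ofReal (Real.exp (l * (x ⬝ᵥ x)))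
      = ∫⁻ h, ENNReal.ofReal (Real.exp ((√(2 * l) • (W *ᵥ h)) ⬝ᵥ x))
        ∂(Measure.pi fun _ : Fin d => gaussianReal 0 1) := by
    intro x
    have e : ∀ h : Fin d → ℝ, ENNReal.ofReal (Real.exp ((√(2 * l) • (W *ᵥ h)) ⬝ᵥ x))
        = ∏ k, ENNReal.ofReal (Real.exp ((√(2 * l) * (Wᵀ *ᵥ x) k) * h k)) := by
      intro h
      rw [← ENNReal.ofReal_prod_of_nonneg fun _ _ => (Real.exp_pos _).le, ← Real.exp_sum,
        smul_dotProduct, dotProduct_comm, dotProduct_mulVec, ← mulVec_transpose, dotProduct,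
        smul_eq_mul, Finset.mul_sum]
      congr 2
      exact Finset.sum_congr rfl fun k _ => by ring
    simp_rw [e]
    rw [lintegral_pi_prod (f := fun k y =>
      ENNReal.ofReal (Real.exp ((√(2 * l) * (Wᵀ *ᵥ x) k) * y))) _ (fun k => by fun_prop)]
    simp_rw [lintegral_exp_mul_gaussianReal]
    rw [← ENNReal.ofReal_prod_of_nonneg fun _ _ => (Real.exp_pos _).le, ← Real.exp_sum,
      dotProduct_self_orthogonal hW', Finset.mul_sum]
    congr 2
    refine Finset.sum_congr rfl fun k _ => ?_
    rw [mul_pow, hsq]; push_cast; ring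
  simp_rw [h1]
  rw [lintegral_lintegral_swap]
  · calc ∫⁻ h, ∫⁻ ω, ENNReal.ofReal (Real.exp ((√(2 * l) • (W *ᵥ h)) ⬝ᵥ w ω)) ∂P
          ∂(Measure.pi fun _ : Fin d => gaussianReal 0 1)
        ≤ ∫⁻ h, ∏ k, ENNReal.ofReal (Real.exp ((l * a k) * h k ^ 2))
          ∂(Measure.pi fun _ : Fin d => gaussianReal 0 1) := by
          refine lintegral_mono fun h => (hmgf _).trans (le_of_eq ?_)
          rw [← ENNReal.ofReal_prod_of_nonneg fun _ _ => (Real.exp_pos _).le, ← Real.exp_sum,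
            hquad, ← mulVec_smul, hWW, Finset.sum_div]
          congr 2
          refine Finset.sum_congr rfl fun k _ => ?_
          rw [Pi.smul_apply, smul_eq_mul, mul_pow, hsq]; ring
      _ = ∏ k, ∫⁻ y, ENNReal.ofReal (Real.exp ((l * a k) * y ^ 2)) ∂(gaussianReal 0 1) :=
          lintegral_pi_prod (f := fun k y => ENNReal.ofReal (Real.exp ((l * a k) * y ^ 2)))
            (fun _ : Fin d => gaussianReal 0 1) fun k => by fun_prop
      _ ≤ ∏ k, ENNReal.ofReal (Real.exp (2 * (l * a k))) := by
          refine Finset.prod_le_prod' fun k _ => lintegral_exp_mul_sq_gaussianReal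
            (mul_nonneg hl0 (ha0 k)) ?_
          nlinarith [ha0 k, ha1 k]
      _ = _ := by
          rw [← ENNReal.ofReal_prod_of_nonneg fun _ _ => (Real.exp_pos _).le, ← Real.exp_sum,
            htr, Finset.mul_sum]
          congr 2
          exact Finset.sum_congr rfl fun k _ => by ring
  · refine AEMeasurable.ennreal_ofReal (Real.measurable_exp.comp_aemeasurable ?_)
    simp only [dotProduct, mulVec, Pi.smul_apply, smul_eq_mul]
    refine Finset.aemeasurable_fun_sum _ fun i _ => AEMeasurable.mul ?_ ?_
    · refine Measurable.aemeasurable ?_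
      fun_prop
    · exact ((aemeasurable_pi_iff.1 hw) i).comp_fst

lemma pow_le_factorial_mul_exp {x l : ℝ} (hx : 0 ≤ x) (hl : 0 < l) (q : ℕ) :
    x ^ q ≤ (q / l) ^ q * Real.exp (l * x) := by
  have h1 := Real.pow_div_factorial_le_exp (l * x) (by positivity) q
  have h2 : ((q.factorial : ℕ) : ℝ) ≤ (q : ℝ) ^ q := by exact_mod_cast Nat.factorial_le_pow q
  rw [div_le_iff₀ (by positivity)] at h1
  have h3 : (l * x) ^ q ≤ Real.exp (l * x) * (q : ℝ) ^ q :=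
    h1.trans (mul_le_mul_of_nonneg_left h2 (Real.exp_pos _).le)
  rw [mul_pow] at h3
  rw [div_pow, div_mul_eq_mul_div, le_div_iff₀ (by positivity)]
  linarith

/-- Moments of a variable with a moment generating function of Poisson type. -/
lemma lintegral_pow_le_of_lintegral_exp_le {Ω : Type*} [MeasurableSpace Ω] {P : Measure Ω}
    {X : Ω → ℝ} (hX : ∀ ω, 0 ≤ X ω) {y T : ℝ} {q : ℕ} (hq : 0 < q) (hy : y ≤ T) (hqT : q ≤ T)
    (h : ∀ l, 0 ≤ l → l ≤ 1 / 4 →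
      ∫⁻ ω, ENNReal.ofReal (Real.exp (l * X ω)) ∂P ≤ ENNReal.ofReal (Real.exp (4 * l * y))) :
    ∫⁻ ω, ENNReal.ofReal (X ω ^ q) ∂P ≤ ENNReal.ofReal ((12 * T) ^ q) := by
  have hq' : (0 : ℝ) < q := by exact_mod_cast hq
  have hT : 0 < T := hq'.trans_le hqT
  -- With this `l` the exponent `4 l y` is at most `q`, and `q / l = 4T`; the result is `(4eT)^q`,
  -- where `4e < 12`. The condition `l ≤ 1/4` is `q ≤ T`.
  set l : ℝ := q / (4 * T) with hl
  have hl0 : 0 < l := by positivity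
  have hl1 : l ≤ 1 / 4 := by
    rw [hl, div_le_iff₀ (by positivity)]; linarith
  calc ∫⁻ ω, ENNReal.ofReal (X ω ^ q) ∂P
      ≤ ∫⁻ ω, ENNReal.ofReal ((q / l) ^ q) * ENNReal.ofReal (Real.exp (l * X ω)) ∂P := by
        refine lintegral_mono fun ω => ?_
        rw [← ENNReal.ofReal_mul (by positivity)]
        exact ENNReal.ofReal_le_ofReal (pow_le_factorial_mul_exp (hX ω) hl0 q)
    _ = ENNReal.ofReal ((q / l) ^ q) * ∫⁻ ω, ENNReal.ofReal (Real.exp (l * X ω)) ∂P :=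
        lintegral_const_mul' _ _ ENNReal.ofReal_ne_top
    _ ≤ ENNReal.ofReal ((q / l) ^ q) * ENNReal.ofReal (Real.exp (4 * l * y)) := by
        gcongr; exact h l hl0.le hl1
    _ ≤ ENNReal.ofReal ((12 * T) ^ q) := by
        rw [← ENNReal.ofReal_mul (by positivity)]
        refine ENNReal.ofReal_le_ofReal ?_
        have e1 : (q : ℝ) / l = 4 * T := by rw [hl]; field_simp
        have e2 : 4 * l * y ≤ q * 1 := by
          calc 4 * l * y ≤ 4 * l * T := by gcongr
            _ = q * 1 := by rw [hl]; field_simp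
        rw [e1]
        calc (4 * T) ^ q * Real.exp (4 * l * y) ≤ (4 * T) ^ q * Real.exp (q * 1) := by gcongr
          _ = (4 * T * Real.exp 1) ^ q := by
            rw [Real.exp_nat_mul, ← mul_pow]
          _ ≤ (12 * T) ^ q := by
            have := Real.exp_one_lt_d9
            gcongr ?_ ^ q
            nlinarith

/-! ### The OSNAP distribution -/

instance {m s : ℕ} (γ : Fin s) (i : Fin m) : Decidable (i ∈ block m s γ) :=
  inferInstanceAs (Decidable (_ ∧ _))

/-! ### The blocks of rows and their uniform laws. -/

section Blocks

variable {m s : ℕ} {p : ℝ}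

lemma mul_div_eq_one (hs : (s : ℝ) = p * m) (hd : s ∣ m) (γ : Fin s) :
    p * ((m / s : ℕ) : ℝ) = 1 := by
  obtain ⟨b, rfl⟩ := hd
  have h0 : 0 < s := γ.pos
  have h0' : (s : ℝ) ≠ 0 := by exact_mod_cast h0.ne'
  rw [Nat.mul_div_cancel_left _ h0]
  push_cast at hs
  have : (s : ℝ) * (p * b) = s * 1 := by linarith
  exact mul_left_cancel₀ h0' this

lemma mem_block_iff (hs : (s : ℝ) = p * m) (hd : s ∣ m) (γ : Fin s) (i : Fin m) :
    i ∈ block m s γ ↔ (γ : ℕ) = i / (m / s) := by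
  have hb : 0 < m / s := by
    have := mul_div_eq_one hs hd γ
    rcases Nat.eq_zero_or_pos (m / s) with h | h
    · rw [h] at this; simp at this
    · exact h
  have e : i ∈ block m s γ ↔ m / s * (γ : ℕ) ≤ (i : ℕ) ∧ (i : ℕ) < m / s * ((γ : ℕ) + 1) := Iff.rfl
  rw [e, eq_comm, Nat.div_eq_iff hb]
  have : m / s * ((γ : ℕ) + 1) = γ * (m / s) + m / s := by ring
  rw [this, mul_comm]
  omega

/-- The blocks partition the rows: only `γ = i / (m / s)` contributes. -/
lemma sum_ite_mem_block (hs : (s : ℝ) = p * m) (hd : s ∣ m) (i : Fin m) (c : ℝ) (h0 : 0 < s) :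
    ∑ γ : Fin s, (if i ∈ block m s γ then c else 0) = c := by
  have hlt : (i : ℕ) / (m / s) < s := by
    rw [Nat.div_lt_iff_lt_mul, Nat.mul_div_cancel' hd]
    · exact i.2
    · exact Nat.div_pos (Nat.le_of_dvd i.pos hd) h0
  rw [Finset.sum_eq_single ⟨(i : ℕ) / (m / s), hlt⟩]
  · rw [if_pos]; rw [mem_block_iff hs hd]
  · intro γ _ hγ
    rw [if_neg]
    rw [mem_block_iff hs hd]
    exact fun h => hγ (Fin.ext h)
  · simp

lemma card_filter_mem_block (hd : s ∣ m) (γ : Fin s) :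
    (Finset.univ.filter fun i => i ∈ block m s γ).card = m / s := by
  have : (Finset.univ.filter fun i => i ∈ block m s γ).map Fin.valEmbedding
      = Finset.Ico (m / s * γ) (m / s * (γ + 1)) := by
    ext a
    simp only [Finset.mem_map, Finset.mem_filter, Finset.mem_univ, true_and,
      Fin.valEmbedding_apply, Finset.mem_Ico]
    constructor
    · rintro ⟨i, hi, rfl⟩; exact hi
    · intro h
      have : a < m := h.2.trans_le <| by
        calc m / s * (γ + 1) ≤ m / s * s := Nat.mul_le_mul_left _ γ.2
          _ = m := Nat.div_mul_cancel hd
      exact ⟨⟨a, this⟩, h, rfl⟩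
  rw [← Finset.card_map Fin.valEmbedding, this, Nat.card_Ico, ← Nat.mul_sub]
  simp

/-- A block has `m / s = 1 / p` elements. -/
lemma uniformOn_block_singleton (hs : (s : ℝ) = p * m) (hd : s ∣ m) (γ : Fin s) (i : Fin m) :
    uniformOn (block m s γ) {i} = ENNReal.ofReal (if i ∈ block m s γ then p else 0) := by
  have hp := mul_div_eq_one hs hd γ
  have hb : 0 < m / s := by
    rcases Nat.eq_zero_or_pos (m / s) with h | h
    · rw [h] at hp; simp at hp
    · exact h
  have e : block m s γ = ((Finset.univ.filter fun i => i ∈ block m s γ : Finset (Fin m)) : Set _) := by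
    ext; simp
  have e2 : ({i} : Set (Fin m)) = (({i} : Finset (Fin m)) : Set _) := by simp
  conv_lhs => rw [e, e2, uniformOn_apply_finset, card_filter_mem_block hd]
  split_ifs with h
  · have : (Finset.univ.filter fun i => i ∈ block m s γ) ∩ {i} = {i} := by
      ext a; simp only [Finset.mem_inter, Finset.mem_filter, Finset.mem_univ, true_and,
        Finset.mem_singleton]
      exact ⟨fun h => h.2, fun ha => ⟨ha ▸ h, ha⟩⟩
    rw [this, Finset.card_singleton, eq_div_of_mul_eq (by positivity) hp,
      ENNReal.ofReal_div_of_pos (by positivity)]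
    simp
  · have : (Finset.univ.filter fun i => i ∈ block m s γ) ∩ {i} = ∅ := by
      ext a; simp only [Finset.mem_inter, Finset.mem_filter, Finset.mem_univ, true_and,
        Finset.mem_singleton, Finset.notMem_empty, iff_false]
      rintro ⟨h1, rfl⟩; exact h h1
    rw [this]; simp

lemma isProbabilityMeasure_uniformOn_block (hs : (s : ℝ) = p * m) (hd : s ∣ m) (γ : Fin s) :
    IsProbabilityMeasure (uniformOn (block m s γ)) := by
  refine isProbabilityMeasure_uniformOn (Set.toFinite _) ?_
  by_contra h
  have h1 := card_filter_mem_block hd γ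
  rw [Set.not_nonempty_iff_eq_empty] at h
  simp only [h, Set.mem_empty_iff_false, Finset.filter_false, Finset.card_empty] at h1
  have hp := mul_div_eq_one hs hd γ
  rw [← h1] at hp
  simp at hp

lemma lintegral_uniformOn_block (hs : (s : ℝ) = p * m) (hd : s ∣ m) (γ : Fin s)
    (f : Fin m → ℝ≥0∞) :
    ∫⁻ i, f i ∂(uniformOn (block m s γ))
      = ∑ i, ENNReal.ofReal (if i ∈ block m s γ then p else 0) * f i := by
  rw [lintegral_fintype]
  exact Finset.sum_congr rfl fun i _ => by
    rw [uniformOn_block_singleton hs hd, mul_comm]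

end Blocks

/-! ### The Rademacher law. -/

instance : IsProbabilityMeasure rademacher := by
  constructor
  simp [rademacher, ENNReal.inv_two_add_inv_two]

lemma ae_rademacher : ∀ᵐ y ∂rademacher, |y| = 1 := by
  rw [rademacher, ae_add_measure_iff]
  constructor <;> refine Measure.ae_smul_measure ?_ _ <;>
    rw [ae_dirac_iff (measurableSet_eq_fun (by fun_prop) (by fun_prop))] <;> simp

lemma integral_id_rademacher : ∫ y, y ∂rademacher = 0 := by
  rw [rademacher, integral_add_measure, integral_smul_measure, integral_smul_measure]
  · simp
  · exact (integrable_dirac (by simp)).smul_measure (by simp)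
  · exact (integrable_dirac (by simp)).smul_measure (by simp)

lemma lintegral_exp_mul_rademacher_le (b : ℝ) :
    ∫⁻ y, ENNReal.ofReal (Real.exp (b * y)) ∂rademacher
      ≤ ENNReal.ofReal (Real.exp (b ^ 2 / 2)) := by
  rw [rademacher, lintegral_add_measure, lintegral_smul_measure, lintegral_smul_measure,
    lintegral_dirac, lintegral_dirac]
  have h2 : (2⁻¹ : ℝ≥0∞) = ENNReal.ofReal 2⁻¹ := by
    rw [ENNReal.ofReal_inv_of_pos (by norm_num)]; simp
  rw [h2, smul_eq_mul, smul_eq_mul, ← ENNReal.ofReal_mul (by norm_num),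
    ← ENNReal.ofReal_mul (by norm_num), ← ENNReal.ofReal_add (by positivity) (by positivity)]
  refine ENNReal.ofReal_le_ofReal (le_trans (le_of_eq ?_) (Real.cosh_le_exp_half_sq b))
  rw [Real.cosh_eq]
  ring_nf

/-! ### Exponential moments of the rows of an OSNAP matrix times `U`. -/

section GenLaw

variable {m n s d : ℕ} {p : ℝ}

lemma hasLaw_sign (hs : (s : ℝ) = p * m) (hd : s ∣ m) (x : Fin n × Fin s) :
    MeasurePreserving (fun z : Gen m n s => z.1 x) (genLaw m n s) rademacher := by
  have := fun x : Fin n × Fin s => isProbabilityMeasure_uniformOn_block hs hd x.2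
  exact (measurePreserving_eval (fun _ : Fin n × Fin s => rademacher) x).comp
    measurePreserving_fst

lemma hasLaw_index (hs : (s : ℝ) = p * m) (hd : s ∣ m) (x : Fin n × Fin s) :
    MeasurePreserving (fun z : Gen m n s => z.2 x) (genLaw m n s) (uniformOn (block m s x.2)) := by
  have := fun x : Fin n × Fin s => isProbabilityMeasure_uniformOn_block hs hd x.2
  exact (measurePreserving_eval (fun x : Fin n × Fin s => uniformOn (block m s x.2)) x).comp
    measurePreserving_snd

lemma ae_abs_sign (hs : (s : ℝ) = p * m) (hd : s ∣ m) :
    ∀ᵐ z ∂(genLaw m n s), ∀ x, |z.1 x| = 1 :=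
  ae_all_iff.2 fun x => (hasLaw_sign hs hd x).quasiMeasurePreserving.ae ae_rademacher

lemma ae_pi_mem_block (hs : (s : ℝ) = p * m) (hd : s ∣ m) :
    ∀ᵐ y ∂(Measure.pi fun x : Fin n × Fin s => uniformOn (block m s x.2)),
      ∀ x, y x ∈ block m s x.2 := by
  have := fun x : Fin n × Fin s => isProbabilityMeasure_uniformOn_block hs hd x.2
  refine ae_all_iff.2 fun x => (measurePreserving_eval
    (fun x : Fin n × Fin s => uniformOn (block m s x.2)) x).quasiMeasurePreserving.ae ?_
  exact ae_cond_mem (Set.toFinite _).measurableSet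

lemma measurable_genMatrix : Measurable (genMatrix : Gen m n s → _) := by
  refine measurable_pi_iff.2 fun i => measurable_pi_iff.2 fun l => ?_
  have : (fun z : Gen m n s => genMatrix z i l)
      = fun z => ∑ x : Fin n × Fin s, if z.2 x = i ∧ x.1 = l then z.1 x else 0 := by
    ext z
    simp only [genMatrix, Matrix.sum_apply, Matrix.single_apply]
  change Measurable fun z : Gen m n s => genMatrix z i l
  rw [this]
  refine Finset.measurable_fun_sum _ fun x _ => Measurable.ite ?_ (by fun_prop) (by fun_prop)
  have h1 : MeasurableSet {z : Gen m n s | z.2 x = i} :=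
    measurableSet_eq_fun (by fun_prop) (by fun_prop)
  exact h1.inter (MeasurableSet.const _)

lemma genMatrix_mul_row (z : Gen m n s) (U : Matrix (Fin n) (Fin d) ℝ) (i : Fin m) :
    (genMatrix z * U) i = ∑ x : Fin n × Fin s, (if z.2 x = i then z.1 x else 0) • U x.1 := by
  ext a
  rw [genMatrix, Matrix.sum_mul, Matrix.sum_apply, Finset.sum_apply]
  refine Finset.sum_congr rfl fun x _ => ?_
  split_ifs with h
  · subst h; rw [Matrix.single_mul_apply_same]; simp
  · rw [Matrix.single_mul_apply_of_ne _ _ _ _ _ (Ne.symm h)]; simp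

lemma sum_row_dotProduct_sq {U : Matrix (Fin n) (Fin d) ℝ} (hU : Uᵀ * U = 1) (v : Fin d → ℝ) :
    ∑ l, (U l ⬝ᵥ v) ^ 2 = v ⬝ᵥ v := by
  have : (U *ᵥ v) ⬝ᵥ (U *ᵥ v) = v ⬝ᵥ v := by
    rw [dotProduct_mulVec, ← mulVec_transpose, mulVec_mulVec, hU, one_mulVec]
  rw [← this]
  exact Finset.sum_congr rfl fun l _ => by rw [sq]; rfl

lemma sum_row_dotProduct_self {U : Matrix (Fin n) (Fin d) ℝ} (hU : Uᵀ * U = 1) :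
    ∑ l, U l ⬝ᵥ U l = d := by
  have : (Uᵀ * U).trace = d := by rw [hU]; simp
  rw [← this, trace_mul_comm]
  rfl

/-- `U Uᵀ` is a projection: in `∑_j (u_j ⬝ᵥ u_l)² = u_l ⬝ᵥ u_l` keep only the term `j = l`. -/
lemma row_dotProduct_self_le_one {U : Matrix (Fin n) (Fin d) ℝ} (hU : Uᵀ * U = 1) (l : Fin n) :
    U l ⬝ᵥ U l ≤ 1 := by
  have h := sum_row_dotProduct_sq hU (U l)
  have h1 : (U l ⬝ᵥ U l) ^ 2 ≤ U l ⬝ᵥ U l := by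
    refine le_of_le_of_eq ?_ h
    exact Finset.single_le_sum (f := fun j => (U j ⬝ᵥ U l) ^ 2) (fun j _ => sq_nonneg _)
      (Finset.mem_univ l)
  nlinarith [sq_nonneg (U l ⬝ᵥ U l - 1)]

lemma lintegral_exp_sum_sign_le {w : Fin n × Fin s → Fin d → ℝ} (c : Fin d → ℝ) :
    ∫⁻ ξ, ENNReal.ofReal (Real.exp (c ⬝ᵥ ∑ x, ξ x • w x))
        ∂(Measure.pi fun _ : Fin n × Fin s => rademacher)
      ≤ ENNReal.ofReal (Real.exp ((∑ x, (w x ⬝ᵥ c) ^ 2) / 2)) := by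
  have e : ∀ ξ : Fin n × Fin s → ℝ, ENNReal.ofReal (Real.exp (c ⬝ᵥ ∑ x, ξ x • w x))
      = ∏ x, ENNReal.ofReal (Real.exp ((w x ⬝ᵥ c) * ξ x)) := by
    intro ξ
    rw [← ENNReal.ofReal_prod_of_nonneg fun _ _ => (Real.exp_pos _).le, ← Real.exp_sum,
      dotProduct_sum]
    congr 2
    exact Finset.sum_congr rfl fun x _ => by
      rw [dotProduct_smul, smul_eq_mul, mul_comm, dotProduct_comm]
  simp_rw [e]
  rw [lintegral_pi_prod (f := fun x y => ENNReal.ofReal (Real.exp ((w x ⬝ᵥ c) * y))) _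
    (fun x => by fun_prop), Finset.sum_div, Real.exp_sum,
    ENNReal.ofReal_prod_of_nonneg fun _ _ => (Real.exp_pos _).le]
  exact Finset.prod_le_prod' fun x _ => lintegral_exp_mul_rademacher_le _

lemma exp_sub_one_le_two_mul {y : ℝ} (h0 : 0 ≤ y) (h1 : y ≤ 1) : Real.exp y - 1 ≤ 2 * y := by
  have := Real.abs_exp_sub_one_le (x := y) (by rwa [abs_of_nonneg h0])
  rw [abs_of_nonneg h0] at this
  exact (le_abs_self _).trans this

/-- Condition on the positions `y`. The row is then a Rademacher sum with covariance `A = ∑ 1[y_x =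
i] u_l u_lᵀ ≤ 1`, so its squared norm has exponential moment at most `exp(2 l Tr A)`. The indicators
are independent, and `1 + p (e^{2lv} - 1) ≤ e^{4lpv}` for `v = |u_l|²`; the exponents add up to `4 l
p d`. -/
lemma lintegral_exp_row_law_le (hp0 : 0 < p) (hs : (s : ℝ) = p * m) (hd : s ∣ m)
    {U : Matrix (Fin n) (Fin d) ℝ} (hU : Uᵀ * U = 1) (i : Fin m) {l : ℝ} (hl0 : 0 ≤ l)
    (hl1 : l ≤ 1 / 4) :
    ∫⁻ S, ENNReal.ofReal (Real.exp (l * ((S * U) i ⬝ᵥ (S * U) i))) ∂(law m n s)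
      ≤ ENNReal.ofReal (Real.exp (4 * l * (p * d))) := by
  have h0 : 0 < s := by
    have : (0 : ℝ) < s := by rw [hs]; have := i.pos; positivity
    exact_mod_cast this
  have hprob := fun x : Fin n × Fin s => isProbabilityMeasure_uniformOn_block hs hd x.2
  have hmeas : Measurable fun S : Matrix (Fin m) (Fin n) ℝ =>
      ENNReal.ofReal (Real.exp (l * ((S * U) i ⬝ᵥ (S * U) i))) := by
    refine (Continuous.measurable ?_).ennreal_ofReal
    simp only [dotProduct, Matrix.mul_apply]
    fun_prop
  rw [law, lintegral_map hmeas measurable_genMatrix, genLaw]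
  refine (lintegral_prod_symm _ (hmeas.comp measurable_genMatrix).aemeasurable).trans_le ?_
  have hin : ∀ᵐ y ∂(Measure.pi fun x : Fin n × Fin s => uniformOn (block m s x.2)),
      ∫⁻ ξ, ENNReal.ofReal (Real.exp (l * ((genMatrix (ξ, y) * U) i ⬝ᵥ (genMatrix (ξ, y) * U) i)))
        ∂(Measure.pi fun _ : Fin n × Fin s => rademacher)
      ≤ ∏ x : Fin n × Fin s,
        ENNReal.ofReal (Real.exp (if y x = i then 2 * l * (U x.1 ⬝ᵥ U x.1) else 0)) := by
    filter_upwards [ae_pi_mem_block hs hd] with y hy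
    set w : Fin n × Fin s → Fin d → ℝ := fun x => (if y x = i then (1 : ℝ) else 0) • U x.1 with hw
    set A : Matrix (Fin d) (Fin d) ℝ := ∑ x, vecMulVec (w x) (w x) with hA
    have hrow : ∀ ξ : Fin n × Fin s → ℝ, (genMatrix (ξ, y) * U) i = ∑ x, ξ x • w x := by
      intro ξ
      rw [genMatrix_mul_row]
      refine Finset.sum_congr rfl fun x _ => ?_
      simp only [hw, smul_smul]
      split_ifs <;> simp
    have hquad : ∀ v, v ⬝ᵥ (A *ᵥ v) = ∑ x, (w x ⬝ᵥ v) ^ 2 := by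
      intro v
      rw [hA, Matrix.sum_mulVec, dotProduct_sum]
      refine Finset.sum_congr rfl fun x _ => ?_
      rw [vecMulVec_mulVec, op_smul_eq_smul, dotProduct_smul, smul_eq_mul, dotProduct_comm v]; ring
    have htr : A.trace = ∑ x : Fin n × Fin s, if y x = i then U x.1 ⬝ᵥ U x.1 else 0 := by
      rw [hA, trace_sum]
      refine Finset.sum_congr rfl fun x _ => ?_
      rw [trace_vecMulVec]
      simp only [hw]
      split_ifs <;> simp
    have hAh : A.IsHermitian := by
      rw [hA, Matrix.IsHermitian, conjTranspose_eq_transpose_of_trivial, transpose_sum]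
      exact Finset.sum_congr rfl fun x _ => by rw [transpose_vecMulVec]
    simp_rw [hrow]
    refine (lintegral_exp_dotProduct_self_le ?_ hAh (fun v => ?_) (fun v => ?_) (fun c => ?_)
      hl0 hl1).trans (le_of_eq ?_)
    · refine Measurable.aemeasurable ?_
      fun_prop
    · rw [hquad]; positivity
    · rw [hquad, ← sum_row_dotProduct_sq hU v, Fintype.sum_prod_type]
      refine Finset.sum_le_sum fun j _ => ?_
      -- Row `i` lies in exactly one block, so column `j` meets it at most once. This is what gives
      -- `A ≤ 1`, rather than only `A ≤ s`.
      calc ∑ γ, (w (j, γ) ⬝ᵥ v) ^ 2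
          ≤ ∑ γ : Fin s, if i ∈ block m s γ then (U j ⬝ᵥ v) ^ 2 else 0 := by
            refine Finset.sum_le_sum fun γ _ => ?_
            simp only [hw]
            by_cases h : y (j, γ) = i
            · have := hy (j, γ)
              rw [h] at this
              rw [if_pos h, if_pos this, one_smul]
            · rw [if_neg h, zero_smul, zero_dotProduct]
              split_ifs
              · simpa using sq_nonneg (U j ⬝ᵥ v)
              · simp
        _ = (U j ⬝ᵥ v) ^ 2 := sum_ite_mem_block hs hd i _ h0
    · rw [hquad]; exact lintegral_exp_sum_sign_le c
    · rw [← ENNReal.ofReal_prod_of_nonneg fun _ _ => (Real.exp_pos _).le, ← Real.exp_sum, htr,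
        Finset.mul_sum]
      congr 2
      exact Finset.sum_congr rfl fun x _ => by split_ifs <;> simp
  refine (lintegral_mono_ae hin).trans ?_
  refine (lintegral_pi_prod (f := fun (x : Fin n × Fin s) (y : Fin m) =>
    ENNReal.ofReal (Real.exp (if y = i then 2 * l * (U x.1 ⬝ᵥ U x.1) else 0))) _
    (fun x => measurable_of_finite _)).trans_le ?_
  have hx : ∀ x : Fin n × Fin s, ∫⁻ y, ENNReal.ofReal
      (Real.exp (if y = i then 2 * l * (U x.1 ⬝ᵥ U x.1) else 0)) ∂(uniformOn (block m s x.2))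
      ≤ ENNReal.ofReal (Real.exp (if i ∈ block m s x.2 then 4 * l * p * (U x.1 ⬝ᵥ U x.1) else 0)) := by
    intro x
    have hu0 : 0 ≤ U x.1 ⬝ᵥ U x.1 := Finset.sum_nonneg fun _ _ => mul_self_nonneg _
    have hu1 := row_dotProduct_self_le_one hU x.1
    set E := Real.exp (2 * l * (U x.1 ⬝ᵥ U x.1)) with hE
    have hE1 : 1 ≤ E := Real.one_le_exp (by positivity)
    have e : ∀ y : Fin m, ENNReal.ofReal
        (Real.exp (if y = i then 2 * l * (U x.1 ⬝ᵥ U x.1) else 0))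
        = 1 + if y = i then ENNReal.ofReal (E - 1) else 0 := by
      intro y
      split_ifs
      · rw [← ENNReal.ofReal_one, ← ENNReal.ofReal_add (by norm_num) (by linarith)]
        congr 1; ring
      · simp
    simp_rw [e]
    rw [lintegral_add_left (by fun_prop), lintegral_const, measure_univ, mul_one,
      lintegral_uniformOn_block hs hd]
    simp only [mul_ite, mul_zero, Finset.sum_ite_eq', Finset.mem_univ, if_true]
    split_ifs with h
    · rw [← ENNReal.ofReal_mul hp0.le, ← ENNReal.ofReal_one,
        ← ENNReal.ofReal_add (by norm_num) (mul_nonneg hp0.le (by linarith))]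
      refine ENNReal.ofReal_le_ofReal ?_
      -- The argument `2 l |u_l|²` is at most `1/2`, within the range of `exp_sub_one_le_two_mul`.
      have h1 : E - 1 ≤ 2 * (2 * l * (U x.1 ⬝ᵥ U x.1)) :=
        exp_sub_one_le_two_mul (by positivity) (by nlinarith)
      have h2 := Real.add_one_le_exp (4 * l * p * (U x.1 ⬝ᵥ U x.1))
      nlinarith [mul_le_mul_of_nonneg_left h1 hp0.le]
    · simp
  refine (Finset.prod_le_prod' fun x _ => hx x).trans (le_of_eq ?_)
  rw [← ENNReal.ofReal_prod_of_nonneg fun _ _ => (Real.exp_pos _).le, ← Real.exp_sum,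
    Fintype.sum_prod_type]
  congr 2
  simp_rw [sum_ite_mem_block hs hd i _ h0]
  rw [← Finset.mul_sum, sum_row_dotProduct_self hU]
  ring

end GenLaw

/-! ### Variables with all moments -/

section AllMoments

variable {Ω : Type*} [MeasurableSpace Ω] {P : Measure Ω}

/-- All moments of `f` are finite. -/
def AllMoments (f : Ω → ℝ) (P : Measure Ω) : Prop := ∀ r : ℝ≥0∞, r ≠ ∞ → MemLp f r P

lemma AllMoments.integrable {f : Ω → ℝ} (hf : AllMoments f P) : Integrable f P :=
  memLp_one_iff_integrable.1 (hf 1 (by simp))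

lemma AllMoments.add {f g : Ω → ℝ} (hf : AllMoments f P) (hg : AllMoments g P) :
    AllMoments (fun ω => f ω + g ω) P := fun r hr => (hf r hr).add (hg r hr)

lemma AllMoments.mul {f g : Ω → ℝ} (hf : AllMoments f P) (hg : AllMoments g P) :
    AllMoments (fun ω => f ω * g ω) P := fun r hr => by
  have : ENNReal.HolderTriple (2 * r) (2 * r) r := ⟨by
    rw [ENNReal.mul_inv (by simp) (by simp), ← add_mul, ENNReal.inv_two_add_inv_two, one_mul]⟩
  exact (hg (2 * r) (ENNReal.mul_ne_top (by simp) hr)).mul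
    (hf (2 * r) (ENNReal.mul_ne_top (by simp) hr))

lemma AllMoments.sum {ι : Type*} {s : Finset ι} {f : ι → Ω → ℝ}
    (hf : ∀ i ∈ s, AllMoments (f i) P) : AllMoments (fun ω => ∑ i ∈ s, f i ω) P :=
  fun r hr => memLp_finsetSum s fun i hi => hf i hi r hr

lemma allMoments_matrix_mul {a b c : ℕ} {A : Ω → Matrix (Fin a) (Fin b) ℝ}
    {B : Ω → Matrix (Fin b) (Fin c) ℝ} (hA : ∀ i j, AllMoments (fun ω => A ω i j) P)
    (hB : ∀ i j, AllMoments (fun ω => B ω i j) P) (i : Fin a) (j : Fin c) :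
    AllMoments (fun ω => (A ω * B ω) i j) P := by
  simp only [Matrix.mul_apply]
  exact AllMoments.sum fun k _ => (hA i k).mul (hB k j)

lemma IsGaussianMatrix.allMoments {m n : ℕ} {G : Ω → Matrix (Fin m) (Fin n) ℝ} {v : NNReal}
    (hG : IsGaussianMatrix G v P) (i : Fin m) (j : Fin n) : AllMoments (fun ω => G ω i j) P := by
  intro r hr
  have h := hG.hasLaw i j
  have := memLp_id_gaussianReal' (μ := 0) (v := v) r hr
  rw [← h.map_eq, memLp_map_measure_iff (by fun_prop) h.aemeasurable] at this
  exact this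

variable [IsProbabilityMeasure P]

lemma allMoments_of_ae_bound {f : Ω → ℝ} (hf : AEMeasurable f P) {C : ℝ}
    (h : ∀ᵐ ω ∂P, |f ω| ≤ C) : AllMoments f P :=
  fun _ _ => MemLp.of_bound hf.aestronglyMeasurable C h

lemma allMoments_const (c : ℝ) : AllMoments (fun _ : Ω => c) P := fun _ _ => memLp_const c

lemma AllMoments.const_mul {f : Ω → ℝ} (c : ℝ) (hf : AllMoments f P) :
    AllMoments (fun ω => c * f ω) P := (allMoments_const c).mul hf

lemma allMoments_matrix_pow {a : ℕ} {A : Ω → Matrix (Fin a) (Fin a) ℝ}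
    (hA : ∀ i j, AllMoments (fun ω => A ω i j) P) (N : ℕ) (i j : Fin a) :
    AllMoments (fun ω => (A ω ^ N) i j) P := by
  induction N generalizing i j with
  | zero => simp only [pow_zero]; exact allMoments_const _
  | succ N ih => simp only [pow_succ]; exact allMoments_matrix_mul ih hA i j

lemma allMoments_list_prod {a k : ℕ} {A : Fin k → Ω → Matrix (Fin a) (Fin a) ℝ}
    (hA : ∀ r i j, AllMoments (fun ω => A r ω i j) P) (i j : Fin a) :
    AllMoments (fun ω => (List.ofFn fun r => A r ω).prod i j) P := by
  induction k generalizing i j with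
  | zero => simp only [List.ofFn_zero, List.prod_nil]; exact allMoments_const _
  | succ k ih =>
    simp only [List.ofFn_succ, List.prod_cons]
    exact allMoments_matrix_mul (hA 0) (ih fun r => hA r.succ) i j

lemma allMoments_ntr {a : ℕ} {A : Ω → Matrix (Fin a) (Fin a) ℝ}
    (hA : ∀ i j, AllMoments (fun ω => A ω i j) P) : AllMoments (fun ω => ntr (A ω)) P := by
  simp only [ntr, trace]
  exact AllMoments.const_mul _ (AllMoments.sum fun i _ => hA i i)

lemma allMoments_interp {m n : ℕ} {t : ℝ} {S G : Ω → Matrix (Fin m) (Fin n) ℝ}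
    (hS : ∀ i j, AllMoments (fun ω => S ω i j) P) (hG : ∀ i j, AllMoments (fun ω => G ω i j) P)
    (i : Fin m) (j : Fin n) : AllMoments (fun ω => interp t (S ω) (G ω) i j) P := by
  simp only [interp, Matrix.add_apply, Matrix.smul_apply, smul_eq_mul]
  exact ((hS i j).const_mul _).add ((hG i j).const_mul _)

lemma allMoments_Gam {m n d : ℕ} (U : Matrix (Fin n) (Fin d) ℝ)
    {A B : Ω → Matrix (Fin m) (Fin n) ℝ}
    (hA : ∀ i j, AllMoments (fun ω => A ω i j) P) (hB : ∀ i j, AllMoments (fun ω => B ω i j) P)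
    (i j : Fin d) : AllMoments (fun ω => Gam U (A ω) (B ω) i j) P := by
  have hA' := fun i j => allMoments_matrix_mul hA (B := fun _ => U) (fun i j => allMoments_const _) i j
  have hB' := fun i j => allMoments_matrix_mul hB (B := fun _ => U) (fun i j => allMoments_const _) i j
  simp only [Gam, Matrix.add_apply]
  exact (allMoments_matrix_mul (A := fun ω => (A ω * U)ᵀ) (fun i j => hA' j i) hB' i j).add
    (allMoments_matrix_mul (A := fun ω => (B ω * U)ᵀ) (fun i j => hB' j i) hA' i j)

lemma abs_genMatrix_apply_le {m n s : ℕ} {z : Gen m n s} (hz : ∀ x, |z.1 x| = 1) (i : Fin m)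
    (j : Fin n) : |genMatrix z i j| ≤ Fintype.card (Fin n × Fin s) := by
  rw [genMatrix, Matrix.sum_apply]
  refine (Finset.abs_sum_le_sum_abs _ _).trans ?_
  refine (Finset.sum_le_card_nsmul _ _ 1 fun x _ => ?_).trans (by simp)
  rw [Matrix.single_apply]
  split_ifs
  · exact (hz x).le
  · simp

lemma allMoments_of_hasLaw_law {m n s : ℕ} {p : ℝ} (hs : (s : ℝ) = p * m) (hd : s ∣ m)
    {S : Ω → Matrix (Fin m) (Fin n) ℝ} (hS : HasLaw S (law m n s) P) (i : Fin m) (j : Fin n) :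
    AllMoments (fun ω => S ω i j) P := by
  have hm : Measurable fun M : Matrix (Fin m) (Fin n) ℝ => M i j :=
    (measurable_pi_apply j).comp (measurable_pi_apply i)
  refine allMoments_of_ae_bound (hm.comp_aemeasurable hS.aemeasurable)
    (C := Fintype.card (Fin n × Fin s)) ?_
  have hmeas : MeasurableSet {M : Matrix (Fin m) (Fin n) ℝ |
      |M i j| ≤ (Fintype.card (Fin n × Fin s) : ℝ)} := by
    have : Measurable fun M : Matrix (Fin m) (Fin n) ℝ => |M i j| := by
      simpa using hm.abs
    exact this measurableSet_Iic
  have : ∀ᵐ M ∂(law m n s), |M i j| ≤ (Fintype.card (Fin n × Fin s) : ℝ) := by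
    rw [law, ae_map_iff measurable_genMatrix.aemeasurable hmeas]
    filter_upwards [ae_abs_sign hs hd] with z hz
    exact abs_genMatrix_apply_le hz i j
  rw [← hS.map_eq, ae_map_iff hS.aemeasurable hmeas] at this
  exact this

end AllMoments

/-! ### Second moments -/

section SecondMoment

variable {m n s d : ℕ} {p : ℝ}

lemma variance_id_rademacher : Var[fun y => y; rademacher] = 1 := by
  rw [variance_of_integral_eq_zero (by fun_prop) integral_id_rademacher]
  rw [integral_congr_ae (g := fun _ => (1 : ℝ))]
  · simp
  · filter_upwards [ae_rademacher] with y hy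
    rw [← sq_abs, hy, one_pow]

lemma memLp_id_rademacher : MemLp id 2 rademacher :=
  MemLp.of_bound (by fun_prop) 1 (by filter_upwards [ae_rademacher] with y hy using hy.le)

lemma lintegral_sum_sign_sq (b : Fin n × Fin s → ℝ) :
    ∫⁻ ξ, ENNReal.ofReal ((∑ x, b x * ξ x) ^ 2) ∂(Measure.pi fun _ : Fin n × Fin s => rademacher)
      = ENNReal.ofReal (∑ x, b x ^ 2) := by
  have hL : ∀ x, MemLp (fun y => b x * y) 2 rademacher := fun x =>
    memLp_id_rademacher.const_mul (b x)
  have hLi : ∀ x, MemLp (fun ξ : Fin n × Fin s → ℝ => b x * ξ x) 2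
      (Measure.pi fun _ : Fin n × Fin s => rademacher) := fun x =>
    (hL x).comp_measurePreserving (measurePreserving_eval _ x)
  have hmem := memLp_finsetSum Finset.univ fun x _ => hLi x
  have hv := variance_sum_pi (μ := fun _ : Fin n × Fin s => rademacher) hL
  have e : (∑ x, fun ξ : Fin n × Fin s → ℝ => b x * ξ x) = fun ξ => ∑ x, b x * ξ x := by
    ext; simp
  rw [e, variance_of_integral_eq_zero hmem.aestronglyMeasurable.aemeasurable] at hv
  · rw [← ofReal_integral_eq_lintegral_ofReal hmem.integrable_sq
      (Filter.Eventually.of_forall fun _ => sq_nonneg _)]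
    rw [hv]
    congr 1
    refine Finset.sum_congr rfl fun x _ => ?_
    rw [variance_const_mul]
    rw [variance_id_rademacher, mul_one]
  · rw [integral_finsetSum _ fun x _ => (hLi x).integrable (by norm_num)]
    refine Finset.sum_eq_zero fun x _ => ?_
    rw [integral_const_mul]
    have := integral_comp_eval (μ := fun _ : Fin n × Fin s => rademacher) (i := x)
      (f := fun y : ℝ => y) (by fun_prop)
    rw [this, integral_id_rademacher, mul_zero]

lemma sum_mul_genMatrix (c : Matrix (Fin m) (Fin n) ℝ) (z : Gen m n s) :
    ∑ i, ∑ j, c i j * genMatrix z i j = ∑ x, c (z.2 x) x.1 * z.1 x := by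
  have : ∀ i j, c i j * genMatrix z i j
      = ∑ x, if z.2 x = i then (if x.1 = j then c i j * z.1 x else 0) else 0 := by
    intro i j
    rw [genMatrix, Matrix.sum_apply, Finset.mul_sum]
    refine Finset.sum_congr rfl fun x _ => ?_
    rw [Matrix.single_apply, ite_and, mul_ite, mul_ite, mul_zero]
  simp_rw [this]
  calc _ = ∑ i, ∑ x, ∑ j, (if z.2 x = i then (if x.1 = j then c i j * z.1 x else 0) else 0) :=
        Finset.sum_congr rfl fun i _ => Finset.sum_comm
    _ = ∑ x, ∑ i, ∑ j, (if z.2 x = i then (if x.1 = j then c i j * z.1 x else 0) else 0) :=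
        Finset.sum_comm
    _ = _ := Finset.sum_congr rfl fun x _ => by
        rw [Finset.sum_eq_single (z.2 x)]
        · simp
        · intro i _ hi; simp [Ne.symm hi]
        · simp

/-- The entries are uncorrelated with variance `p`: given the positions only the diagonal terms
survive the signs, and summing over `γ` gives every entry total probability `p`. -/
lemma lintegral_law_sq (hp0 : 0 < p) (hs : (s : ℝ) = p * m) (hd : s ∣ m)
    (c : Matrix (Fin m) (Fin n) ℝ) :
    ∫⁻ S, ENNReal.ofReal ((∑ i, ∑ j, c i j * S i j) ^ 2) ∂(law m n s)
      = ENNReal.ofReal (p * ∑ i, ∑ j, c i j ^ 2) := by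
  have hprob := fun x : Fin n × Fin s => isProbabilityMeasure_uniformOn_block hs hd x.2
  have hmeas : Measurable fun S : Matrix (Fin m) (Fin n) ℝ =>
      ENNReal.ofReal ((∑ i, ∑ j, c i j * S i j) ^ 2) := by
    refine (Continuous.measurable ?_).ennreal_ofReal
    fun_prop
  rw [law, lintegral_map hmeas measurable_genMatrix, genLaw]
  refine (lintegral_prod_symm _ (hmeas.comp measurable_genMatrix).aemeasurable).trans ?_
  simp only [Function.comp_apply, sum_mul_genMatrix]
  have h1 : ∀ y : Fin n × Fin s → Fin m, ∫⁻ ξ : Fin n × Fin s → ℝ,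
      ENNReal.ofReal ((∑ x, c (y x) x.1 * ξ x) ^ 2)
        ∂(Measure.pi fun _ : Fin n × Fin s => rademacher)
      = ∑ x, ENNReal.ofReal (c (y x) x.1 ^ 2) := fun y => by
    rw [lintegral_sum_sign_sq (fun x => c (y x) x.1),
      ENNReal.ofReal_sum_of_nonneg fun _ _ => sq_nonneg _]
  simp_rw [h1]
  rw [lintegral_finsetSum _ fun x _ => measurable_of_finite _]
  have h2 : ∀ x : Fin n × Fin s, ∫⁻ y : Fin n × Fin s → Fin m, ENNReal.ofReal (c (y x) x.1 ^ 2)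
      ∂(Measure.pi fun x : Fin n × Fin s => uniformOn (block m s x.2))
      = ENNReal.ofReal (∑ i, if i ∈ block m s x.2 then p * c i x.1 ^ 2 else 0) := by
    intro x
    rw [(measurePreserving_eval (fun x : Fin n × Fin s => uniformOn (block m s x.2)) x).lintegral_comp
      (f := fun i => ENNReal.ofReal (c i x.1 ^ 2)) (measurable_of_finite _),
      lintegral_uniformOn_block hs hd, ENNReal.ofReal_sum_of_nonneg fun i _ => by
        split_ifs
        · positivity
        · exact le_rfl]
    refine Finset.sum_congr rfl fun i _ => ?_
    split_ifs
    · rw [ENNReal.ofReal_mul hp0.le]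
    · simp
  simp_rw [h2]
  rw [← ENNReal.ofReal_sum_of_nonneg fun x _ => Finset.sum_nonneg fun i _ => by
        split_ifs
        · positivity
        · exact le_rfl, Fintype.sum_prod_type]
  congr 1
  have h3 : ∀ j : Fin n, ∑ γ : Fin s, ∑ i, (if i ∈ block m s γ then p * c i j ^ 2 else 0)
      = ∑ i, p * c i j ^ 2 := by
    intro j
    rw [Finset.sum_comm]
    refine Finset.sum_congr rfl fun i _ => sum_ite_mem_block hs hd i _ ?_
    have : (0 : ℝ) < s := by rw [hs]; have := i.pos; positivity
    exact_mod_cast this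
  simp_rw [h3]
  rw [Finset.sum_comm, Finset.mul_sum]
  simp_rw [Finset.mul_sum]

variable {Ω : Type*} [MeasurableSpace Ω] {P : Measure Ω}

lemma IsGaussianMatrix.integral_apply {G : Ω → Matrix (Fin m) (Fin n) ℝ} {v : NNReal}
    (hG : IsGaussianMatrix G v P) (i : Fin m) (j : Fin n) : ∫ ω, G ω i j ∂P = 0 := by
  rw [(hG.hasLaw i j).integral_eq, integral_id_gaussianReal]

variable [IsProbabilityMeasure P]

lemma allMoments_sum_mul {A : Ω → Matrix (Fin m) (Fin n) ℝ}
    (hA : ∀ i j, AllMoments (fun ω => A ω i j) P) (c : Matrix (Fin m) (Fin n) ℝ) :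
    AllMoments (fun ω => ∑ i, ∑ j, c i j * A ω i j) P :=
  AllMoments.sum fun i _ => AllMoments.sum fun j _ => (hA i j).const_mul _

lemma IsGaussianMatrix.integral_sum_mul {G : Ω → Matrix (Fin m) (Fin n) ℝ} {v : NNReal}
    (hG : IsGaussianMatrix G v P) (c : Matrix (Fin m) (Fin n) ℝ) :
    ∫ ω, ∑ i, ∑ j, c i j * G ω i j ∂P = 0 := by
  rw [integral_finsetSum _ fun i _ => (AllMoments.sum fun j _ =>
    (hG.allMoments i j).const_mul (c i j)).integrable]
  refine Finset.sum_eq_zero fun i _ => ?_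
  rw [integral_finsetSum _ fun j _ => ((hG.allMoments i j).const_mul (c i j)).integrable]
  refine Finset.sum_eq_zero fun j _ => ?_
  rw [integral_const_mul, hG.integral_apply, mul_zero]

lemma IsGaussianMatrix.integral_sum_mul_sq {G : Ω → Matrix (Fin m) (Fin n) ℝ} {v : NNReal}
    (hG : IsGaussianMatrix G v P) (c : Matrix (Fin m) (Fin n) ℝ) :
    ∫ ω, (∑ i, ∑ j, c i j * G ω i j) ^ 2 ∂P = v * ∑ i, ∑ j, c i j ^ 2 := by
  have hA := allMoments_sum_mul hG.allMoments c
  rw [← variance_of_integral_eq_zero hA.integrable.aemeasurable (hG.integral_sum_mul c)]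
  have e : (fun ω => ∑ i, ∑ j, c i j * G ω i j)
      = ∑ x : Fin m × Fin n, fun ω => c x.1 x.2 * G ω x.1 x.2 := by
    ext ω; rw [Finset.sum_apply, Fintype.sum_prod_type]
  rw [e, IndepFun.variance_sum]
  · rw [Fintype.sum_prod_type, Finset.mul_sum]
    refine Finset.sum_congr rfl fun i _ => ?_
    rw [Finset.mul_sum]
    refine Finset.sum_congr rfl fun j _ => ?_
    rw [variance_const_mul, (hG.hasLaw i j).variance_eq, variance_id_gaussianReal, mul_comm]
  · exact fun x _ => ((hG.allMoments x.1 x.2).const_mul _) 2 (by simp)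
  · intro x _ y _ hxy
    exact (hG.indep.indepFun hxy).comp (φ := fun a => c x.1 x.2 * a) (ψ := fun a => c y.1 y.2 * a)
      (by fun_prop) (by fun_prop)

/-- `S` and `G` have the same covariance, the cross term vanishes by independence, and the weights
`t` and `1 - t` add up to `1`. Hence the second moments do not depend on `t`, and they are all that
is used about `S₁(t)` apart from its independence of `S₂(t)` and the moments of `Γ`. -/
lemma lintegral_interp_sq (hp0 : 0 < p) (hs : (s : ℝ) = p * m) (hd : s ∣ m)
    {S G : Ω → Matrix (Fin m) (Fin n) ℝ} (hS : HasLaw S (law m n s) P)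
    (hG : IsGaussianMatrix G p.toNNReal P) (hSG : IndepFun S G P) {t : ℝ} (ht0 : 0 ≤ t)
    (ht1 : t ≤ 1) (c : Matrix (Fin m) (Fin n) ℝ) :
    ∫⁻ ω, ENNReal.ofReal ((∑ i, ∑ j, c i j * interp t (S ω) (G ω) i j) ^ 2) ∂P
      = ENNReal.ofReal (p * ∑ i, ∑ j, c i j ^ 2) := by
  set L : Matrix (Fin m) (Fin n) ℝ → ℝ := fun M => ∑ i, ∑ j, c i j * M i j with hL
  have hLm : Measurable L := by
    refine Continuous.measurable ?_
    fun_prop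
  have hA : AllMoments (fun ω => L (S ω)) P :=
    allMoments_sum_mul (allMoments_of_hasLaw_law hs hd hS) c
  have hB : AllMoments (fun ω => L (G ω)) P := allMoments_sum_mul hG.allMoments c
  have hsum : ∀ ω, (∑ i, ∑ j, c i j * interp t (S ω) (G ω) i j) ^ 2
      = t * L (S ω) ^ 2 + (1 - t) * L (G ω) ^ 2 + 2 * √t * √(1 - t) * (L (S ω) * L (G ω)) := by
    intro ω
    have : ∑ i, ∑ j, c i j * interp t (S ω) (G ω) i j = √t * L (S ω) + √(1 - t) * L (G ω) := by
      simp only [hL, Finset.mul_sum, ← Finset.sum_add_distrib]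
      refine Finset.sum_congr rfl fun i _ => Finset.sum_congr rfl fun j _ => ?_
      simp only [interp, Matrix.add_apply, Matrix.smul_apply, smul_eq_mul]; ring
    rw [this]
    have h1 : √t ^ 2 = t := Real.sq_sqrt ht0
    have h2 : √(1 - t) ^ 2 = 1 - t := Real.sq_sqrt (by linarith)
    calc _ = √t ^ 2 * L (S ω) ^ 2 + √(1 - t) ^ 2 * L (G ω) ^ 2
          + 2 * √t * √(1 - t) * (L (S ω) * L (G ω)) := by ring
      _ = _ := by rw [h1, h2]
  have hA2 : Integrable (fun ω => L (S ω) ^ 2) P := by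
    simpa only [sq] using (hA.mul hA).integrable
  have hB2 : Integrable (fun ω => L (G ω) ^ 2) P := by
    simpa only [sq] using (hB.mul hB).integrable
  have hAB := (hA.mul hB).integrable
  have hint := ((hA2.const_mul t).add (hB2.const_mul (1 - t))).add
    (hAB.const_mul (2 * √t * √(1 - t)))
  have eA : ∫ ω, L (S ω) ^ 2 ∂P = p * ∑ i, ∑ j, c i j ^ 2 := by
    rw [integral_eq_lintegral_of_nonneg_ae (Filter.Eventually.of_forall fun _ => sq_nonneg _)
      hA2.aestronglyMeasurable]
    rw [hS.lintegral_comp (f := fun M => ENNReal.ofReal (L M ^ 2))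
      (hLm.pow_const 2).ennreal_ofReal.aemeasurable, lintegral_law_sq hp0 hs hd,
      ENNReal.toReal_ofReal]
    positivity
  have eB : ∫ ω, L (G ω) ^ 2 ∂P = p * ∑ i, ∑ j, c i j ^ 2 := by
    rw [hG.integral_sum_mul_sq, Real.coe_toNNReal _ hp0.le]
  have eAB : ∫ ω, L (S ω) * L (G ω) ∂P = 0 := by
    have := (hSG.comp hLm hLm).integral_fun_mul_eq_mul_integral
      hA.integrable.aestronglyMeasurable hB.integrable.aestronglyMeasurable
    simp only [Function.comp_apply] at this
    rw [this, show ∫ ω, L (G ω) ∂P = 0 from hG.integral_sum_mul c, mul_zero]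
  simp_rw [hsum]
  refine (ofReal_integral_eq_lintegral_ofReal hint ?_).symm.trans ?_
  rotate_left
  · congr 1
    have e1 := integral_add ((hA2.const_mul t).add (hB2.const_mul (1 - t)))
      (hAB.const_mul (2 * √t * √(1 - t)))
    have e2 := integral_add (hA2.const_mul t) (hB2.const_mul (1 - t))
    simp only [Pi.add_apply, integral_const_mul] at e1 e2 ⊢
    rw [e1, e2, eA, eB, eAB]; ring
  · refine Filter.Eventually.of_forall fun ω => ?_
    simp only [Pi.zero_apply, Pi.add_apply]
    rw [← hsum]
    positivity

end SecondMoment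

/-! ### Comparison with the moments of `Gam` -/

section Gam

variable {m n d : ℕ}

lemma exists_absPow_eq_sum (r : ℝ) (M : Matrix (Fin d) (Fin d) ℝ) :
    ∃ (b : Fin d → ℝ) (w : Fin d → Fin d → ℝ), (∀ k, 0 ≤ b k) ∧ (∀ k, w k ⬝ᵥ w k = 1) ∧
      absPow r M = ∑ k, b k • vecMulVec (w k) (w k) := by
  obtain ⟨a, e, W, V, C, hW, -, -, -, -, hg, -, -, -, -, ha, -⟩ := exists_singular_decomposition M
  refine ⟨fun k => a k ^ (r / 2), fun k i => W i k, fun k => Real.rpow_nonneg (ha k) _,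
    fun k => ?_, ?_⟩
  · have := congrFun (congrFun hW k) k
    rw [mul_apply, one_apply_eq] at this
    exact this
  · rw [absPow, hg]
    ext i j
    rw [mul_apply, Matrix.sum_apply]
    refine Finset.sum_congr rfl fun k _ => ?_
    rw [mul_diagonal, transpose_apply, Matrix.smul_apply, vecMulVec_apply, smul_eq_mul,
      Function.comp_apply]
    ring

lemma trace_vecMulVec_mul (w : Fin d → ℝ) (N : Matrix (Fin d) (Fin d) ℝ) :
    (vecMulVec w w * N).trace = w ⬝ᵥ (N *ᵥ w) := by
  rw [vecMulVec_mul, trace_vecMulVec, dotProduct_comm, dotProduct_comm w, ← dotProduct_mulVec,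
    dotProduct_comm]

lemma transpose_Gam (U : Matrix (Fin n) (Fin d) ℝ) (A B : Matrix (Fin m) (Fin n) ℝ) :
    (Gam U A B)ᵀ = Gam U A B := by
  rw [Gam, transpose_add, transpose_mul (A * U)ᵀ, transpose_mul (B * U)ᵀ, transpose_transpose,
    transpose_transpose, add_comm]

lemma isHermitian_Gam (U : Matrix (Fin n) (Fin d) ℝ) (A B : Matrix (Fin m) (Fin n) ℝ) :
    (Gam U A B).IsHermitian := by
  rw [Matrix.IsHermitian, conjTranspose_eq_transpose_of_trivial, transpose_Gam]

lemma trace_pow_Gam_nonneg (U : Matrix (Fin n) (Fin d) ℝ) (A B : Matrix (Fin m) (Fin n) ℝ)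
    (q : ℕ) : 0 ≤ (Gam U A B ^ (2 * q)).trace := by
  have : Gam U A B ^ (2 * q) = (Gam U A B ^ q)ᵀ * Gam U A B ^ q := by
    rw [transpose_pow, transpose_Gam, two_mul, pow_add]
  rw [this]
  refine Finset.sum_nonneg fun i _ => ?_
  rw [diag_apply, mul_apply]
  exact Finset.sum_nonneg fun j _ => mul_self_nonneg _

/-- The coefficients of the entries of `Gam U A B *ᵥ v` as linear forms in `A`. -/
def gamCoeff (U : Matrix (Fin n) (Fin d) ℝ) (B : Matrix (Fin m) (Fin n) ℝ) (v : Fin d → ℝ)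
    (a : Fin d) : Matrix (Fin m) (Fin n) ℝ :=
  Matrix.of fun i j => U j a * ((B * U) *ᵥ v) i + (B * U) i a * (U *ᵥ v) j

lemma Gam_mulVec_apply (U : Matrix (Fin n) (Fin d) ℝ) (A B : Matrix (Fin m) (Fin n) ℝ)
    (v : Fin d → ℝ) (a : Fin d) :
    (Gam U A B *ᵥ v) a = ∑ i, ∑ j, gamCoeff U B v a i j * A i j := by
  have h1 : (((A * U)ᵀ * (B * U)) *ᵥ v) a = ∑ i, ∑ j, U j a * ((B * U) *ᵥ v) i * A i j := by
    rw [← mulVec_mulVec, mulVec, dotProduct]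
    refine Finset.sum_congr rfl fun i _ => ?_
    rw [transpose_apply, mul_apply, Finset.sum_mul]
    exact Finset.sum_congr rfl fun j _ => by ring
  have h2 : (((B * U)ᵀ * (A * U)) *ᵥ v) a = ∑ i, ∑ j, (B * U) i a * (U *ᵥ v) j * A i j := by
    rw [← mulVec_mulVec, ← mulVec_mulVec, mulVec, dotProduct]
    refine Finset.sum_congr rfl fun i _ => ?_
    rw [transpose_apply, mulVec, dotProduct, Finset.mul_sum]
    exact Finset.sum_congr rfl fun j _ => by ring
  rw [Gam, add_mulVec, Pi.add_apply, h1, h2]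
  simp only [gamCoeff, Matrix.of_apply, add_mul, Finset.sum_add_distrib]

/-- With `X = B U` and `y = X v` the coefficients are `U_{ja} y_i + X_{ia} (U v)_j`. Since the
columns of `U` are orthonormal, the squares give `d |y|²` and `|X|² |v|²` (Frobenius norm of `X`),
and the cross term gives `2 |y|²`. -/
lemma sum_gamCoeff_sq {U : Matrix (Fin n) (Fin d) ℝ} (hU : Uᵀ * U = 1)
    (B : Matrix (Fin m) (Fin n) ℝ) (v : Fin d → ℝ) :
    ∑ a, ∑ i, ∑ j, gamCoeff U B v a i j ^ 2
      = (d + 2) * (((B * U) *ᵥ v) ⬝ᵥ ((B * U) *ᵥ v)) + (∑ i, (B * U) i ⬝ᵥ (B * U) i) * (v ⬝ᵥ v) := by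
  set X := B * U with hX
  set y := X *ᵥ v with hy
  have hUv : (U *ᵥ v) ⬝ᵥ (U *ᵥ v) = v ⬝ᵥ v := by
    rw [dotProduct_mulVec, ← mulVec_transpose, mulVec_mulVec, hU, one_mulVec]
  have hUU : ∀ a, ∑ j, U j a * U j a = 1 := fun a => by
    have := congrFun (congrFun hU a) a
    rw [mul_apply, one_apply_eq] at this
    exact this
  have hUa : ∀ a, ∑ j, U j a * (U *ᵥ v) j = v a := fun a => by
    have : (Uᵀ *ᵥ (U *ᵥ v)) a = v a := by rw [mulVec_mulVec, hU, one_mulVec]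
    exact this
  have h1 : ∀ a i, ∑ j, gamCoeff U B v a i j ^ 2
      = y i * y i + 2 * (y i * (X i a * v a)) + X i a * X i a * (v ⬝ᵥ v) := by
    intro a i
    calc ∑ j, gamCoeff U B v a i j ^ 2
        = ∑ j, (y i * y i * (U j a * U j a) + 2 * (y i * X i a) * (U j a * (U *ᵥ v) j)
          + X i a * X i a * ((U *ᵥ v) j * (U *ᵥ v) j)) :=
          Finset.sum_congr rfl fun j _ => by
            simp only [gamCoeff, Matrix.of_apply, ← hX, ← hy]; ring
      _ = y i * y i * 1 + 2 * (y i * X i a) * v a + X i a * X i a * (v ⬝ᵥ v) := by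
          rw [Finset.sum_add_distrib, Finset.sum_add_distrib, ← Finset.mul_sum, ← Finset.mul_sum,
            ← Finset.mul_sum, hUU, hUa, ← hUv]
          rfl
      _ = _ := by ring
  simp_rw [h1, Finset.sum_add_distrib]
  have e1 : ∑ _a : Fin d, ∑ i, y i * y i = d * (y ⬝ᵥ y) := by
    rw [Finset.sum_const, Finset.card_univ, Fintype.card_fin, nsmul_eq_mul]; rfl
  have e2 : ∑ a, ∑ i, 2 * (y i * (X i a * v a)) = 2 * (y ⬝ᵥ y) := by
    rw [Finset.sum_comm, dotProduct, Finset.mul_sum]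
    refine Finset.sum_congr rfl fun i _ => ?_
    rw [← Finset.mul_sum, ← Finset.mul_sum]
    rfl
  have e3 : ∑ a, ∑ i, X i a * X i a * (v ⬝ᵥ v) = (∑ i, X i ⬝ᵥ X i) * (v ⬝ᵥ v) := by
    rw [Finset.sum_comm, Finset.sum_mul]
    refine Finset.sum_congr rfl fun i _ => ?_
    rw [← Finset.sum_mul]
    rfl
  rw [e1, e2, e3]
  ring

lemma trace_absPow_mul_Gam_sq {r : ℝ} {M : Matrix (Fin d) (Fin d) ℝ} {b : Fin d → ℝ}
    {w : Fin d → Fin d → ℝ} (h : absPow r M = ∑ k, b k • vecMulVec (w k) (w k))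
    (U : Matrix (Fin n) (Fin d) ℝ) (A B : Matrix (Fin m) (Fin n) ℝ) :
    (absPow r M * (Gam U A B * Gam U A B)).trace
      = ∑ k, ∑ a, b k * (∑ i, ∑ j, gamCoeff U B (w k) a i j * A i j) ^ 2 := by
  rw [h, Finset.sum_mul, trace_sum]
  refine Finset.sum_congr rfl fun k _ => ?_
  rw [smul_mul_assoc, trace_smul, trace_vecMulVec_mul, ← mulVec_mulVec, dotProduct_mulVec,
    ← mulVec_transpose, transpose_Gam, smul_eq_mul, ← Finset.mul_sum, dotProduct]
  congr 1
  exact Finset.sum_congr rfl fun a _ => by rw [Gam_mulVec_apply, sq]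

/-- Expand `|M|^r` in unit eigenvectors `w_k`; then the trace is `∑ b_k |Γ w_k|²`, a sum of squares
of linear forms in `T`, for which the second moments suffice. -/
lemma lintegral_trace_absPow_mul_Gam_sq {Ω : Type*} [MeasurableSpace Ω] {P : Measure Ω} {p : ℝ}
    (hp0 : 0 < p) {T : Ω → Matrix (Fin m) (Fin n) ℝ} (hTm : AEMeasurable T P)
    (hT : ∀ c : Matrix (Fin m) (Fin n) ℝ, ∫⁻ ω, ENNReal.ofReal ((∑ i, ∑ j, c i j * T ω i j) ^ 2) ∂P
      = ENNReal.ofReal (p * ∑ i, ∑ j, c i j ^ 2))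
    {U : Matrix (Fin n) (Fin d) ℝ} (hU : Uᵀ * U = 1) (r : ℝ) (M : Matrix (Fin d) (Fin d) ℝ)
    (B : Matrix (Fin m) (Fin n) ℝ) :
    ∫⁻ ω, ENNReal.ofReal (absPow r M * (Gam U (T ω) B * Gam U (T ω) B)).trace ∂P
      = ENNReal.ofReal (p * ((d + 2) * ∑ i, (B * U) i ⬝ᵥ (absPow r M *ᵥ (B * U) i)
        + (∑ i, (B * U) i ⬝ᵥ (B * U) i) * (absPow r M).trace)) := by
  obtain ⟨b, w, hb, hw, h⟩ := exists_absPow_eq_sum r M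
  have hmeas : ∀ c : Matrix (Fin m) (Fin n) ℝ,
      AEMeasurable (fun ω => ∑ i, ∑ j, c i j * T ω i j) P := fun c => by
    have : Measurable fun A : Matrix (Fin m) (Fin n) ℝ => ∑ i, ∑ j, c i j * A i j := by
      refine Continuous.measurable ?_
      fun_prop
    exact this.comp_aemeasurable hTm
  simp_rw [trace_absPow_mul_Gam_sq h]
  have e : ∀ ω, ENNReal.ofReal (∑ k, ∑ a, b k *
      (∑ i, ∑ j, gamCoeff U B (w k) a i j * T ω i j) ^ 2)
      = ∑ k, ∑ a, ENNReal.ofReal (b k) *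
        ENNReal.ofReal ((∑ i, ∑ j, gamCoeff U B (w k) a i j * T ω i j) ^ 2) := by
    intro ω
    rw [ENNReal.ofReal_sum_of_nonneg fun k _ => Finset.sum_nonneg fun a _ =>
      mul_nonneg (hb k) (sq_nonneg _)]
    refine Finset.sum_congr rfl fun k _ => ?_
    rw [ENNReal.ofReal_sum_of_nonneg fun a _ => mul_nonneg (hb k) (sq_nonneg _)]
    exact Finset.sum_congr rfl fun a _ => ENNReal.ofReal_mul (hb k)
  simp_rw [e]
  rw [lintegral_finsetSum' _ fun k _ => Finset.aemeasurable_fun_sum _ fun a _ =>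
    ((hmeas _).pow_const 2).ennreal_ofReal.const_mul _]
  have e2 : ∀ k, ∫⁻ ω, ∑ a, ENNReal.ofReal (b k) *
      ENNReal.ofReal ((∑ i, ∑ j, gamCoeff U B (w k) a i j * T ω i j) ^ 2) ∂P
      = ENNReal.ofReal (b k * (p * ((d + 2) * (((B * U) *ᵥ w k) ⬝ᵥ ((B * U) *ᵥ w k))
        + (∑ i, (B * U) i ⬝ᵥ (B * U) i) * 1))) := by
    intro k
    rw [lintegral_finsetSum' _ fun a _ => ((hmeas _).pow_const 2).ennreal_ofReal.const_mul _]
    simp_rw [lintegral_const_mul' _ _ ENNReal.ofReal_ne_top, hT]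
    have h3 : ENNReal.ofReal (∑ a, p * ∑ i, ∑ j, gamCoeff U B (w k) a i j ^ 2)
        = ∑ a, ENNReal.ofReal (p * ∑ i, ∑ j, gamCoeff U B (w k) a i j ^ 2) :=
      ENNReal.ofReal_sum_of_nonneg fun a _ => mul_nonneg hp0.le
        (Finset.sum_nonneg fun i _ => Finset.sum_nonneg fun j _ => sq_nonneg _)
    rw [← Finset.mul_sum, ← h3, ← ENNReal.ofReal_mul (hb k), ← Finset.mul_sum, sum_gamCoeff_sq hU, hw]
  simp_rw [e2]
  have hnn : ∀ N : ℕ, ∀ v : Fin N → ℝ, 0 ≤ v ⬝ᵥ v := fun N v =>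
    Finset.sum_nonneg fun i _ => mul_self_nonneg _
  refine (ENNReal.ofReal_sum_of_nonneg fun k _ => mul_nonneg (hb k) (mul_nonneg hp0.le
    (add_nonneg (mul_nonneg (by positivity) (hnn _ _))
      (mul_nonneg (Finset.sum_nonneg fun i _ => hnn _ _) zero_le_one)))).symm.trans ?_
  congr 1
  have t1 : (absPow r M).trace = ∑ k, b k := by
    rw [h, trace_sum]
    exact Finset.sum_congr rfl fun k _ => by rw [trace_smul, trace_vecMulVec, hw]; simp
  have t2 : ∑ i, (B * U) i ⬝ᵥ (absPow r M *ᵥ (B * U) i)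
      = ∑ k, b k * (((B * U) *ᵥ w k) ⬝ᵥ ((B * U) *ᵥ w k)) := by
    have : ∀ i, (B * U) i ⬝ᵥ (absPow r M *ᵥ (B * U) i)
        = ∑ k, b k * (((B * U) *ᵥ w k) i * ((B * U) *ᵥ w k) i) := by
      intro i
      rw [h, Matrix.sum_mulVec, dotProduct_sum]
      refine Finset.sum_congr rfl fun k _ => ?_
      rw [smul_mulVec, vecMulVec_mulVec, op_smul_eq_smul, dotProduct_smul, dotProduct_smul,
        smul_eq_mul, smul_eq_mul, dotProduct_comm (w k)]
      rfl
    simp_rw [this]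
    rw [Finset.sum_comm]
    refine Finset.sum_congr rfl fun k _ => ?_
    rw [← Finset.mul_sum]
    rfl
  rw [t1, t2, mul_add, Finset.mul_sum, Finset.mul_sum, Finset.mul_sum, Finset.mul_sum,
    ← Finset.sum_add_distrib]
  exact Finset.sum_congr rfl fun k _ => by ring

lemma measurable_trace_Gam_pow (U : Matrix (Fin n) (Fin d) ℝ) (N : ℕ) :
    Measurable fun x : Matrix (Fin m) (Fin n) ℝ × Matrix (Fin m) (Fin n) ℝ =>
      (Gam U x.1 x.2 ^ N).trace := by
  have : BorelSpace (Matrix (Fin m) (Fin n) ℝ × Matrix (Fin m) (Fin n) ℝ) :=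
    inferInstanceAs (BorelSpace ((Fin m → Fin n → ℝ) × (Fin m → Fin n → ℝ)))
  refine Continuous.measurable ?_
  unfold Gam
  fun_prop

/-- The comparison of the weighted second moments of `T₂ * U` with the moments of `Gam`. -/
lemma lintegral_weighted_le {Ω : Type*} [MeasurableSpace Ω] {P : Measure Ω}
    [IsProbabilityMeasure P] {p : ℝ} (hp0 : 0 < p) {T₁ T₂ : Ω → Matrix (Fin m) (Fin n) ℝ}
    (hT₁m : AEMeasurable T₁ P) (hT₂m : AEMeasurable T₂ P) (hind : IndepFun T₁ T₂ P)
    (hT₁ : ∀ c : Matrix (Fin m) (Fin n) ℝ,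
      ∫⁻ ω, ENNReal.ofReal ((∑ i, ∑ j, c i j * T₁ ω i j) ^ 2) ∂P
        = ENNReal.ofReal (p * ∑ i, ∑ j, c i j ^ 2))
    {U : Matrix (Fin n) (Fin d) ℝ} (hU : Uᵀ * U = 1) {r q q' : ℝ} {N : ℕ} (hr : 0 ≤ r)
    (hN : (N : ℝ) = q) (hq : q'.HolderConjugate q) {M : Ω → Matrix (Fin d) (Fin d) ℝ}
    (hM : AEMeasurable M P) :
    ∫⁻ ω, ENNReal.ofReal (p * ((d + 2) * ∑ i, (T₂ ω * U) i ⬝ᵥ (absPow r (M ω) *ᵥ (T₂ ω * U) i)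
        + (∑ i, (T₂ ω * U) i ⬝ᵥ (T₂ ω * U) i) * (absPow r (M ω)).trace)) ∂P
      ≤ (∫⁻ ω, ENNReal.ofReal (absPow (r * q') (M ω)).trace ∂P) ^ (1 / q') *
        (∫⁻ ω, ENNReal.ofReal (Gam U (T₁ ω) (T₂ ω) ^ (2 * N)).trace ∂P) ^ (1 / q) := by
  set f : Ω → ℝ≥0∞ := fun ω => ENNReal.ofReal (absPow (r * q') (M ω)).trace with hf
  set φ : Matrix (Fin m) (Fin n) ℝ × Matrix (Fin m) (Fin n) ℝ → ℝ≥0∞ :=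
    fun x => ENNReal.ofReal (Gam U x.1 x.2 ^ (2 * N)).trace with hφ
  have hφm : Measurable φ := (measurable_trace_Gam_pow U _).ennreal_ofReal
  have hfm : AEMeasurable f P := by
    have h1 : Measurable fun A : Matrix (Fin d) (Fin d) ℝ => A.trace :=
      Continuous.measurable (by fun_prop)
    exact ((h1.comp (measurable_absPow (mul_nonneg hr hq.nonneg))).comp_aemeasurable
      hM).ennreal_ofReal
  have hq1 : 0 < q := hq.symm.pos
  have hq1' : 0 < q' := hq.pos
  have hgm : AEMeasurable (fun x : Ω × Ω => φ (T₁ x.2, T₂ x.1)) (P.prod P) :=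
    hφm.comp_aemeasurable (hT₁m.comp_snd.prodMk hT₂m.comp_fst)
  -- Decoupling: `M` may depend on `T₁`, so the averaging over `T₁` is done at an independent point
  -- `ω'`, with `M` and `T₂` frozen at `ω`.
  calc _ = ∫⁻ ω, ∫⁻ ω', ENNReal.ofReal
        (absPow r (M ω) * (Gam U (T₁ ω') (T₂ ω) * Gam U (T₁ ω') (T₂ ω))).trace ∂P ∂P :=
        lintegral_congr fun ω =>
          (lintegral_trace_absPow_mul_Gam_sq hp0 hT₁m hT₁ hU r (M ω) (T₂ ω)).symm
    _ ≤ ∫⁻ ω, ∫⁻ ω', f ω ^ (1 / q') * φ (T₁ ω', T₂ ω) ^ (1 / q) ∂P ∂P := by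
        refine lintegral_mono fun ω => lintegral_mono fun ω' => ?_
        rw [hf, hφ, ENNReal.ofReal_rpow_of_nonneg (trace_absPow_nonneg _ _) (by positivity),
          ENNReal.ofReal_rpow_of_nonneg (trace_pow_Gam_nonneg _ _ _ _) (by positivity),
          ← ENNReal.ofReal_mul (Real.rpow_nonneg (trace_absPow_nonneg _ _) _)]
        exact ENNReal.ofReal_le_ofReal
          (trace_absPow_mul_sq_le hN hq _ _ (isHermitian_Gam U _ _))
    _ = ∫⁻ x, f x.1 ^ (1 / q') * φ (T₁ x.2, T₂ x.1) ^ (1 / q) ∂(P.prod P) :=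
        (lintegral_prod (fun x : Ω × Ω => f x.1 ^ (1 / q') * φ (T₁ x.2, T₂ x.1) ^ (1 / q))
          ((hfm.comp_fst.pow_const _).mul (hgm.pow_const _))).symm
    _ ≤ (∫⁻ x, (f x.1 ^ (1 / q')) ^ q' ∂(P.prod P)) ^ (1 / q') *
        (∫⁻ x, (φ (T₁ x.2, T₂ x.1) ^ (1 / q)) ^ q ∂(P.prod P)) ^ (1 / q) :=
        ENNReal.lintegral_mul_le_Lp_mul_Lq _ hq (hfm.comp_fst.pow_const _) (hgm.pow_const _)
    _ = _ := by
        simp_rw [← ENNReal.rpow_mul, one_div, inv_mul_cancel₀ hq1.ne', inv_mul_cancel₀ hq1'.ne',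
          ENNReal.rpow_one]
        congr 2
        · rw [lintegral_prod _ hfm.comp_fst]
          simp
        · rw [lintegral_prod _ hgm]
          -- Because `T₁` and `T₂` are independent, `(T₁ ω', T₂ ω)` under the product measure has
          -- the same law as `(T₁, T₂)`. The decoupling therefore does not change the moment of
          -- `Gam`.
          have h1 : ∀ ω, ∫⁻ ω', φ (T₁ ω', T₂ ω) ∂P = ∫⁻ A, φ (A, T₂ ω) ∂(P.map T₁) := fun ω =>
            (lintegral_map' (f := fun A => φ (A, T₂ ω))
              (hφm.comp measurable_prodMk_right).aemeasurable hT₁m).symm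
          simp_rw [h1]
          have : IsProbabilityMeasure (P.map T₁) := Measure.isProbabilityMeasure_map hT₁m
          have : IsProbabilityMeasure (P.map T₂) := Measure.isProbabilityMeasure_map hT₂m
          rw [← lintegral_map' (f := fun B => ∫⁻ A, φ (A, B) ∂(P.map T₁))
            hφm.lintegral_prod_left'.aemeasurable hT₂m, ← lintegral_prod_symm _ hφm.aemeasurable,
            ← (indepFun_iff_map_prod_eq_prod_map_map hT₁m hT₂m).1 hind,
            lintegral_map' hφm.aemeasurable (hT₁m.prodMk hT₂m)]

end Gam

/-! ### Moments of the rows -/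

section Rows

variable {m n s d : ℕ} {p : ℝ} {Ω : Type*} [MeasurableSpace Ω] {P : Measure Ω}

lemma IsGaussianMatrix.aemeasurable {G : Ω → Matrix (Fin m) (Fin n) ℝ} {v : NNReal}
    (hG : IsGaussianMatrix G v P) : AEMeasurable G P :=
  aemeasurable_pi_iff.2 fun i => aemeasurable_pi_iff.2 fun j => (hG.hasLaw i j).aemeasurable

lemma measurable_row_mul (U : Matrix (Fin n) (Fin d) ℝ) (i : Fin m) :
    Measurable fun A : Matrix (Fin m) (Fin n) ℝ => (A * U) i := by
  refine measurable_pi_iff.2 fun a => Continuous.measurable ?_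
  simp only [Matrix.mul_apply]
  fun_prop

/-- Since `Uᵀ U = 1`, the row is Gaussian with covariance `p • 1`, and `p ≤ 1` puts it within
`lintegral_exp_dotProduct_self_le`. -/
lemma IsGaussianMatrix.lintegral_exp_row_le (hp0 : 0 < p) (hp1 : p ≤ 1)
    {G : Ω → Matrix (Fin m) (Fin n) ℝ} (hG : IsGaussianMatrix G p.toNNReal P)
    {U : Matrix (Fin n) (Fin d) ℝ} (hU : Uᵀ * U = 1) (i : Fin m) {l : ℝ} (hl0 : 0 ≤ l)
    (hl1 : l ≤ 1 / 4) :
    ∫⁻ ω, ENNReal.ofReal (Real.exp (l * ((G ω * U) i ⬝ᵥ (G ω * U) i))) ∂P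
      ≤ ENNReal.ofReal (Real.exp (4 * l * (p * d))) := by
  have := hG.indep.isProbabilityMeasure
  have hquad : ∀ v : Fin d → ℝ, v ⬝ᵥ ((p • (1 : Matrix (Fin d) (Fin d) ℝ)) *ᵥ v) = p * (v ⬝ᵥ v) :=
    fun v => by rw [smul_mulVec, one_mulVec, dotProduct_smul, smul_eq_mul]
  have hnn : ∀ v : Fin d → ℝ, 0 ≤ v ⬝ᵥ v := fun v => Finset.sum_nonneg fun _ _ => mul_self_nonneg _
  refine (lintegral_exp_dotProduct_self_le (A := p • (1 : Matrix (Fin d) (Fin d) ℝ))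
    ((measurable_row_mul U i).comp_aemeasurable hG.aemeasurable) ?_ (fun v => ?_) (fun v => ?_)
    (fun c => ?_) hl0 hl1).trans ?_
  · rw [Matrix.IsHermitian, conjTranspose_eq_transpose_of_trivial, transpose_smul, transpose_one]
  · rw [hquad]; exact mul_nonneg hp0.le (hnn v)
  · rw [hquad]; nlinarith [hnn v]
  · have e : ∀ ω, ENNReal.ofReal (Real.exp (c ⬝ᵥ (G ω * U) i))
        = ∏ j, ENNReal.ofReal (Real.exp ((U j ⬝ᵥ c) * G ω i j)) := by
      intro ω
      rw [← ENNReal.ofReal_prod_of_nonneg fun _ _ => (Real.exp_pos _).le, ← Real.exp_sum]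
      congr 2
      have : (G ω * U) i = ∑ j, G ω i j • U j := by
        ext a; rw [mul_apply, Finset.sum_apply]; rfl
      rw [this, dotProduct_sum]
      exact Finset.sum_congr rfl fun j _ => by
        rw [dotProduct_smul, smul_eq_mul, mul_comm, dotProduct_comm]
    refine (lintegral_congr e).trans_le ?_
    have hind : iIndepFun (fun (j : Fin n) ω => G ω i j) P :=
      hG.indep.precomp (g := fun j : Fin n => (i, j)) fun a b h => by simpa using h
    refine (lintegral_prod_of_iIndepFun (fun j => hG.hasLaw i j) hind
      (f := fun j y => ENNReal.ofReal (Real.exp ((U j ⬝ᵥ c) * y))) (fun j => by fun_prop)).trans_le ?_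
    simp_rw [lintegral_exp_mul_gaussianReal]
    rw [← ENNReal.ofReal_prod_of_nonneg fun _ _ => (Real.exp_pos _).le, ← Real.exp_sum, hquad,
      ← sum_row_dotProduct_sq hU c, Real.coe_toNNReal _ hp0.le, Finset.mul_sum, Finset.sum_div]
  · refine ENNReal.ofReal_le_ofReal (Real.exp_le_exp.2 ?_)
    rw [trace_smul, trace_one, Fintype.card_fin, smul_eq_mul]
    have : 0 ≤ l * (p * d) := by positivity
    nlinarith

/-- `(√t x + √(1-t) y)²` plus the square of the rotated coordinate `√(1-t) x - √t y` is `x² + y²`.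
-/
lemma row_interp_dotProduct_self_le {t : ℝ} (ht0 : 0 ≤ t) (ht1 : t ≤ 1)
    (S G : Matrix (Fin m) (Fin n) ℝ) (U : Matrix (Fin n) (Fin d) ℝ) (i : Fin m) :
    (interp t S G * U) i ⬝ᵥ (interp t S G * U) i
      ≤ (S * U) i ⬝ᵥ (S * U) i + (G * U) i ⬝ᵥ (G * U) i := by
  rw [interp, Matrix.add_mul, Matrix.smul_mul, Matrix.smul_mul]
  simp only [dotProduct, ← Finset.sum_add_distrib]
  refine Finset.sum_le_sum fun a _ => ?_
  change (√t * (S * U) i a + √(1 - t) * (G * U) i a) *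
    (√t * (S * U) i a + √(1 - t) * (G * U) i a) ≤ _
  have h1 : √t ^ 2 = t := Real.sq_sqrt ht0
  have h2 : √(1 - t) ^ 2 = 1 - t := Real.sq_sqrt (by linarith)
  have h3 : √t ^ 2 + √(1 - t) ^ 2 = 1 := by rw [h1, h2]; ring
  set x := (S * U) i a
  set y := (G * U) i a
  calc _ ≤ (√t * x + √(1 - t) * y) ^ 2 + (√(1 - t) * x - √t * y) ^ 2 := by
        nlinarith [sq_nonneg (√(1 - t) * x - √t * y)]
    _ = (√t ^ 2 + √(1 - t) ^ 2) * (x * x + y * y) := by ring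
    _ = _ := by rw [h3, one_mul]

lemma lintegral_row_pow_le (hp0 : 0 < p) (hp1 : p ≤ 1) (hs : (s : ℝ) = p * m) (hd : s ∣ m)
    {S G : Ω → Matrix (Fin m) (Fin n) ℝ} (hS : HasLaw S (law m n s) P)
    (hG : IsGaussianMatrix G p.toNNReal P) {U : Matrix (Fin n) (Fin d) ℝ} (hU : Uᵀ * U = 1)
    {t : ℝ} (ht0 : 0 ≤ t) (ht1 : t ≤ 1) {q : ℕ} (hq : 0 < q) {T : ℝ} (hT1 : p * d ≤ T)
    (hT2 : q ≤ T) (i : Fin m) :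
    ∫⁻ ω, ENNReal.ofReal (((interp t (S ω) (G ω) * U) i ⬝ᵥ (interp t (S ω) (G ω) * U) i) ^ q) ∂P
      ≤ ENNReal.ofReal ((24 * T) ^ q) := by
  have hnn : ∀ v : Fin d → ℝ, 0 ≤ v ⬝ᵥ v := fun v => Finset.sum_nonneg fun _ _ => mul_self_nonneg _
  have hT : 0 ≤ T := (Nat.cast_nonneg q).trans hT2
  have hmS : Measurable fun A : Matrix (Fin m) (Fin n) ℝ => (A * U) i ⬝ᵥ (A * U) i := by
    refine Continuous.measurable ?_
    simp only [dotProduct, Matrix.mul_apply]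
    fun_prop
  have bS : ∫⁻ ω, ENNReal.ofReal (((S ω * U) i ⬝ᵥ (S ω * U) i) ^ q) ∂P
      ≤ ENNReal.ofReal ((12 * T) ^ q) := by
    refine lintegral_pow_le_of_lintegral_exp_le (fun ω => hnn _) hq hT1 hT2 fun l hl0 hl1 => ?_
    exact (hS.lintegral_comp
      (f := fun A => ENNReal.ofReal (Real.exp (l * ((A * U) i ⬝ᵥ (A * U) i))))
      (Real.measurable_exp.comp (hmS.const_mul l)).ennreal_ofReal.aemeasurable).trans_le
      (lintegral_exp_row_law_le hp0 hs hd hU i hl0 hl1)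
  have bG : ∫⁻ ω, ENNReal.ofReal (((G ω * U) i ⬝ᵥ (G ω * U) i) ^ q) ∂P
      ≤ ENNReal.ofReal ((12 * T) ^ q) :=
    lintegral_pow_le_of_lintegral_exp_le (fun ω => hnn _) hq hT1 hT2 fun l hl0 hl1 =>
      hG.lintegral_exp_row_le hp0 hp1 hU i hl0 hl1
  calc _ ≤ ∫⁻ ω, (ENNReal.ofReal (2 ^ (q - 1)) * ENNReal.ofReal (((S ω * U) i ⬝ᵥ (S ω * U) i) ^ q)
        + ENNReal.ofReal (2 ^ (q - 1)) * ENNReal.ofReal (((G ω * U) i ⬝ᵥ (G ω * U) i) ^ q)) ∂P := by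
        refine lintegral_mono fun ω => ?_
        rw [← ENNReal.ofReal_mul (by positivity), ← ENNReal.ofReal_mul (by positivity),
          ← ENNReal.ofReal_add (mul_nonneg (by positivity) (pow_nonneg (hnn _) _))
            (mul_nonneg (by positivity) (pow_nonneg (hnn _) _)), ← mul_add]
        refine ENNReal.ofReal_le_ofReal ?_
        exact (pow_le_pow_left₀ (hnn _) (row_interp_dotProduct_self_le ht0 ht1 _ _ U i) q).trans
          (add_pow_le (hnn _) (hnn _) q)
    _ = ENNReal.ofReal (2 ^ (q - 1)) * ∫⁻ ω, ENNReal.ofReal (((S ω * U) i ⬝ᵥ (S ω * U) i) ^ q) ∂P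
        + ENNReal.ofReal (2 ^ (q - 1)) *
          ∫⁻ ω, ENNReal.ofReal (((G ω * U) i ⬝ᵥ (G ω * U) i) ^ q) ∂P := by
        rw [lintegral_add_left', lintegral_const_mul' _ _ ENNReal.ofReal_ne_top,
          lintegral_const_mul' _ _ ENNReal.ofReal_ne_top]
        exact ((hmS.pow_const q).comp_aemeasurable hS.aemeasurable).ennreal_ofReal.const_mul _
    _ ≤ ENNReal.ofReal (2 ^ (q - 1)) * ENNReal.ofReal ((12 * T) ^ q)
        + ENNReal.ofReal (2 ^ (q - 1)) * ENNReal.ofReal ((12 * T) ^ q) := by gcongr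
    _ = ENNReal.ofReal ((24 * T) ^ q) := by
        rw [← ENNReal.ofReal_mul (by positivity), ← ENNReal.ofReal_add (by positivity)
          (by positivity)]
        congr 1
        obtain ⟨r, rfl⟩ : ∃ r, q = r + 1 := ⟨q - 1, by omega⟩
        rw [Nat.add_sub_cancel, show (24 : ℝ) * T = 2 * (12 * T) by ring, mul_pow 2]
        ring

lemma lintegral_comp_index {𝓥 : Type*} [MeasurableSpace 𝓥] {W : Ω → Fin m} {V : Ω → 𝓥}
    (hW : AEMeasurable W P) (hV : AEMeasurable V P) (hind : IndepFun W V P)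
    {g : Fin m → 𝓥 → ℝ≥0∞} (hg : ∀ i, Measurable (g i)) :
    ∫⁻ ω, g (W ω) (V ω) ∂P = ∑ i, P.map W {i} * ∫⁻ ω, g i (V ω) ∂P := by
  have e : ∀ ω, g (W ω) (V ω) = ∑ i, (fun j => if j = i then (1 : ℝ≥0∞) else 0) (W ω) * g i (V ω) := by
    intro ω
    simp
  have hm : ∀ i : Fin m, Measurable fun j : Fin m => if j = i then (1 : ℝ≥0∞) else 0 := fun i =>
    measurable_of_finite _
  rw [lintegral_congr e]
  refine (lintegral_finsetSum' _ fun i _ => AEMeasurable.mul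
    ((hm i).comp_aemeasurable hW) ((hg i).comp_aemeasurable hV)).trans ?_
  refine Finset.sum_congr rfl fun i _ => ?_
  have h1 := lintegral_mul_eq_lintegral_mul_lintegral_of_indepFun''
    ((hm i).comp_aemeasurable hW) ((hg i).comp_aemeasurable hV) (hind.comp (hm i) (hg i))
  refine h1.trans ?_
  congr 1
  change ∫⁻ ω, (fun j => if j = i then (1 : ℝ≥0∞) else 0) (W ω) ∂P = _
  rw [← lintegral_map' (f := fun j => if j = i then (1 : ℝ≥0∞) else 0) (hm i).aemeasurable hW,
    ← lintegral_indicator_one (MeasurableSet.singleton i)]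
  exact lintegral_congr fun j => by simp [Set.indicator_apply]

/-- Position `(l,γ)` averages over block `γ` with mass `p` per row; the blocks partition the rows,
so the sum over `γ` is `p` times the sum over all rows. Independence of `Z` and `V` allows the index
to be integrated first. -/
lemma sum_lintegral_index (hp0 : 0 < p) (hs : (s : ℝ) = p * m) (hd : s ∣ m) {𝓥 : Type*}
    [MeasurableSpace 𝓥] {Z : Ω → Gen m n s} {V : Ω → 𝓥} (hZ : HasLaw Z (genLaw m n s) P)
    (hV : AEMeasurable V P) (hind : IndepFun Z V P) {g : Fin n → Fin m → 𝓥 → ℝ≥0∞}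
    (hg : ∀ l i, Measurable (g l i)) :
    ∑ x : Fin n × Fin s, ∫⁻ ω, g x.1 ((Z ω).2 x) (V ω) ∂P
      = ENNReal.ofReal p * ∑ l, ∑ i, ∫⁻ ω, g l i (V ω) ∂P := by
  have h : ∀ x : Fin n × Fin s, ∫⁻ ω, g x.1 ((Z ω).2 x) (V ω) ∂P
      = ∑ i, ENNReal.ofReal (if i ∈ block m s x.2 then p else 0) * ∫⁻ ω, g x.1 i (V ω) ∂P := by
    intro x
    have hm : Measurable fun z : Gen m n s => z.2 x := by fun_prop
    refine (lintegral_comp_index (W := fun ω => (Z ω).2 x) (hm.comp_aemeasurable hZ.aemeasurable) hV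
      (hind.comp hm measurable_id) (hg x.1)).trans ?_
    have e : P.map (fun ω => (Z ω).2 x) = uniformOn (block m s x.2) := by
      rw [← (hasLaw_index hs hd x).map_eq, ← hZ.map_eq,
        AEMeasurable.map_map_of_aemeasurable hm.aemeasurable hZ.aemeasurable]
      rfl
    rw [e]
    simp_rw [uniformOn_block_singleton hs hd]
  simp_rw [h]
  rw [Fintype.sum_prod_type, Finset.mul_sum]
  refine Finset.sum_congr rfl fun l _ => ?_
  rw [Finset.sum_comm, Finset.mul_sum]
  refine Finset.sum_congr rfl fun i _ => ?_
  change ∑ γ : Fin s, ENNReal.ofReal (if i ∈ block m s γ then p else 0) *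
    ∫⁻ ω, g l i (V ω) ∂P = _
  rw [← Finset.sum_mul, ← ENNReal.ofReal_sum_of_nonneg fun γ _ => by split_ifs <;> positivity,
    sum_ite_mem_block hs hd i]
  have : (0 : ℝ) < s := by rw [hs]; have := i.pos; positivity
  exact_mod_cast this

end Rows

/-! ### The Hölder inequality behind the trace inequality -/

section Holder

variable {Ω : Type*} [MeasurableSpace Ω] {P : Measure Ω}

lemma sum_lintegral_prod_rpow_le {ι κ : Type*} [Fintype ι] [Fintype κ] {f : ι → κ → Ω → ℝ≥0∞}
    (hf : ∀ i x, AEMeasurable (f i x) P) {w : ι → ℝ} (hw : ∑ i, w i = 1) (hw0 : ∀ i, 0 ≤ w i) :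
    ∑ x, ∫⁻ ω, ∏ i, f i x ω ^ w i ∂P ≤ ∏ i, (∑ x, ∫⁻ ω, f i x ω ∂P) ^ w i := by
  let _ : MeasurableSpace κ := ⊤
  have h := ENNReal.lintegral_prod_norm_pow_le (μ := (Measure.count : Measure κ)) Finset.univ
    (f := fun i x => ∫⁻ ω, f i x ω ∂P) (fun i _ => (measurable_from_top).aemeasurable) hw
    fun i _ => hw0 i
  simp only [lintegral_count, tsum_fintype] at h
  refine (Finset.sum_le_sum fun x _ => ?_).trans h
  exact ENNReal.lintegral_prod_norm_pow_le Finset.univ (fun i _ => hf i x) hw fun i _ => hw0 i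

lemma prod_rpow_const_of_nonneg {ι : Type*} (s : Finset ι) (a : ℝ≥0∞) {w : ι → ℝ}
    (hw : ∀ i, 0 ≤ w i) : ∏ i ∈ s, a ^ w i = a ^ ∑ i ∈ s, w i := by
  classical
  induction s using Finset.induction_on with
  | empty => simp
  | insert i s hi ih =>
    rw [Finset.prod_insert hi, Finset.sum_insert hi, ih,
      ENNReal.rpow_add_of_nonneg _ _ (hw i) (Finset.sum_nonneg fun j _ => hw j)]

/-- The exponents in Hölder's inequality. The factors are `u^q w_i^q`, `u wB_i` and `w_j uA_i`, with
weights `θ κ_i`, `aw_i` and `κ_j au_i`. The weights sum to `θ + ∑ aw + ∑ au = 1`. Spreading `uA_i`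
over all `j` distributes the available powers of the `w_j`, and each factor involves only one index
of `w` or `wB`. -/
lemma sum_lintegral_prod_le {κ : Type*} [Fintype κ] {k : ℕ} {q θ : ℝ} (hq : 0 < q) (hθ : 0 < θ)
    (hθq : q * θ + (1 - θ) = k / 2)
    {u : κ → ℝ≥0∞} {uA w wB : Fin k → κ → Ω → ℝ≥0∞} {au aw : Fin k → ℝ}
    (huA : ∀ i x, AEMeasurable (uA i x) P) (hwm : ∀ i x, AEMeasurable (w i x) P)
    (hwB : ∀ i x, AEMeasurable (wB i x) P)
    (hau0 : ∀ i, 0 ≤ au i) (haw0 : ∀ i, 0 ≤ aw i) (hau1 : ∀ i, au i ≤ 1 / 2)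
    (haw1 : ∀ i, aw i ≤ 1 / 2) (hsum : ∑ i, au i + ∑ i, aw i = 1 - θ)
    {R : ℝ≥0∞} {Bu Bw : Fin k → ℝ≥0∞}
    (hR : ∀ i, ∑ x, ∫⁻ ω, u x ^ q * w i x ω ^ q ∂P ≤ R)
    (hBw : ∀ i, ∑ x, ∫⁻ ω, u x * wB i x ω ∂P ≤ Bw i)
    (hBu : ∀ i j, ∑ x, ∫⁻ ω, w j x ω * uA i x ω ∂P ≤ Bu i) :
    ∑ x, ∫⁻ ω, ∏ i, ((u x ^ (1 / 2 - au i) * uA i x ω ^ au i) *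
        (w i x ω ^ (1 / 2 - aw i) * wB i x ω ^ aw i)) ∂P
      ≤ R ^ θ * ∏ i, (Bu i ^ au i * Bw i ^ aw i) := by
  set Au := ∑ i, au i with hAu
  set Aw := ∑ i, aw i with hAw
  have hAu0 : 0 ≤ Au := Finset.sum_nonneg fun i _ => hau0 i
  have hAw0 : 0 ≤ Aw := Finset.sum_nonneg fun i _ => haw0 i
  have hq0 : 0 ≤ q * θ := mul_nonneg hq.le hθ.le
  have hk : 0 < 2 * (q * θ) + 2 * Au := by
    have := mul_pos hq hθ; linarith
  -- Forced by the exponent of `w_i`: it receives `q θ κ_i` from the first kind of factor and `κ_i ∑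
  -- au` from the third, and these must add up to `1/2 - aw_i`.
  set κ' : Fin k → ℝ := fun i => (1 - 2 * aw i) / (2 * (q * θ) + 2 * Au) with hκ
  have hκ0 : ∀ i, 0 ≤ κ' i := fun i => div_nonneg (by linarith [haw1 i]) hk.le
  have hκ1 : ∑ i, κ' i = 1 := by
    rw [hκ, ← Finset.sum_div, div_eq_one_iff_eq hk.ne', Finset.sum_sub_distrib, ← Finset.mul_sum]
    simp only [Finset.sum_const, Finset.card_univ, Fintype.card_fin, nsmul_eq_mul, mul_one]
    linarith
  have hκw : ∀ i, q * (θ * κ' i) + κ' i * Au = 1 / 2 - aw i := fun i => by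
    have : κ' i * (2 * (q * θ) + 2 * Au) = 1 - 2 * aw i := div_mul_cancel₀ _ hk.ne'
    linarith
  set f : Fin k ⊕ Fin k ⊕ Fin k × Fin k → κ → Ω → ℝ≥0∞ := fun y x ω => match y with
    | .inl i => u x ^ q * w i x ω ^ q
    | .inr (.inl i) => u x * wB i x ω
    | .inr (.inr (j, i)) => w j x ω * uA i x ω with hf
  set W : Fin k ⊕ Fin k ⊕ Fin k × Fin k → ℝ := fun y => match y with
    | .inl i => θ * κ' i
    | .inr (.inl i) => aw i
    | .inr (.inr (j, i)) => κ' j * au i with hW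
  have hW0 : ∀ y, 0 ≤ W y := by
    rintro (i | i | ⟨j, i⟩)
    · exact mul_nonneg hθ.le (hκ0 i)
    · exact haw0 i
    · exact mul_nonneg (hκ0 j) (hau0 i)
  have hW1 : ∑ y, W y = 1 := by
    rw [Fintype.sum_sum_type, Fintype.sum_sum_type, Fintype.sum_prod_type]
    simp only [hW]
    simp_rw [← Finset.mul_sum, ← Finset.sum_mul]
    rw [hκ1]
    linarith
  have hfm : ∀ y x, AEMeasurable (f y x) P := by
    rintro (i | i | ⟨j, i⟩) x
    · exact ((hwm i x).pow_const q).const_mul _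
    · exact (hwB i x).const_mul _
    · exact (hwm j x).mul (huA i x)
  have hpt : ∀ x ω, ∏ i, ((u x ^ (1 / 2 - au i) * uA i x ω ^ au i) *
        (w i x ω ^ (1 / 2 - aw i) * wB i x ω ^ aw i)) = ∏ y, f y x ω ^ W y := by
    intro x ω
    rw [Fintype.prod_sum_type, Fintype.prod_sum_type, Fintype.prod_prod_type]
    simp only [hf, hW]
    simp_rw [ENNReal.mul_rpow_of_nonneg _ _ (mul_nonneg hθ.le (hκ0 _)),
      ENNReal.mul_rpow_of_nonneg _ _ (haw0 _),
      ENNReal.mul_rpow_of_nonneg _ _ (mul_nonneg (hκ0 _) (hau0 _)), Finset.prod_mul_distrib,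
      ← ENNReal.rpow_mul]
    -- The exponent of `u` is `k/2 - ∑ au`; by `hθq` and `hsum` it equals `q θ + ∑ aw`.
    have e1 : ∏ i, u x ^ (1 / 2 - au i) = (∏ i, u x ^ (q * (θ * κ' i))) * ∏ i, u x ^ aw i := by
      rw [prod_rpow_const_of_nonneg _ _ fun i => by linarith [hau1 i],
        prod_rpow_const_of_nonneg _ _ fun i => mul_nonneg hq.le (mul_nonneg hθ.le (hκ0 i)),
        prod_rpow_const_of_nonneg _ _ haw0,
        ← ENNReal.rpow_add_of_nonneg _ _ (Finset.sum_nonneg fun i _ =>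
          mul_nonneg hq.le (mul_nonneg hθ.le (hκ0 i))) hAw0, Finset.sum_sub_distrib,
        ← Finset.mul_sum, ← Finset.mul_sum, hκ1]
      congr 1
      simp only [Finset.sum_const, Finset.card_univ, Fintype.card_fin, nsmul_eq_mul]
      linarith
    have e2 : ∏ i, w i x ω ^ (1 / 2 - aw i)
        = (∏ i, w i x ω ^ (q * (θ * κ' i))) * ∏ j, ∏ i, w j x ω ^ (κ' j * au i) := by
      rw [← Finset.prod_mul_distrib]
      refine Finset.prod_congr rfl fun i _ => ?_
      rw [prod_rpow_const_of_nonneg _ _ fun j => mul_nonneg (hκ0 i) (hau0 j), ← Finset.mul_sum,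
        ← ENNReal.rpow_add_of_nonneg _ _ (mul_nonneg hq.le (mul_nonneg hθ.le (hκ0 i)))
          (mul_nonneg (hκ0 i) hAu0), hκw]
    have e3 : ∏ j, ∏ i, uA i x ω ^ (κ' j * au i) = ∏ i, uA i x ω ^ au i := by
      rw [Finset.prod_comm]
      refine Finset.prod_congr rfl fun i _ => ?_
      rw [prod_rpow_const_of_nonneg _ _ fun j => mul_nonneg (hκ0 j) (hau0 i), ← Finset.sum_mul,
        hκ1, one_mul]
    rw [e1, e2, e3]
    ring
  simp_rw [hpt]
  refine (sum_lintegral_prod_rpow_le hfm hW1 hW0).trans ?_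
  rw [Fintype.prod_sum_type, Fintype.prod_sum_type, Fintype.prod_prod_type]
  simp only [hf, hW]
  have b1 : ∏ i, (∑ x, ∫⁻ ω, u x ^ q * w i x ω ^ q ∂P) ^ (θ * κ' i) ≤ R ^ θ := by
    calc _ ≤ ∏ i, R ^ (θ * κ' i) := Finset.prod_le_prod' fun i _ =>
          ENNReal.rpow_le_rpow (hR i) (mul_nonneg hθ.le (hκ0 i))
      _ = R ^ θ := by
          rw [prod_rpow_const_of_nonneg _ _ fun i => mul_nonneg hθ.le (hκ0 i), ← Finset.mul_sum,
            hκ1, mul_one]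
  have b2 : ∏ i, (∑ x, ∫⁻ ω, u x * wB i x ω ∂P) ^ aw i ≤ ∏ i, Bw i ^ aw i :=
    Finset.prod_le_prod' fun i _ => ENNReal.rpow_le_rpow (hBw i) (haw0 i)
  have b3 : ∏ j, ∏ i, (∑ x, ∫⁻ ω, w j x ω * uA i x ω ∂P) ^ (κ' j * au i) ≤ ∏ i, Bu i ^ au i := by
    calc _ ≤ ∏ j, ∏ i, Bu i ^ (κ' j * au i) := Finset.prod_le_prod' fun j _ =>
          Finset.prod_le_prod' fun i _ =>
            ENNReal.rpow_le_rpow (hBu i j) (mul_nonneg (hκ0 j) (hau0 i))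
      _ = _ := by
          rw [Finset.prod_comm]
          refine Finset.prod_congr rfl fun i _ => ?_
          rw [prod_rpow_const_of_nonneg _ _ fun j => mul_nonneg (hκ0 j) (hau0 i), ← Finset.sum_mul,
            hκ1, one_mul]
  rw [Finset.prod_mul_distrib, mul_comm (∏ i, Bu i ^ au i)]
  exact mul_le_mul' b1 (mul_le_mul' b2 b3)

end Holder

/-! ### The trace of a product of rank one matrices -/

section TraceProd

variable {d : ℕ}

lemma list_prod_vecMulVec_mul (k : ℕ) (a b : Fin (k + 1) → Fin d → ℝ)
    (Y : Fin (k + 1) → Matrix (Fin d) (Fin d) ℝ) :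
    (List.ofFn fun i => vecMulVec (a i) (b i) * Y i).prod
      = (∏ i : Fin k, b i.castSucc ⬝ᵥ (Y i.castSucc *ᵥ a i.succ)) •
        (vecMulVec (a 0) (b (Fin.last k)) * Y (Fin.last k)) := by
  induction k with
  | zero => simp
  | succ k ih =>
    rw [List.ofFn_succ, List.prod_cons, ih (fun i => a i.succ) (fun i => b i.succ) fun i => Y i.succ,
      Fin.prod_univ_succ, mul_smul_comm, mul_comm (b (Fin.castSucc 0) ⬝ᵥ _), mul_smul]
    simp only [Fin.succ_castSucc, Fin.succ_last, Fin.castSucc_zero]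
    congr 1
    have : vecMulVec (a 0) (b 0) * Y 0 * vecMulVec (a (Fin.succ 0)) (b (Fin.last (k + 1)))
        = (b 0 ⬝ᵥ (Y 0 *ᵥ a (Fin.succ 0))) • vecMulVec (a 0) (b (Fin.last (k + 1))) := by
      rw [vecMulVec_mul, vecMulVec_mul_vecMulVec, dotProduct_mulVec, vecMulVec_smul]
    rw [← mul_assoc, this, smul_mul_assoc]

/-- Addition in `Fin k` wraps around, so `i + 1` closes the cycle: the last form contains the first
vector `a 0`. -/
lemma trace_list_prod_vecMulVec_mul {k : ℕ} [NeZero k] (a b : Fin k → Fin d → ℝ)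
    (Y : Fin k → Matrix (Fin d) (Fin d) ℝ) :
    (List.ofFn fun i => vecMulVec (a i) (b i) * Y i).prod.trace
      = ∏ i, b i ⬝ᵥ (Y i *ᵥ a (i + 1)) := by
  obtain ⟨k, rfl⟩ : ∃ l, k = l + 1 := ⟨k - 1, by have := NeZero.ne k; omega⟩
  rw [list_prod_vecMulVec_mul, trace_smul, smul_eq_mul, vecMulVec_mul, trace_vecMulVec,
    Fin.prod_univ_castSucc, dotProduct_comm (a 0), ← dotProduct_mulVec]
  congr 1
  · exact Finset.prod_congr rfl fun i _ => by rw [Fin.coeSucc_eq_succ]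
  · rw [Fin.last_add_one]

end TraceProd

/-! ### Splitting the factors of the trace -/

section Half

variable {d : ℕ}

/-- The exponent `q' / (2 β)`. -/
def halfExp (β : ℝ≥0∞) (q' : ℝ) : ℝ := q' * (β⁻¹).toReal / 2

/-- The weight `|M|^{β/q'}`, replaced by `0` for `β = ∞`. -/
def halfMat (β : ℝ≥0∞) (q' : ℝ) (M : Matrix (Fin d) (Fin d) ℝ) : Matrix (Fin d) (Fin d) ℝ :=
  if β = ∞ then 0 else absPow (β.toReal / q') M

/-- The constant that replaces the weights for `β = ∞`. -/
def halfConst {Ω : Type*} [MeasurableSpace Ω] (β : ℝ≥0∞) (M : Ω → Matrix (Fin d) (Fin d) ℝ)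
    (P : Measure Ω) : ℝ :=
  if β = ∞ then (eLpNorm (fun ω => opNorm (M ω)) ∞ P).toReal else 1

/-- The factor of the vector `v` in the bound on a bilinear form. -/
def halfTerm (β : ℝ≥0∞) (q' : ℝ) (v : Fin d → ℝ) (M : Matrix (Fin d) (Fin d) ℝ) : ℝ :=
  (v ⬝ᵥ v) ^ (1 / 2 - halfExp β q') * (v ⬝ᵥ (halfMat β q' M *ᵥ v)) ^ halfExp β q'

lemma dotProduct_self_nonneg' {ι : Type*} [Fintype ι] (v : ι → ℝ) : 0 ≤ v ⬝ᵥ v :=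
  Finset.sum_nonneg fun _ _ => mul_self_nonneg _

lemma dotProduct_halfMat_nonneg (β : ℝ≥0∞) (q' : ℝ) (v : Fin d → ℝ)
    (M : Matrix (Fin d) (Fin d) ℝ) : 0 ≤ v ⬝ᵥ (halfMat β q' M *ᵥ v) := by
  rw [halfMat]
  split_ifs
  · simp
  · exact dotProduct_absPow_nonneg _ _ _

lemma halfTerm_nonneg (β : ℝ≥0∞) (q' : ℝ) (v : Fin d → ℝ) (M : Matrix (Fin d) (Fin d) ℝ) :
    0 ≤ halfTerm β q' v M :=
  mul_nonneg (Real.rpow_nonneg (dotProduct_self_nonneg' v) _)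
    (Real.rpow_nonneg (dotProduct_halfMat_nonneg _ _ _ _) _)

lemma halfTerm_smul (β : ℝ≥0∞) (q' : ℝ) {c : ℝ} (hc : |c| = 1) (v : Fin d → ℝ)
    (M : Matrix (Fin d) (Fin d) ℝ) : halfTerm β q' (c • v) M = halfTerm β q' v M := by
  have hc2 : c * c = 1 := by rw [← sq, ← sq_abs, hc, one_pow]
  simp only [halfTerm, mulVec_smul, dotProduct_smul, smul_dotProduct, smul_eq_mul, ← mul_assoc,
    hc2, one_mul]

lemma measurable_halfMat (β : ℝ≥0∞) {q' : ℝ} (hq' : 0 < q') :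
    Measurable (halfMat β q' : Matrix (Fin d) (Fin d) ℝ → _) := by
  unfold halfMat
  split_ifs
  · exact measurable_const
  · exact measurable_absPow (div_nonneg ENNReal.toReal_nonneg hq'.le)

lemma halfConst_nonneg {Ω : Type*} [MeasurableSpace Ω] (β : ℝ≥0∞)
    (M : Ω → Matrix (Fin d) (Fin d) ℝ) (P : Measure Ω) : 0 ≤ halfConst β M P := by
  rw [halfConst]
  split_ifs
  · exact ENNReal.toReal_nonneg
  · exact zero_le_one

lemma MemLinfty.ae_opNorm_le {Ω : Type*} [MeasurableSpace Ω] {P : Measure Ω}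
    {M : Ω → Matrix (Fin d) (Fin d) ℝ} (hM : MemLinfty M P) :
    ∀ᵐ ω ∂P, opNorm (M ω) ≤ (eLpNorm (fun ω => opNorm (M ω)) ∞ P).toReal := by
  have h := ae_le_eLpNormEssSup (f := fun ω => opNorm (M ω)) (μ := P)
  filter_upwards [h] with ω hω
  rw [← eLpNorm_exponent_top] at hω
  have := ENNReal.toReal_mono hM.2.eLpNorm_ne_top hω
  rw [toReal_enorm] at this
  exact (Real.le_norm_self _).trans this

/-- For finite `β` this is the bound with `r = β / q'`, and `hβ` says `r ≥ 1`. For `β = ∞` the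
exponent `halfExp` is `0`, so the default weight `0` enters only as `0 ^ 0 = 1` and the operator
norm moves into `halfConst`. One null set serves all `b` and `v`. -/
lemma ae_abs_dotProduct_le {Ω : Type*} [MeasurableSpace Ω] {P : Measure Ω}
    {M : Ω → Matrix (Fin d) (Fin d) ℝ} (hM : MemLinfty M P) {β : ℝ≥0∞} {q' : ℝ} (hq' : 0 < q')
    (hβ : β ≠ ∞ → q' ≤ β.toReal) :
    ∀ᵐ ω ∂P, ∀ b v : Fin d → ℝ, |b ⬝ᵥ (M ω *ᵥ v)| ≤
      halfConst β M P * (halfTerm β q' b (M ω)ᵀ * halfTerm β q' v (M ω)) := by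
  filter_upwards [hM.ae_opNorm_le] with ω hω b v
  by_cases h : β = ∞
  · have h0 : halfExp β q' = 0 := by simp [halfExp, h]
    refine (abs_dotProduct_mulVec_le_opNorm (M ω) b v).trans ?_
    simp only [halfConst, if_pos h, halfTerm, h0, sub_zero, Real.rpow_zero, mul_one]
    exact mul_le_mul_of_nonneg_right hω (mul_nonneg
      (Real.rpow_nonneg (dotProduct_self_nonneg' b) _)
      (Real.rpow_nonneg (dotProduct_self_nonneg' v) _))
  · have h1 : 1 ≤ β.toReal / q' := by rw [le_div_iff₀ hq', one_mul]; exact hβ h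
    have h2 : halfExp β q' = (2 * (β.toReal / q'))⁻¹ := by
      rw [halfExp, ENNReal.toReal_inv, mul_inv, inv_div]; ring
    simp only [halfConst, if_neg h, halfTerm, halfMat, one_mul, h2]
    exact abs_dotProduct_mulVec_le_absPow h1 (M ω) b v

/-- A crude bound that makes `Tr |M|^β` integrable for essentially bounded `M`, so that the Bochner
integral in `schattenNorm` has its intended value. -/
lemma trace_absPow_le {r : ℝ} (hr : 0 ≤ r) (M : Matrix (Fin d) (Fin d) ℝ) :
    (absPow r M).trace ≤ d * opNorm M ^ r := by
  obtain ⟨a, e, W, V, C, hW, hW', -, -, -, hg, -, -, -, -, ha, -⟩ :=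
    exists_singular_decomposition M
  have hn : 0 ≤ opNorm M := norm_nonneg _
  rw [absPow, hg, trace_conj_diagonal hW]
  have hak : ∀ k, a k ≤ opNorm M ^ 2 := by
    intro k
    have h0 : Mᵀ * M = W * diagonal a * Wᵀ := by
      have := hg id
      rwa [cfc_id ℝ _ (isHermitian_transpose_mul M).isSelfAdjoint] at this
    set v := W *ᵥ (Pi.single k 1 : Fin d → ℝ) with hv
    have hWv : Wᵀ *ᵥ v = Pi.single k 1 := by rw [hv, mulVec_mulVec, hW, one_mulVec]
    have h1 : (M *ᵥ v) ⬝ᵥ (M *ᵥ v) = a k := by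
      have := dotProduct_conj_diagonal W a v
      rw [← h0, hWv, ← mulVec_mulVec, dotProduct_mulVec, ← mulVec_transpose, transpose_transpose]
        at this
      rw [this, Finset.sum_eq_single k]
      · simp
      · intro j _ hj; simp [hj]
      · simp
    have h2 : v ⬝ᵥ v = 1 := by
      rw [dotProduct_self_orthogonal hW' v, hWv, Finset.sum_eq_single k]
      · simp
      · intro j _ hj; simp [hj]
      · simp
    have h3 := toEuclideanCLM_ofLp M v
    rw [norm_toLp_eq_sqrt, norm_toLp_eq_sqrt, h1, h2, Real.sqrt_one, mul_one] at h3
    exact (Real.sqrt_le_left hn).1 h3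
  calc ∑ k, ((fun x : ℝ => x ^ (r / 2)) ∘ a) k ≤ ∑ _k : Fin d, opNorm M ^ r := by
        refine Finset.sum_le_sum fun k _ => ?_
        refine (Real.rpow_le_rpow (ha k) (hak k) (by positivity)).trans (le_of_eq ?_)
        rw [← Real.rpow_natCast, ← Real.rpow_mul hn]
        congr 1
        push_cast
        ring
    _ = _ := by simp

lemma measurable_trace_absPow {r : ℝ} (hr : 0 ≤ r) :
    Measurable fun M : Matrix (Fin d) (Fin d) ℝ => (absPow r M).trace := by
  have h1 : Measurable fun A : Matrix (Fin d) (Fin d) ℝ => A.trace :=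
    Continuous.measurable (by fun_prop)
  exact h1.comp (measurable_absPow hr)

lemma schattenNorm_nonneg {Ω : Type*} [MeasurableSpace Ω] {P : Measure Ω}
    (M : Ω → Matrix (Fin d) (Fin d) ℝ) {β : ℝ≥0∞} (hβ0 : β ≠ 0) : 0 ≤ schattenNorm β M P := by
  rw [schattenNorm]
  split_ifs with h
  · exact ENNReal.toReal_nonneg
  · refine Real.rpow_nonneg (integral_nonneg fun ω => ?_) _
    rw [abs_rpow_eq_absPow (ENNReal.toReal_pos hβ0 h), ntr]
    exact mul_nonneg (by positivity) (trace_absPow_nonneg _ _)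

lemma lintegral_trace_absPow_rpow {Ω : Type*} [MeasurableSpace Ω] {P : Measure Ω}
    [IsProbabilityMeasure P] {M : Ω → Matrix (Fin d) (Fin d) ℝ} (hM : MemLinfty M P) (hd : 0 < d)
    {β : ℝ≥0∞} (hβ0 : β ≠ 0) (hβ : β ≠ ∞) :
    (∫⁻ ω, ENNReal.ofReal (absPow β.toReal (M ω)).trace ∂P) ^ (β⁻¹).toReal
      = ENNReal.ofReal ((d : ℝ) ^ (β⁻¹).toReal * schattenNorm β M P) := by
  have hb : 0 < β.toReal := ENNReal.toReal_pos hβ0 hβ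
  have hd' : (0 : ℝ) < d := by exact_mod_cast hd
  have hint : Integrable (fun ω => (absPow β.toReal (M ω)).trace) P := by
    refine (allMoments_of_ae_bound ((measurable_trace_absPow hb.le).comp_aemeasurable hM.1)
      (C := d * (eLpNorm (fun ω => opNorm (M ω)) ∞ P).toReal ^ β.toReal) ?_).integrable
    filter_upwards [hM.ae_opNorm_le] with ω hω
    simp only [Function.comp_apply]
    rw [abs_of_nonneg (trace_absPow_nonneg _ _)]
    refine (trace_absPow_le hb.le _).trans ?_
    have : 0 ≤ opNorm (M ω) := norm_nonneg _
    gcongr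
  have hI : ∫ ω, (absPow β.toReal (M ω)).trace ∂P
      = d * ∫ ω, ntr (CFC.abs (M ω) ^ β.toReal) ∂P := by
    simp_rw [abs_rpow_eq_absPow hb, ntr]
    rw [integral_const_mul, mul_inv_cancel_left₀ hd'.ne']
  have hI0 : 0 ≤ ∫ ω, ntr (CFC.abs (M ω) ^ β.toReal) ∂P := by
    refine integral_nonneg fun ω => ?_
    rw [abs_rpow_eq_absPow hb, ntr]
    exact mul_nonneg (by positivity) (trace_absPow_nonneg _ _)
  rw [← ofReal_integral_eq_lintegral_ofReal hint
    (Filter.Eventually.of_forall fun ω => trace_absPow_nonneg _ _), hI, schattenNorm, if_neg hβ,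
    ENNReal.ofReal_rpow_of_nonneg (by positivity) ENNReal.toReal_nonneg,
    Real.mul_rpow hd'.le hI0, ENNReal.toReal_inv, one_div]

end Half

/-! ### Regrouping the factors -/

section Regroup

variable {m n s d k : ℕ} [NeZero k]

/-- The index of the bilinear form that contains the `i`-th vector `ξ u_l`. -/
def signIdx (τ : Fin k → Equiv.Perm (Fin 2)) (i : Fin k) : Fin k := if τ i 0 = 0 then i - 1 else i

/-- The index of the bilinear form that contains the `i`-th row of `M₂ U`. -/
def rowIdx (τ : Fin k → Equiv.Perm (Fin 2)) (i : Fin k) : Fin k := if τ i 0 = 0 then i else i - 1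

/-- The matrix whose weight is evaluated at the `i`-th vector `ξ u_l`. -/
def signMat (τ : Fin k → Equiv.Perm (Fin 2)) (Y : Fin k → Matrix (Fin d) (Fin d) ℝ) (i : Fin k) :
    Matrix (Fin d) (Fin d) ℝ := if τ i 0 = 0 then Y (i - 1) else (Y i)ᵀ

/-- The matrix whose weight is evaluated at the `i`-th row of `M₂ U`. -/
def rowMat (τ : Fin k → Equiv.Perm (Fin 2)) (Y : Fin k → Matrix (Fin d) (Fin d) ℝ) (i : Fin k) :
    Matrix (Fin d) (Fin d) ℝ := if τ i 0 = 0 then (Y i)ᵀ else Y (i - 1)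

/-- For each `i` the two indices are `i` and `i - 1` in some order, whatever `τ i` is. So every form
is counted twice, once for each of its vectors. -/
lemma prod_signIdx_mul_rowIdx {M : Type*} [CommMonoid M] (τ : Fin k → Equiv.Perm (Fin 2))
    (f : Fin k → M) : ∏ i, (f (signIdx τ i) * f (rowIdx τ i)) = ∏ i, (f i * f i) := by
  have h : ∀ i, f (signIdx τ i) * f (rowIdx τ i) = f i * f (i - 1) := by
    intro i
    rw [signIdx, rowIdx]
    split_ifs
    · exact mul_comm _ _
    · rfl
  simp_rw [h, Finset.prod_mul_distrib]
  congr 1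
  exact Equiv.prod_comp (Equiv.subRight (1 : Fin k)) f

lemma sum_signIdx_add_rowIdx (τ : Fin k → Equiv.Perm (Fin 2)) (f : Fin k → ℝ) :
    ∑ i, f (signIdx τ i) + ∑ i, f (rowIdx τ i) = 2 * ∑ i, f i := by
  have h : ∀ i, f (signIdx τ i) + f (rowIdx τ i) = f i + f (i - 1) := by
    intro i
    rw [signIdx, rowIdx]
    split_ifs
    · exact add_comm _ _
    · rfl
  rw [← Finset.sum_add_distrib]
  simp_rw [h, Finset.sum_add_distrib]
  rw [two_mul]
  congr 1
  exact Equiv.sum_comp (Equiv.subRight (1 : Fin k)) f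

/-- The bounds are regrouped by vector instead of by form: the left vector of block `i` lies in form
`i - 1` and is weighted by `Y (i - 1)`, the right one lies in form `i` and is weighted by the
transpose of `Y i`. Signs drop out of `halfTerm`. -/
lemma abs_trace_traceProd_le (U : Matrix (Fin n) (Fin d) ℝ) (M₂ : Matrix (Fin m) (Fin n) ℝ)
    {z : Fin k → Gen m n s} (τ : Fin k → Equiv.Perm (Fin 2))
    {Y : Fin k → Matrix (Fin d) (Fin d) ℝ} {x : Fin n × Fin s} (hz : ∀ i, |(z i).1 x| = 1)
    {β : Fin k → ℝ≥0∞} {q' : ℝ} {K : Fin k → ℝ}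
    (h : ∀ i (b v : Fin d → ℝ), |b ⬝ᵥ (Y i *ᵥ v)| ≤
      K i * (halfTerm (β i) q' b (Y i)ᵀ * halfTerm (β i) q' v (Y i))) :
    |(traceProd U M₂ z τ Y x).trace| ≤ (∏ i, K i) *
      ∏ i, (halfTerm (β (signIdx τ i)) q' (U x.1) (signMat τ Y i) *
        halfTerm (β (rowIdx τ i)) q' ((M₂ * U) ((z i).2 x)) (rowMat τ Y i)) := by
  rw [traceProd, trace_list_prod_vecMulVec_mul (fun i => Theta U M₂ (z i) x (τ i 0))
    (fun i => Theta U M₂ (z i) x (τ i 1)), Finset.abs_prod]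
  refine (Finset.prod_le_prod (fun _ _ => abs_nonneg _) fun i _ => h i _ _).trans (le_of_eq ?_)
  rw [Finset.prod_mul_distrib]
  congr 1
  set g : Fin k → ℝ := fun i => halfTerm (β i) q' (Theta U M₂ (z (i + 1)) x (τ (i + 1) 0)) (Y i)
    with hg
  rw [Finset.prod_mul_distrib, ← Equiv.prod_comp (Equiv.subRight (1 : Fin k)) g,
    ← Finset.prod_mul_distrib]
  refine Finset.prod_congr rfl fun i _ => ?_
  simp only [hg, Equiv.subRight_apply, sub_add_cancel, signIdx, rowIdx, signMat, rowMat]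
  by_cases h0 : τ i 0 = 0
  · have h1 : τ i 1 = 1 := by
      have : τ i 1 ≠ 0 := fun h => by
        have := (τ i).injective (h.trans h0.symm); simp at this
      omega
    simp only [h0, h1, Theta, if_true]
    rw [mul_comm]
    congr 1
    exact halfTerm_smul _ _ (hz i) _ _
  · have h0' : τ i 0 = 1 := by omega
    have h1 : τ i 1 = 0 := by
      have : τ i 1 ≠ 1 := fun h => by
        have := (τ i).injective (h.trans h0'.symm); simp at this
      omega
    simp only [h0', h1, Theta, one_ne_zero, if_false]
    congr 1
    exact halfTerm_smul _ _ (hz i) _ _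

end Regroup

/-! ### Integrability -/

section Integrability

variable {m n s d k : ℕ} {p : ℝ} {Ω : Type*} [MeasurableSpace Ω] {P : Measure Ω}

lemma ae_abs_sign_of_hasLaw (hs : (s : ℝ) = p * m) (hd : s ∣ m) {Z : Ω → Gen m n s}
    (hZ : HasLaw Z (genLaw m n s) P) : ∀ᵐ ω ∂P, ∀ x, |(Z ω).1 x| = 1 := by
  have hm : MeasurableSet {z : Gen m n s | ∀ x, |z.1 x| = 1} := by
    rw [Set.ofPred_forall]
    refine MeasurableSet.iInter fun x => measurableSet_eq_fun ?_ measurable_const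
    have : Measurable fun z : Gen m n s => z.1 x := by fun_prop
    simpa using this.abs
  have := ae_abs_sign (n := n) hs hd
  rw [← hZ.map_eq, ae_map_iff hZ.aemeasurable hm] at this
  exact this

variable [IsProbabilityMeasure P]

lemma allMoments_Theta (hs : (s : ℝ) = p * m) (hd : s ∣ m) {Z : Ω → Gen m n s}
    (hZ : HasLaw Z (genLaw m n s) P) (U : Matrix (Fin n) (Fin d) ℝ)
    {T : Ω → Matrix (Fin m) (Fin n) ℝ} (hT : ∀ i j, AllMoments (fun ω => T ω i j) P)
    (x : Fin n × Fin s) (e : Fin 2) (a : Fin d) :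
    AllMoments (fun ω => Theta U (T ω) (Z ω) x e a) P := by
  have h0 : AllMoments (fun ω => (Z ω).1 x * U x.1 a) P := by
    have hm : Measurable fun z : Gen m n s => z.1 x := by fun_prop
    refine (allMoments_of_ae_bound (hm.comp_aemeasurable hZ.aemeasurable) (C := 1) ?_).mul
      (allMoments_const _)
    filter_upwards [ae_abs_sign_of_hasLaw hs hd hZ] with ω hω
    exact (hω x).le
  have h1 : AllMoments (fun ω => (T ω * U) ((Z ω).2 x) a) P := by
    have e1 : ∀ ω, (T ω * U) ((Z ω).2 x) a
        = ∑ i, (fun j => if j = i then (1 : ℝ) else 0) ((Z ω).2 x) * (T ω * U) i a := by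
      intro ω; simp
    simp_rw [e1]
    refine AllMoments.sum fun i _ => AllMoments.mul ?_
      (allMoments_matrix_mul hT (B := fun _ => U) (fun _ _ => allMoments_const _) i a)
    have hm : Measurable fun z : Gen m n s => z.2 x := by fun_prop
    refine allMoments_of_ae_bound (((measurable_of_finite
      fun j : Fin m => if j = i then (1 : ℝ) else 0).comp hm).comp_aemeasurable hZ.aemeasurable)
      (C := 1) (Filter.Eventually.of_forall fun ω => ?_)
    split_ifs <;> simp
  match e with
  | 0 => exact h0
  | 1 => exact h1

lemma MemLinfty.allMoments {M : Ω → Matrix (Fin d) (Fin d) ℝ} (hM : MemLinfty M P) (i j : Fin d) :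
    AllMoments (fun ω => M ω i j) P := by
  have hm : Measurable fun A : Matrix (Fin d) (Fin d) ℝ => A i j :=
    (measurable_pi_apply j).comp (measurable_pi_apply i)
  refine allMoments_of_ae_bound (hm.comp_aemeasurable hM.1)
    (C := (eLpNorm (fun ω => opNorm (M ω)) ∞ P).toReal) ?_
  filter_upwards [hM.ae_opNorm_le] with ω hω
  exact (abs_entry_le_opNorm _ _ _).trans hω

lemma allMoments_traceProd (hs : (s : ℝ) = p * m) (hd : s ∣ m) {Z : Fin k → Ω → Gen m n s}
    (hZ : ∀ i, HasLaw (Z i) (genLaw m n s) P) (U : Matrix (Fin n) (Fin d) ℝ)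
    {T : Ω → Matrix (Fin m) (Fin n) ℝ} (hT : ∀ i j, AllMoments (fun ω => T ω i j) P)
    {Y : Fin k → Ω → Matrix (Fin d) (Fin d) ℝ} (hY : ∀ i, MemLinfty (Y i) P)
    (τ : Fin k → Equiv.Perm (Fin 2)) (x : Fin n × Fin s) :
    AllMoments (fun ω => ntr (traceProd U (T ω) (fun i => Z i ω) τ (fun i => Y i ω) x)) P := by
  refine allMoments_ntr fun i j => allMoments_list_prod (A := fun r ω =>
    vecMulVec (Theta U (T ω) (Z r ω) x (τ r 0)) (Theta U (T ω) (Z r ω) x (τ r 1)) * Y r ω)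
    (fun r => allMoments_matrix_mul (fun a b => ?_) (hY r).allMoments) i j
  simp only [vecMulVec_apply]
  exact (allMoments_Theta hs hd (hZ r) U hT x _ a).mul (allMoments_Theta hs hd (hZ r) U hT x _ b)

end Integrability

/-! ### Bounds for the weighted sums -/

section HalfBounds

variable {m n s d : ℕ} {p : ℝ} {Ω : Type*} [MeasurableSpace Ω] {P : Measure Ω}

lemma sum_lintegral_index_ofReal (hp0 : 0 < p) (hs : (s : ℝ) = p * m) (hd : s ∣ m) {𝓥 : Type*}
    [MeasurableSpace 𝓥] {Z : Ω → Gen m n s} {V : Ω → 𝓥} (hZ : HasLaw Z (genLaw m n s) P)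
    (hV : AEMeasurable V P) (hind : IndepFun Z V P) {g : Fin n → Fin m → 𝓥 → ℝ}
    (hg : ∀ l i, Measurable (g l i)) (hg0 : ∀ l i v, 0 ≤ g l i v) :
    ∑ x : Fin n × Fin s, ∫⁻ ω, ENNReal.ofReal (g x.1 ((Z ω).2 x) (V ω)) ∂P
      = ∫⁻ ω, ENNReal.ofReal (p * ∑ l, ∑ i, g l i (V ω)) ∂P := by
  rw [sum_lintegral_index hp0 hs hd hZ hV hind (g := fun l i v => ENNReal.ofReal (g l i v))
    fun l i => (hg l i).ennreal_ofReal]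
  have hm : ∀ l i, AEMeasurable (fun ω => ENNReal.ofReal (g l i (V ω))) P := fun l i =>
    (hg l i).ennreal_ofReal.comp_aemeasurable hV
  have e : ∀ ω, ENNReal.ofReal (p * ∑ l, ∑ i, g l i (V ω))
      = ENNReal.ofReal p * ∑ l, ∑ i, ENNReal.ofReal (g l i (V ω)) := by
    intro ω
    rw [ENNReal.ofReal_mul hp0.le, ENNReal.ofReal_sum_of_nonneg fun l _ =>
      Finset.sum_nonneg fun i _ => hg0 l i _]
    congr 1
    exact Finset.sum_congr rfl fun l _ => ENNReal.ofReal_sum_of_nonneg fun i _ => hg0 l i _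
  simp_rw [e]
  rw [lintegral_const_mul' _ _ ENNReal.ofReal_ne_top,
    lintegral_finsetSum' _ fun l _ => Finset.aemeasurable_fun_sum _ fun i _ => hm l i]
  congr 1
  exact Finset.sum_congr rfl fun l _ => (lintegral_finsetSum' _ fun i _ => hm l i).symm

lemma sum_row_dotProduct_mulVec {U : Matrix (Fin n) (Fin d) ℝ} (hU : Uᵀ * U = 1)
    (H : Matrix (Fin d) (Fin d) ℝ) : ∑ l, U l ⬝ᵥ (H *ᵥ U l) = H.trace := by
  have h1 : (U * (H * Uᵀ)).trace = H.trace := by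
    rw [trace_mul_comm, Matrix.mul_assoc, hU, Matrix.mul_one]
  rw [← h1]
  refine Finset.sum_congr rfl fun l _ => ?_
  rw [diag_apply, mul_apply]
  rfl

variable {Z : Ω → Gen m n s} {T : Ω → Matrix (Fin m) (Fin n) ℝ}
  {N : Ω → Matrix (Fin d) (Fin d) ℝ} {U : Matrix (Fin n) (Fin d) ℝ}

lemma measurable_quadratic {ι : Type*} [MeasurableSpace ι] {v : ι → Fin d → ℝ} (hv : Measurable v)
    {H : ι → Matrix (Fin d) (Fin d) ℝ} (hH : Measurable H) :
    Measurable fun x => v x ⬝ᵥ (H x *ᵥ v x) := by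
  simp only [dotProduct, mulVec]
  refine Finset.measurable_fun_sum _ fun i _ => (measurable_pi_iff.1 hv i).mul
    (Finset.measurable_fun_sum _ fun j _ => ?_)
  exact (measurable_pi_iff.1 (measurable_pi_iff.1 hH i) j).mul (measurable_pi_iff.1 hv j)

lemma measurable_dotProduct_self {ι : Type*} [MeasurableSpace ι] {v : ι → Fin d → ℝ}
    (hv : Measurable v) : Measurable fun x => v x ⬝ᵥ v x :=
  Finset.measurable_fun_sum _ fun i _ =>
    (measurable_pi_iff.1 hv i).mul (measurable_pi_iff.1 hv i)

/-- The weighted second moments that dominate both kinds of weighted sums. -/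
def weightedMoment (p r : ℝ) (U : Matrix (Fin n) (Fin d) ℝ) (B : Matrix (Fin m) (Fin n) ℝ)
    (M : Matrix (Fin d) (Fin d) ℝ) : ℝ :=
  p * ((d + 2) * ∑ i, (B * U) i ⬝ᵥ (absPow r M *ᵥ (B * U) i)
    + (∑ i, (B * U) i ⬝ᵥ (B * U) i) * (absPow r M).trace)

/-- The squared norms `|u_l|²` sum to `d`, which produces the part `p d ∑ X_iᵀ H X_i` of
`weightedMoment`. -/
lemma sum_lintegral_row_le (hp0 : 0 < p) (hs : (s : ℝ) = p * m) (hd : s ∣ m)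
    (hU : Uᵀ * U = 1) (hZ : HasLaw Z (genLaw m n s) P) (hT : AEMeasurable T P)
    (hN : AEMeasurable N P) (hind : IndepFun Z (fun ω => (T ω, N ω)) P) {r : ℝ} (hr : 0 ≤ r) :
    ∑ x : Fin n × Fin s, ∫⁻ ω, ENNReal.ofReal (U x.1 ⬝ᵥ U x.1) * ENNReal.ofReal
        ((T ω * U) ((Z ω).2 x) ⬝ᵥ (absPow r (N ω) *ᵥ (T ω * U) ((Z ω).2 x))) ∂P
      ≤ ∫⁻ ω, ENNReal.ofReal (weightedMoment p r U (T ω) (N ω)) ∂P := by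
  simp_rw [← ENNReal.ofReal_mul (dotProduct_self_nonneg' _)]
  refine (sum_lintegral_index_ofReal hp0 hs hd hZ (hT.prodMk hN) hind
    (g := fun l i (v : Matrix (Fin m) (Fin n) ℝ × Matrix (Fin d) (Fin d) ℝ) =>
      (U l ⬝ᵥ U l) * ((v.1 * U) i ⬝ᵥ (absPow r v.2 *ᵥ (v.1 * U) i)))
    (fun l i => (measurable_quadratic ((measurable_row_mul U i).comp measurable_fst)
      ((measurable_absPow hr).comp measurable_snd)).const_mul _)
    (fun l i v => mul_nonneg (dotProduct_self_nonneg' _) (dotProduct_absPow_nonneg _ _ _))).trans_le ?_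
  refine lintegral_mono fun ω => ENNReal.ofReal_le_ofReal ?_
  rw [weightedMoment, ← Finset.sum_mul_sum, sum_row_dotProduct_self hU]
  have h1 : 0 ≤ ∑ i, (T ω * U) i ⬝ᵥ (absPow r (N ω) *ᵥ (T ω * U) i) :=
    Finset.sum_nonneg fun i _ => dotProduct_absPow_nonneg _ _ _
  have h2 : 0 ≤ (∑ i, (T ω * U) i ⬝ᵥ (T ω * U) i) * (absPow r (N ω)).trace :=
    mul_nonneg (Finset.sum_nonneg fun i _ => dotProduct_self_nonneg' _) (trace_absPow_nonneg _ _)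
  refine mul_le_mul_of_nonneg_left ?_ hp0.le
  linarith

/-- Here `∑ u_lᵀ H u_l = Tr H`, which produces the second summand of `weightedMoment`. -/
lemma sum_lintegral_sign_le (hp0 : 0 < p) (hs : (s : ℝ) = p * m) (hd : s ∣ m)
    (hU : Uᵀ * U = 1) (hZ : HasLaw Z (genLaw m n s) P) (hT : AEMeasurable T P)
    (hN : AEMeasurable N P) (hind : IndepFun Z (fun ω => (T ω, N ω)) P) {r : ℝ} (hr : 0 ≤ r) :
    ∑ x : Fin n × Fin s, ∫⁻ ω,
        ENNReal.ofReal ((T ω * U) ((Z ω).2 x) ⬝ᵥ (T ω * U) ((Z ω).2 x)) *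
        ENNReal.ofReal (U x.1 ⬝ᵥ (absPow r (N ω) *ᵥ U x.1)) ∂P
      ≤ ∫⁻ ω, ENNReal.ofReal (weightedMoment p r U (T ω) (N ω)) ∂P := by
  simp_rw [← ENNReal.ofReal_mul (dotProduct_self_nonneg' _)]
  refine (sum_lintegral_index_ofReal hp0 hs hd hZ (hT.prodMk hN) hind
    (g := fun l i (v : Matrix (Fin m) (Fin n) ℝ × Matrix (Fin d) (Fin d) ℝ) =>
      ((v.1 * U) i ⬝ᵥ (v.1 * U) i) * (U l ⬝ᵥ (absPow r v.2 *ᵥ U l)))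
    (fun l i => (measurable_dotProduct_self ((measurable_row_mul U i).comp measurable_fst)).mul
      (measurable_quadratic measurable_const ((measurable_absPow hr).comp measurable_snd)))
    (fun l i v => mul_nonneg (dotProduct_self_nonneg' _) (dotProduct_absPow_nonneg _ _ _))).trans_le ?_
  refine lintegral_mono fun ω => ENNReal.ofReal_le_ofReal ?_
  rw [weightedMoment, Finset.sum_comm, ← Finset.sum_mul_sum, sum_row_dotProduct_mulVec hU]
  have h1 : 0 ≤ ∑ i, (T ω * U) i ⬝ᵥ (absPow r (N ω) *ᵥ (T ω * U) i) :=
    Finset.sum_nonneg fun i _ => dotProduct_absPow_nonneg _ _ _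
  refine mul_le_mul_of_nonneg_left ?_ hp0.le
  have : 0 ≤ ((d : ℝ) + 2) * ∑ i, (T ω * U) i ⬝ᵥ (absPow r (N ω) *ᵥ (T ω * U) i) := by positivity
  linarith

/-- `|u_l|^{2q} ≤ |u_l|²` sums to at most `d`, and `m` rows weighted by `p` count as `s`. -/
lemma sum_lintegral_pow_le (hp0 : 0 < p) (hs : (s : ℝ) = p * m) (hd : s ∣ m)
    (hU : Uᵀ * U = 1) (hZ : HasLaw Z (genLaw m n s) P) (hT : AEMeasurable T P)
    (hind : IndepFun Z T P) {q : ℕ} (hq : 0 < q) {C : ℝ} (hC : 0 ≤ C)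
    (hrow : ∀ i, ∫⁻ ω, ENNReal.ofReal (((T ω * U) i ⬝ᵥ (T ω * U) i) ^ q) ∂P ≤ ENNReal.ofReal C) :
    ∑ x : Fin n × Fin s, ∫⁻ ω, ENNReal.ofReal (U x.1 ⬝ᵥ U x.1) ^ (q : ℝ) *
        ENNReal.ofReal ((T ω * U) ((Z ω).2 x) ⬝ᵥ (T ω * U) ((Z ω).2 x)) ^ (q : ℝ) ∂P
      ≤ ENNReal.ofReal (d * (s * C)) := by
  have e : ∀ a b : ℝ, 0 ≤ a → 0 ≤ b → ENNReal.ofReal a ^ (q : ℝ) * ENNReal.ofReal b ^ (q : ℝ)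
      = ENNReal.ofReal (a ^ q) * ENNReal.ofReal (b ^ q) := by
    intro a b ha hb
    rw [ENNReal.rpow_natCast, ENNReal.rpow_natCast, ENNReal.ofReal_pow ha, ENNReal.ofReal_pow hb]
  simp_rw [e _ _ (dotProduct_self_nonneg' _) (dotProduct_self_nonneg' _)]
  refine (sum_lintegral_index hp0 hs hd hZ hT hind
    (g := fun l i (v : Matrix (Fin m) (Fin n) ℝ) => ENNReal.ofReal ((U l ⬝ᵥ U l) ^ q) *
      ENNReal.ofReal (((v * U) i ⬝ᵥ (v * U) i) ^ q))
    (fun l i => ((measurable_dotProduct_self (measurable_row_mul U i)).pow_const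
      q).ennreal_ofReal.const_mul _)).trans_le ?_
  calc _ ≤ ENNReal.ofReal p * ∑ l, ∑ _i : Fin m, ENNReal.ofReal (U l ⬝ᵥ U l) * ENNReal.ofReal C := by
        refine mul_le_mul_right (Finset.sum_le_sum fun l _ => Finset.sum_le_sum fun i _ => ?_) _
        rw [lintegral_const_mul' _ _ ENNReal.ofReal_ne_top]
        refine mul_le_mul' (ENNReal.ofReal_le_ofReal ?_) (hrow i)
        exact pow_le_of_le_one (dotProduct_self_nonneg' _) (row_dotProduct_self_le_one hU l) hq.ne'
    _ = ENNReal.ofReal (d * (s * C)) := by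
        simp_rw [← ENNReal.ofReal_mul (dotProduct_self_nonneg' _)]
        simp only [Finset.sum_const, Finset.card_univ, Fintype.card_fin]
        have h : ENNReal.ofReal (∑ l, (U l ⬝ᵥ U l) * C) = ∑ l, ENNReal.ofReal ((U l ⬝ᵥ U l) * C) :=
          ENNReal.ofReal_sum_of_nonneg fun l _ => mul_nonneg (dotProduct_self_nonneg' _) hC
        rw [← Finset.smul_sum, ← h, ← Finset.sum_mul, sum_row_dotProduct_self hU,
          nsmul_eq_mul, ← ENNReal.ofReal_natCast m, ← ENNReal.ofReal_mul (by positivity),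
          ← ENNReal.ofReal_mul hp0.le, hs]
        congr 1
        ring

end HalfBounds

/-! ### Assembling the trace inequality -/

section Assembly

variable {m n s d : ℕ} {p : ℝ} {Ω : Type*} [MeasurableSpace Ω] {P : Measure Ω}

/-- The bound for the weighted sums with weight `|M|^{β/q'}`; `D` is a moment of `Gam`. -/
def halfBound (β : ℝ≥0∞) (q' q : ℝ) (D : ℝ≥0∞) (M : Ω → Matrix (Fin d) (Fin d) ℝ)
    (P : Measure Ω) : ℝ≥0∞ :=
  if β = ∞ then 0
  else (∫⁻ ω, ENNReal.ofReal (absPow β.toReal (M ω)).trace ∂P) ^ (1 / q') * D ^ (1 / q)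

lemma halfBound_transpose {β : ℝ≥0∞} (hβ0 : β ≠ 0) (q' q : ℝ) (D : ℝ≥0∞)
    (M : Ω → Matrix (Fin d) (Fin d) ℝ) :
    halfBound β q' q D (fun ω => (M ω)ᵀ) P = halfBound β q' q D M P := by
  rw [halfBound, halfBound]
  split_ifs with h
  · rfl
  · simp_rw [trace_absPow_transpose (ENNReal.toReal_pos hβ0 h)]

lemma measurable_transpose {a b : ℕ} :
    Measurable fun M : Matrix (Fin a) (Fin b) ℝ => Mᵀ :=
  measurable_pi_iff.2 fun i => measurable_pi_iff.2 fun j =>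
    (measurable_pi_apply i).comp (measurable_pi_apply j)

section Half

variable [IsProbabilityMeasure P] {T₁ T : Ω → Matrix (Fin m) (Fin n) ℝ}
  {U : Matrix (Fin n) (Fin d) ℝ} {Z : Ω → Gen m n s} {N : Ω → Matrix (Fin d) (Fin d) ℝ}

lemma lintegral_weightedMoment_le (hp0 : 0 < p) (hT₁m : AEMeasurable T₁ P)
    (hT : AEMeasurable T P) (hTT : IndepFun T₁ T P)
    (hT₁ : ∀ c : Matrix (Fin m) (Fin n) ℝ,
      ∫⁻ ω, ENNReal.ofReal ((∑ i, ∑ j, c i j * T₁ ω i j) ^ 2) ∂P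
        = ENNReal.ofReal (p * ∑ i, ∑ j, c i j ^ 2))
    (hU : Uᵀ * U = 1) {q : ℕ} {q' : ℝ} (hq : q'.HolderConjugate q) (hN : AEMeasurable N P)
    {β : ℝ≥0∞} (hβ : β ≠ ∞) :
    ∫⁻ ω, ENNReal.ofReal (weightedMoment p (β.toReal / q') U (T ω) (N ω)) ∂P
      ≤ halfBound β q' q (∫⁻ ω, ENNReal.ofReal (Gam U (T₁ ω) (T ω) ^ (2 * q)).trace ∂P) N P := by
  rw [halfBound, if_neg hβ]
  refine (lintegral_weighted_le hp0 hT₁m hT hTT hT₁ hU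
    (div_nonneg ENNReal.toReal_nonneg hq.nonneg) rfl hq hN).trans_eq ?_
  rw [div_mul_cancel₀ _ hq.pos.ne']

lemma sum_lintegral_row_halfMat_le (hp0 : 0 < p) (hs : (s : ℝ) = p * m) (hd : s ∣ m)
    (hT₁m : AEMeasurable T₁ P) (hT : AEMeasurable T P) (hTT : IndepFun T₁ T P)
    (hT₁ : ∀ c : Matrix (Fin m) (Fin n) ℝ,
      ∫⁻ ω, ENNReal.ofReal ((∑ i, ∑ j, c i j * T₁ ω i j) ^ 2) ∂P
        = ENNReal.ofReal (p * ∑ i, ∑ j, c i j ^ 2))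
    (hU : Uᵀ * U = 1) {q : ℕ} {q' : ℝ} (hq : q'.HolderConjugate q) (hN : AEMeasurable N P)
    (hZ : HasLaw Z (genLaw m n s) P) (hind : IndepFun Z (fun ω => (T ω, N ω)) P) (β : ℝ≥0∞) :
    ∑ x : Fin n × Fin s, ∫⁻ ω, ENNReal.ofReal (U x.1 ⬝ᵥ U x.1) * ENNReal.ofReal
        ((T ω * U) ((Z ω).2 x) ⬝ᵥ (halfMat β q' (N ω) *ᵥ (T ω * U) ((Z ω).2 x))) ∂P
      ≤ halfBound β q' q (∫⁻ ω, ENNReal.ofReal (Gam U (T₁ ω) (T ω) ^ (2 * q)).trace ∂P) N P := by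
  by_cases h : β = ∞
  · simp [halfMat, h]
  · simp only [halfMat, if_neg h]
    exact (sum_lintegral_row_le hp0 hs hd hU hZ hT hN hind
      (div_nonneg ENNReal.toReal_nonneg hq.nonneg)).trans
      (lintegral_weightedMoment_le hp0 hT₁m hT hTT hT₁ hU hq hN h)

lemma sum_lintegral_sign_halfMat_le (hp0 : 0 < p) (hs : (s : ℝ) = p * m) (hd : s ∣ m)
    (hT₁m : AEMeasurable T₁ P) (hT : AEMeasurable T P) (hTT : IndepFun T₁ T P)
    (hT₁ : ∀ c : Matrix (Fin m) (Fin n) ℝ,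
      ∫⁻ ω, ENNReal.ofReal ((∑ i, ∑ j, c i j * T₁ ω i j) ^ 2) ∂P
        = ENNReal.ofReal (p * ∑ i, ∑ j, c i j ^ 2))
    (hU : Uᵀ * U = 1) {q : ℕ} {q' : ℝ} (hq : q'.HolderConjugate q) (hN : AEMeasurable N P)
    (hZ : HasLaw Z (genLaw m n s) P) (hind : IndepFun Z (fun ω => (T ω, N ω)) P) (β : ℝ≥0∞) :
    ∑ x : Fin n × Fin s, ∫⁻ ω,
        ENNReal.ofReal ((T ω * U) ((Z ω).2 x) ⬝ᵥ (T ω * U) ((Z ω).2 x)) *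
        ENNReal.ofReal (U x.1 ⬝ᵥ (halfMat β q' (N ω) *ᵥ U x.1)) ∂P
      ≤ halfBound β q' q (∫⁻ ω, ENNReal.ofReal (Gam U (T₁ ω) (T ω) ^ (2 * q)).trace ∂P) N P := by
  by_cases h : β = ∞
  · simp [halfMat, h]
  · simp only [halfMat, if_neg h]
    exact (sum_lintegral_sign_le hp0 hs hd hU hZ hT hN hind
      (div_nonneg ENNReal.toReal_nonneg hq.nonneg)).trans
      (lintegral_weightedMoment_le hp0 hT₁m hT hTT hT₁ hU hq hN h)

end Half

lemma ofReal_halfTerm {β : ℝ≥0∞} {q' : ℝ} (h0 : 0 ≤ halfExp β q') (h1 : halfExp β q' ≤ 1 / 2)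
    (v : Fin d → ℝ) (M : Matrix (Fin d) (Fin d) ℝ) :
    ENNReal.ofReal (halfTerm β q' v M) = ENNReal.ofReal (v ⬝ᵥ v) ^ (1 / 2 - halfExp β q') *
      ENNReal.ofReal (v ⬝ᵥ (halfMat β q' M *ᵥ v)) ^ halfExp β q' := by
  rw [halfTerm, ENNReal.ofReal_mul (Real.rpow_nonneg (dotProduct_self_nonneg' v) _),
    ENNReal.ofReal_rpow_of_nonneg (dotProduct_self_nonneg' v) (by linarith),
    ENNReal.ofReal_rpow_of_nonneg (dotProduct_halfMat_nonneg _ _ _ _) h0]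

variable [IsProbabilityMeasure P] {T₁ T : Ω → Matrix (Fin m) (Fin n) ℝ}
  {U : Matrix (Fin n) (Fin d) ℝ} {k : ℕ} {Z : Fin k → Ω → Gen m n s}
  {Y : Fin k → Ω → Matrix (Fin d) (Fin d) ℝ}

lemma measurable_row_index (U : Matrix (Fin n) (Fin d) ℝ) (x : Fin n × Fin s) :
    Measurable fun v : Gen m n s × Matrix (Fin m) (Fin n) ℝ => (v.2 * U) (v.1.2 x) := by
  have h : Measurable fun w : Matrix (Fin m) (Fin n) ℝ × Fin m => (w.1 * U) w.2 :=
    measurable_from_prod_countable_left fun i => measurable_row_mul U i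
  exact h.comp (measurable_snd.prodMk
    ((measurable_pi_apply x).comp (measurable_snd.comp measurable_fst)))

-- Hölder with the actual weights. The sign terms contain no `Z`, so each mixed product depends on a
-- single `Z i` together with `T` and one `Y j`, and `hind` for that `i` suffices.
set_option maxHeartbeats 1600000 in
lemma sum_lintegral_halfTerm_le [NeZero k] (hp0 : 0 < p) (hs : (s : ℝ) = p * m) (hd : s ∣ m)
    (hT₁m : AEMeasurable T₁ P) (hT : AEMeasurable T P) (hTT : IndepFun T₁ T P)
    (hT₁ : ∀ c : Matrix (Fin m) (Fin n) ℝ,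
      ∫⁻ ω, ENNReal.ofReal ((∑ i, ∑ j, c i j * T₁ ω i j) ^ 2) ∂P
        = ENNReal.ofReal (p * ∑ i, ∑ j, c i j ^ 2))
    (hU : Uᵀ * U = 1) {q : ℕ} {q' : ℝ} (hq : q'.HolderConjugate q)
    (hY : ∀ i, AEMeasurable (Y i) P) (hZ : ∀ i, HasLaw (Z i) (genLaw m n s) P)
    (hind : ∀ i, IndepFun (Z i) (fun ω => (T ω, fun i => Y i ω)) P) {β : Fin k → ℝ≥0∞}
    (hβ0 : ∀ i, β i ≠ 0) (hβ1 : ∀ i, halfExp (β i) q' ≤ 1 / 2) {θ : ℝ} (hθ : 0 < θ)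
    (hθq : q * θ + (1 - θ) = k / 2) (hsum : 2 * ∑ i, halfExp (β i) q' = 1 - θ) {C : ℝ} (hC : 0 ≤ C)
    (hrow : ∀ i, ∫⁻ ω, ENNReal.ofReal (((T ω * U) i ⬝ᵥ (T ω * U) i) ^ q) ∂P ≤ ENNReal.ofReal C)
    (τ : Fin k → Equiv.Perm (Fin 2)) :
    ∑ x : Fin n × Fin s, ∫⁻ ω, ENNReal.ofReal (∏ i,
      (halfTerm (β (signIdx τ i)) q' (U x.1) (signMat τ (fun j => Y j ω) i) *
        halfTerm (β (rowIdx τ i)) q' ((T ω * U) ((Z i ω).2 x)) (rowMat τ (fun j => Y j ω) i))) ∂P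
      ≤ ENNReal.ofReal (d * (s * C)) ^ θ * ∏ i, halfBound (β i) q' q
        (∫⁻ ω, ENNReal.ofReal (Gam U (T₁ ω) (T ω) ^ (2 * q)).trace ∂P) (Y i) P
          ^ (2 * halfExp (β i) q') := by
  have hq0 : 0 < q := by exact_mod_cast hq.symm.pos
  have he0 : ∀ i, 0 ≤ halfExp (β i) q' := fun i =>
    div_nonneg (mul_nonneg hq.nonneg ENNReal.toReal_nonneg) zero_le_two
  set D := ∫⁻ ω, ENNReal.ofReal (Gam U (T₁ ω) (T ω) ^ (2 * q)).trace ∂P with hD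
  set B : Fin k → ℝ≥0∞ := fun i => halfBound (β i) q' q D (Y i) P with hB
  have hYt : ∀ i, AEMeasurable (fun ω => (Y i ω)ᵀ) P := fun i =>
    measurable_transpose.comp_aemeasurable (hY i)
  have hYi : ∀ i j, IndepFun (Z i) (fun ω => (T ω, Y j ω)) P := fun i j =>
    (hind i).comp measurable_id (measurable_fst.prodMk ((measurable_pi_apply j).comp measurable_snd))
  have hYti : ∀ i j, IndepFun (Z i) (fun ω => (T ω, (Y j ω)ᵀ)) P := fun i j =>
    (hYi i j).comp measurable_id (measurable_fst.prodMk (measurable_transpose.comp measurable_snd))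
  have hsm : ∀ i, AEMeasurable (fun ω => signMat τ (fun j => Y j ω) i) P := by
    intro i
    simp only [signMat]
    split_ifs
    exacts [hY _, hYt _]
  have hrm : ∀ i, AEMeasurable (fun ω => rowMat τ (fun j => Y j ω) i) P := by
    intro i
    simp only [rowMat]
    split_ifs
    exacts [hYt _, hY _]
  have hrowm : ∀ i x, AEMeasurable (fun ω => (T ω * U) ((Z i ω).2 x)) P := fun i x =>
    (measurable_row_index U x).comp_aemeasurable ((hZ i).aemeasurable.prodMk hT)
  have key := sum_lintegral_prod_le (P := P) (κ := Fin n × Fin s) (k := k) (q := q) (θ := θ)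
    (u := fun x => ENNReal.ofReal (U x.1 ⬝ᵥ U x.1))
    (uA := fun i x ω => ENNReal.ofReal
      (U x.1 ⬝ᵥ (halfMat (β (signIdx τ i)) q' (signMat τ (fun j => Y j ω) i) *ᵥ U x.1)))
    (w := fun i x ω => ENNReal.ofReal ((T ω * U) ((Z i ω).2 x) ⬝ᵥ (T ω * U) ((Z i ω).2 x)))
    (wB := fun i x ω => ENNReal.ofReal ((T ω * U) ((Z i ω).2 x) ⬝ᵥ
      (halfMat (β (rowIdx τ i)) q' (rowMat τ (fun j => Y j ω) i) *ᵥ (T ω * U) ((Z i ω).2 x))))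
    (au := fun i => halfExp (β (signIdx τ i)) q') (aw := fun i => halfExp (β (rowIdx τ i)) q')
    (R := ENNReal.ofReal (d * (s * C))) (Bu := fun i => B (signIdx τ i))
    (Bw := fun i => B (rowIdx τ i)) (by exact_mod_cast hq0) hθ hθq
    (fun i x => (measurable_quadratic (v := fun _ : Matrix (Fin d) (Fin d) ℝ => U x.1)
      measurable_const (measurable_halfMat _ hq.pos)).ennreal_ofReal.comp_aemeasurable (hsm i))
    (fun i x => (measurable_dotProduct_self measurable_id).ennreal_ofReal.comp_aemeasurable
      (hrowm i x))
    (fun i x => (measurable_quadratic (ι := (Fin d → ℝ) × Matrix (Fin d) (Fin d) ℝ) measurable_fst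
      ((measurable_halfMat _ hq.pos).comp measurable_snd)).ennreal_ofReal.comp_aemeasurable
      ((hrowm i x).prodMk (hrm i)))
    (fun i => he0 _) (fun i => he0 _) (fun i => hβ1 _) (fun i => hβ1 _)
    ((sum_signIdx_add_rowIdx τ fun i => halfExp (β i) q').trans hsum)
    (fun i => sum_lintegral_pow_le hp0 hs hd hU (hZ i) hT
      ((hind i).comp measurable_id measurable_fst) hq0 hC hrow)
    (fun i => ?_) (fun i j => ?_)
  · refine (le_of_eq ?_).trans (key.trans (le_of_eq ?_))
    · refine Finset.sum_congr rfl fun x _ => lintegral_congr fun ω => ?_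
      rw [ENNReal.ofReal_prod_of_nonneg fun i _ =>
        mul_nonneg (halfTerm_nonneg _ _ _ _) (halfTerm_nonneg _ _ _ _)]
      refine Finset.prod_congr rfl fun i _ => ?_
      rw [ENNReal.ofReal_mul (halfTerm_nonneg _ _ _ _)]
      exact congr_arg₂ _ (ofReal_halfTerm (he0 _) (hβ1 _) _ _) (ofReal_halfTerm (he0 _) (hβ1 _) _ _)
    · rw [prod_signIdx_mul_rowIdx τ fun i => B i ^ halfExp (β i) q']
      congr 1
      refine Finset.prod_congr rfl fun i _ => ?_
      rw [two_mul, ENNReal.rpow_add_of_nonneg _ _ (he0 i) (he0 i)]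
  · simp only [rowIdx, rowMat, hB]
    split_ifs
    · rw [← halfBound_transpose (hβ0 i)]
      exact sum_lintegral_row_halfMat_le hp0 hs hd hT₁m hT hTT hT₁ hU hq (hYt _) (hZ i) (hYti i _) _
    · exact sum_lintegral_row_halfMat_le hp0 hs hd hT₁m hT hTT hT₁ hU hq (hY _) (hZ i) (hYi i _) _
  · simp only [signIdx, signMat, hB]
    split_ifs
    · exact sum_lintegral_sign_halfMat_le hp0 hs hd hT₁m hT hTT hT₁ hU hq (hY _) (hZ j) (hYi j _) _
    · rw [← halfBound_transpose (hβ0 i)]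
      exact sum_lintegral_sign_halfMat_le hp0 hs hd hT₁m hT hTT hT₁ hU hq (hYt _) (hZ j) (hYti j _) _

/-- `2 * halfExp β q' = q' / β` turns the power `1 / q'` of `E Tr |M|^β` into `1 / β`; the factor
`d^{1/β}` is the normalization of the trace. For `β = ∞` all exponents are zero and only the
constant remains. -/
lemma ofReal_halfConst_mul_halfBound {q : ℕ} {q' : ℝ} (hq : q'.HolderConjugate q) (hd : 0 < d)
    {M : Ω → Matrix (Fin d) (Fin d) ℝ} (hM : MemLinfty M P) {β : ℝ≥0∞} (hβ0 : β ≠ 0) (D : ℝ≥0∞) :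
    ENNReal.ofReal (halfConst β M P) * halfBound β q' q D M P ^ (2 * halfExp β q')
      = ENNReal.ofReal (schattenNorm β M P) *
        (ENNReal.ofReal d ^ (β⁻¹).toReal * D ^ (q' / q * (β⁻¹).toReal)) := by
  have hd' : (0 : ℝ) < d := by exact_mod_cast hd
  by_cases h : β = ∞
  · simp [halfConst, halfBound, halfExp, schattenNorm, h]
  · have h0 : 0 ≤ (β⁻¹).toReal := ENNReal.toReal_nonneg
    have h1 : 2 * halfExp β q' = q' * (β⁻¹).toReal := by rw [halfExp]; ring
    have h2 : 0 ≤ q' * (β⁻¹).toReal := mul_nonneg hq.nonneg h0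
    have h3 : 1 / q' * (q' * (β⁻¹).toReal) = (β⁻¹).toReal := by
      rw [← mul_assoc, one_div_mul_cancel hq.pos.ne', one_mul]
    rw [halfConst, halfBound, if_neg h, if_neg h, h1, ENNReal.mul_rpow_of_nonneg _ _ h2,
      ← ENNReal.rpow_mul, ← ENNReal.rpow_mul, h3,
      lintegral_trace_absPow_rpow hM hd hβ0 h, ENNReal.ofReal_mul (by positivity),
      ENNReal.ofReal_rpow_of_nonneg hd'.le h0, ENNReal.ofReal_one, one_mul]
    rw [show 1 / (q : ℝ) * (q' * (β⁻¹).toReal) = q' / q * (β⁻¹).toReal by ring]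
    ring

end Assembly

/-! ### Numerical facts -/

/-- `S ≤ e^{2q} ≤ 10^q`, and `10 * 24 = 240 ≤ 256 = 16²`. -/
lemma mul_pow_le_of_log_le {S T : ℝ} {q : ℕ} (hS : 0 ≤ S) (hq : 1 / 2 * Real.log S ≤ q)
    (hT : 0 ≤ T) : S * (24 * T) ^ q ≤ (16 * √T) ^ (2 * (q : ℝ)) := by
  have h1 : S ≤ 10 ^ q := by
    rcases hS.eq_or_lt with rfl | hS
    · positivity
    · have h2 : S ≤ Real.exp (q * 2) := by
        rw [← Real.log_le_iff_le_exp hS]; linarith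
      refine h2.trans ?_
      rw [Real.exp_nat_mul]
      have h3 : Real.exp 2 = Real.exp 1 * Real.exp 1 := by rw [← Real.exp_add]; norm_num
      have h4 := Real.exp_one_lt_d9
      have h5 := Real.exp_pos 1
      refine pow_le_pow_left₀ (Real.exp_pos _).le ?_ _
      rw [h3]
      nlinarith
  calc S * (24 * T) ^ q ≤ 10 ^ q * (24 * T) ^ q := by gcongr
    _ = (240 * T) ^ q := by rw [← mul_pow]; ring
    _ ≤ (256 * T) ^ q := by gcongr; norm_num
    _ = ((16 * √T) ^ 2) ^ q := by
      have h6 : (16 * √T) ^ 2 = 256 * T := by rw [mul_pow, Real.sq_sqrt hT]; norm_num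
      rw [h6]
    _ = _ := by rw [← pow_mul, ← Real.rpow_natCast]; push_cast; rfl

section Final

variable {m n s d : ℕ} {p : ℝ} {Ω : Type*} [MeasurableSpace Ω] {P : Measure Ω}
  {T₁ T : Ω → Matrix (Fin m) (Fin n) ℝ}
  {U : Matrix (Fin n) (Fin d) ℝ} {k : ℕ} {Z : Fin k → Ω → Gen m n s}
  {Y : Fin k → Ω → Matrix (Fin d) (Fin d) ℝ}

lemma ofReal_sum_integral_traceProd_le [NeZero k] (hs : (s : ℝ) = p * m) (hd : s ∣ m)
    (hZ : ∀ i, HasLaw (Z i) (genLaw m n s) P) (hY : ∀ i, MemLinfty (Y i) P) {β : Fin k → ℝ≥0∞}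
    {q' : ℝ} (hq' : 0 < q') (hβ : ∀ i, β i ≠ ∞ → q' ≤ (β i).toReal)
    (τ : Fin k → Equiv.Perm (Fin 2)) :
    ENNReal.ofReal (∑ x : Fin n × Fin s,
        ∫ ω, ntr (traceProd U (T ω) (fun i => Z i ω) τ (fun i => Y i ω) x) ∂P)
      ≤ ENNReal.ofReal ((d : ℝ)⁻¹ * ∏ i, halfConst (β i) (Y i) P) *
        ∑ x : Fin n × Fin s, ∫⁻ ω, ENNReal.ofReal (∏ i,
          (halfTerm (β (signIdx τ i)) q' (U x.1) (signMat τ (fun j => Y j ω) i) *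
            halfTerm (β (rowIdx τ i)) q' ((T ω * U) ((Z i ω).2 x))
              (rowMat τ (fun j => Y j ω) i))) ∂P := by
  have hK : 0 ≤ (d : ℝ)⁻¹ * ∏ i, halfConst (β i) (Y i) P :=
    mul_nonneg (by positivity) (Finset.prod_nonneg fun i _ => halfConst_nonneg _ _ _)
  rw [Finset.mul_sum]
  refine (ENNReal.ofReal_le_ofReal (Finset.sum_le_sum fun x _ => Real.le_norm_self _)).trans ?_
  rw [ENNReal.ofReal_sum_of_nonneg fun x _ => norm_nonneg _]
  refine Finset.sum_le_sum fun x _ => ?_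
  rw [ofReal_norm]
  refine (enorm_integral_le_lintegral_enorm _).trans ?_
  rw [← lintegral_const_mul' _ _ ENNReal.ofReal_ne_top]
  refine lintegral_mono_ae ?_
  filter_upwards [ae_all_iff.2 fun i => ae_abs_dotProduct_le (hY i) hq' (hβ i),
    ae_all_iff.2 fun i => ae_abs_sign_of_hasLaw hs hd (hZ i)] with ω hω hω'
  rw [← ENNReal.ofReal_mul hK, ← ofReal_norm]
  refine ENNReal.ofReal_le_ofReal ?_
  rw [ntr, norm_mul, Real.norm_of_nonneg (by positivity : (0 : ℝ) ≤ (d : ℝ)⁻¹), mul_assoc]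
  refine mul_le_mul_of_nonneg_left ?_ (by positivity)
  exact abs_trace_traceProd_le U (T ω) τ (fun i => hω' i x) hω

variable [IsProbabilityMeasure P]

lemma sum_integral_traceProd_le [NeZero k] (hp0 : 0 < p) (hs : (s : ℝ) = p * m) (hd : s ∣ m)
    (hT₁m : AEMeasurable T₁ P) (hT : AEMeasurable T P) (hTT : IndepFun T₁ T P)
    (hT₁ : ∀ c : Matrix (Fin m) (Fin n) ℝ,
      ∫⁻ ω, ENNReal.ofReal ((∑ i, ∑ j, c i j * T₁ ω i j) ^ 2) ∂P
        = ENNReal.ofReal (p * ∑ i, ∑ j, c i j ^ 2))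
    (hU : Uᵀ * U = 1) {q : ℕ} (hq : 1 < q) (hk : 2 < k) (hkq : k ≤ 2 * q)
    (hY : ∀ i, MemLinfty (Y i) P) (hZ : ∀ i, HasLaw (Z i) (genLaw m n s) P)
    (hind : ∀ i, IndepFun (Z i) (fun ω => (T ω, fun i => Y i ω)) P) {β : Fin k → ℝ≥0∞}
    (hβ : ∑ i, (β i)⁻¹ = ENNReal.ofReal (1 - (k : ℝ) / (2 * q))) {L C : ℝ} (hC : 0 ≤ C)
    (hL : 0 ≤ L) (hsC : s * C ≤ L ^ (2 * (q : ℝ)))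
    (hrow : ∀ i, ∫⁻ ω, ENNReal.ofReal (((T ω * U) i ⬝ᵥ (T ω * U) i) ^ q) ∂P ≤ ENNReal.ofReal C)
    (hΓ : Integrable (fun ω => ntr (Gam U (T₁ ω) (T ω) ^ (2 * q))) P)
    (τ : Fin k → Equiv.Perm (Fin 2)) :
    ∑ x : Fin n × Fin s, ∫ ω, ntr (traceProd U (T ω) (fun i => Z i ω) τ (fun i => Y i ω) x) ∂P
      ≤ L ^ ((2 * q * k - 4 * q : ℝ) / (2 * q - 2)) *
        (∫ ω, ntr (Gam U (T₁ ω) (T ω) ^ (2 * q)) ∂P) ^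
          ((1 : ℝ) / q * ((2 * q - k : ℝ) / (2 * q - 2))) *
        ∏ i, schattenNorm (β i) (Y i) P := by
  have hqR : (1 : ℝ) < q := by exact_mod_cast hq
  have hkR : (2 : ℝ) < k := by exact_mod_cast hk
  have hkqR : (k : ℝ) ≤ 2 * q := by exact_mod_cast hkq
  set b : Fin k → ℝ := fun i => ((β i)⁻¹).toReal with hb
  have hb0 : ∀ i, 0 ≤ b i := fun i => ENNReal.toReal_nonneg
  -- The sum of the inverses is finite, which excludes `β i = 0`.
  have hβ_inv : ∀ i, (β i)⁻¹ ≠ ∞ := fun i h => by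
    have h1 := Finset.single_le_sum (f := fun i => (β i)⁻¹) (fun _ _ => zero_le) (Finset.mem_univ i)
    rw [hβ, h] at h1
    exact ENNReal.ofReal_ne_top (top_le_iff.1 h1)
  have hβ0 : ∀ i, β i ≠ 0 := fun i => ENNReal.inv_ne_top.1 (hβ_inv i)
  have hB : ∑ i, b i = 1 - k / (2 * q) := by
    rw [hb, ← ENNReal.toReal_sum fun i _ => hβ_inv i, hβ, ENNReal.toReal_ofReal]
    rw [sub_nonneg, div_le_one (by linarith)]
    exact hkqR
  have hM0 : 0 ≤ ∫ ω, ntr (Gam U (T₁ ω) (T ω) ^ (2 * q)) ∂P := integral_nonneg fun ω =>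
    mul_nonneg (by positivity) (trace_pow_Gam_nonneg _ _ _ _)
  have hR0 : 0 ≤ L ^ ((2 * q * k - 4 * q : ℝ) / (2 * q - 2)) *
        (∫ ω, ntr (Gam U (T₁ ω) (T ω) ^ (2 * q)) ∂P) ^
          ((1 : ℝ) / q * ((2 * q - k : ℝ) / (2 * q - 2))) *
        ∏ i, schattenNorm (β i) (Y i) P :=
    mul_nonneg (mul_nonneg (Real.rpow_nonneg hL _) (Real.rpow_nonneg hM0 _))
      (Finset.prod_nonneg fun i _ => schattenNorm_nonneg _ (hβ0 i))
  rcases Nat.eq_zero_or_pos d with hd0 | hd0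
  · refine le_of_eq_of_le ?_ hR0
    refine Finset.sum_eq_zero fun x _ => ?_
    simp [ntr, hd0]
  have hdR : (0 : ℝ) < d := by exact_mod_cast hd0
  have hq : ((q : ℝ) / (q - 1)).HolderConjugate q := (Real.HolderConjugate.conjExponent hqR).symm
  set q' : ℝ := (q : ℝ) / (q - 1) with hq'
  have hq1 : (q : ℝ) - 1 ≠ 0 := by linarith
  have hq0 : (q : ℝ) ≠ 0 := by linarith
  have h2q : 2 * (q : ℝ) - 2 ≠ 0 := by linarith
  -- The mixed products receive total weight `∑ q' / β_i = q' (1 - k / (2q))`, and `θ` is what is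
  -- left of `1`. It is positive because `k > 2`. Also `q' / β_i ≤ 1 - θ < 1`, hence `β_i ≥ q'` as
  -- Jensen requires.
  set θ : ℝ := (k - 2) / (2 * q - 2) with hθ
  have hθ0 : 0 < θ := div_pos (by linarith) (by linarith)
  have hq'B : q' * (1 - k / (2 * q)) = 1 - θ := by rw [hq', hθ]; field_simp; ring
  have hb1 : ∀ i, q' * b i ≤ 1 := fun i => by
    have h1 := Finset.single_le_sum (f := b) (fun i _ => hb0 i) (Finset.mem_univ i)
    rw [hB] at h1
    have := mul_le_mul_of_nonneg_left h1 hq.nonneg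
    linarith
  have hβq : ∀ i, β i ≠ ∞ → q' ≤ (β i).toReal := fun i h => by
    have h1 := hb1 i
    have h2 : 0 < (β i).toReal := ENNReal.toReal_pos (hβ0 i) h
    simp only [hb] at h1
    rwa [ENNReal.toReal_inv, ← div_eq_mul_inv, div_le_one h2] at h1
  have hmain := (ofReal_sum_integral_traceProd_le (U := U) (T := T) hs hd hZ hY hq.pos hβq τ).trans
    (mul_le_mul_right (sum_lintegral_halfTerm_le hp0 hs hd hT₁m hT hTT hT₁ hU hq (fun i => (hY i).1)
      hZ hind hβ0 (fun i => by rw [halfExp]; linarith [hb1 i]) hθ0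
      (by rw [hθ]; field_simp; ring)
      (by simp only [halfExp]; rw [← Finset.sum_div, ← Finset.mul_sum, hB, hq'B]; ring) hC hrow τ) _)
  rw [← ENNReal.ofReal_le_ofReal_iff hR0]
  refine hmain.trans ?_
  have hD : ∫⁻ ω, ENNReal.ofReal (Gam U (T₁ ω) (T ω) ^ (2 * q)).trace ∂P
      = ENNReal.ofReal (d * ∫ ω, ntr (Gam U (T₁ ω) (T ω) ^ (2 * q)) ∂P) := by
    have e : ∀ ω, (Gam U (T₁ ω) (T ω) ^ (2 * q)).trace
        = d * ntr (Gam U (T₁ ω) (T ω) ^ (2 * q)) := fun ω => by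
      rw [ntr, mul_inv_cancel_left₀ hdR.ne']
    simp_rw [e]
    rw [← integral_const_mul, ofReal_integral_eq_lintegral_ofReal (hΓ.const_mul _)]
    refine Filter.Eventually.of_forall fun ω => ?_
    change 0 ≤ (d : ℝ) * _
    rw [← e]
    exact trace_pow_Gam_nonneg _ _ _ _
  set W := ∫ ω, ntr (Gam U (T₁ ω) (T ω) ^ (2 * q)) ∂P
  set E : ℝ := (1 : ℝ) / q * ((2 * q - k : ℝ) / (2 * q - 2)) with hE
  have hE0 : 0 ≤ E := by
    have : 0 ≤ (2 * q - k : ℝ) / (2 * q - 2) := div_nonneg (by linarith) (by linarith)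
    positivity
  have hprod : ENNReal.ofReal (∏ i, halfConst (β i) (Y i) P) * ∏ i, halfBound (β i) q' q
      (ENNReal.ofReal (d * W)) (Y i) P ^ (2 * halfExp (β i) q')
      = ENNReal.ofReal ((∏ i, schattenNorm (β i) (Y i) P) *
        (d ^ (1 - k / (2 * q) : ℝ) * (d ^ E * W ^ E))) := by
    rw [ENNReal.ofReal_prod_of_nonneg fun i _ => halfConst_nonneg _ _ _, ← Finset.prod_mul_distrib]
    simp_rw [ofReal_halfConst_mul_halfBound hq hd0 (hY _) (hβ0 _)]
    rw [Finset.prod_mul_distrib, Finset.prod_mul_distrib, prod_rpow_const_of_nonneg _ _ hb0,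
      prod_rpow_const_of_nonneg _ _ fun i => mul_nonneg (div_nonneg hq.nonneg (by linarith)) (hb0 i),
      ← Finset.mul_sum, ← hb, hB, ← ENNReal.ofReal_prod_of_nonneg fun i _ =>
        schattenNorm_nonneg _ (hβ0 i)]
    have e1 : q' / q * (1 - k / (2 * q)) = E := by rw [hq', hE]; field_simp
    have e2 : 0 ≤ 1 - (k : ℝ) / (2 * q) := by rw [← hB]; exact Finset.sum_nonneg fun i _ => hb0 i
    rw [e1, ENNReal.ofReal_rpow_of_nonneg hdR.le e2,
      ENNReal.ofReal_rpow_of_nonneg (by positivity) hE0, Real.mul_rpow hdR.le hM0,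
      ← ENNReal.ofReal_mul (by positivity), ← ENNReal.ofReal_mul
        (Finset.prod_nonneg fun i _ => schattenNorm_nonneg _ (hβ0 i))]
  have hS0 : 0 ≤ ∏ i, schattenNorm (β i) (Y i) P :=
    Finset.prod_nonneg fun i _ => schattenNorm_nonneg _ (hβ0 i)
  -- The powers of `d` come from the outer trace, from `∑ |u_l|² = d`, from the Schatten norms and
  -- from the moment of `Gam`; they cancel exactly.
  have hd1 : (d : ℝ)⁻¹ * (d ^ θ * (d ^ (1 - k / (2 * q) : ℝ) * d ^ E)) = 1 := by
    rw [← Real.rpow_neg_one, ← Real.rpow_add hdR, ← Real.rpow_add hdR, ← Real.rpow_add hdR]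
    have : -1 + (θ + (1 - k / (2 * q) + E)) = 0 := by rw [hθ, hE]; field_simp; ring
    rw [this, Real.rpow_zero]
  have hL1 : (s * C) ^ θ ≤ L ^ ((2 * q * k - 4 * q : ℝ) / (2 * q - 2)) := by
    refine (Real.rpow_le_rpow (by positivity) hsC hθ0.le).trans_eq ?_
    rw [← Real.rpow_mul hL]
    congr 1
    rw [hθ]
    ring
  rw [hD, ENNReal.ofReal_mul (by positivity), ENNReal.ofReal_rpow_of_nonneg (by positivity) hθ0.le,
    mul_left_comm, mul_assoc, hprod, ← ENNReal.ofReal_mul (by positivity),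
    ← ENNReal.ofReal_mul (by positivity)]
  refine ENNReal.ofReal_le_ofReal ?_
  rw [Real.mul_rpow hdR.le (by positivity)]
  calc _ = ((d : ℝ)⁻¹ * (d ^ θ * (d ^ (1 - k / (2 * q) : ℝ) * d ^ E))) * ((s * C) ^ θ * W ^ E *
        ∏ i, schattenNorm (β i) (Y i) P) := by ring
    _ ≤ _ := by
      rw [hd1, one_mul]
      gcongr

end Final

lemma measurable_interp {m n : ℕ} (t : ℝ) :
    Measurable fun x : Matrix (Fin m) (Fin n) ℝ × Matrix (Fin m) (Fin n) ℝ => interp t x.1 x.2 := by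
  refine measurable_pi_iff.2 fun i => measurable_pi_iff.2 fun j => ?_
  have h : Measurable fun A : Matrix (Fin m) (Fin n) ℝ => A i j :=
    (measurable_pi_apply j).comp (measurable_pi_apply i)
  exact ((h.comp measurable_fst).const_mul _).add ((h.comp measurable_snd).const_mul _)

end OSNAP
end

theorem mainTheorem8 :
    ∃ c : ℝ, 0 < c ∧
      ∀ (m n d s : ℕ) (p : ℝ), 0 < p → p ≤ 1 → (s : ℝ) = p * m → s ∣ m →
      ∀ U : Matrix (Fin n) (Fin d) ℝ, U.transpose * U = 1 →
      ∀ (q k : ℕ), max 2 (1 / 2 * Real.log (p * m)) ≤ (q : ℝ) → 3 ≤ k → k ≤ 2 * q →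
      ∀ (t : ℝ), 0 ≤ t → t ≤ 1 →
      ∀ (Ω : Type*) [MeasurableSpace Ω] (P : Measure Ω) [IsProbabilityMeasure P]
        (S₁ S₂ G₁ G₂ : Ω → Matrix (Fin m) (Fin n) ℝ)
        (Z : Fin k → Ω → OSNAP.Gen m n s)
        (Y : Fin k → Ω → Matrix (Fin d) (Fin d) ℝ),
      HasLaw S₁ (OSNAP.law m n s) P → HasLaw S₂ (OSNAP.law m n s) P →
      OSNAP.IsGaussianMatrix G₁ p.toNNReal P → OSNAP.IsGaussianMatrix G₂ p.toNNReal P →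
      iIndepFun ![S₁, S₂, G₁, G₂] P →
      (∀ i, HasLaw (Z i) (OSNAP.genLaw m n s) P) →
      (∀ i, OSNAP.MemLinfty (Y i) P) →
      IndepFun (fun ω i => Z i ω) (fun ω => (S₁ ω, S₂ ω, G₁ ω, G₂ ω, fun i => Y i ω)) P →
      ∀ (β : Fin k → ENNReal), ∑ i, (β i)⁻¹ = ENNReal.ofReal (1 - (k : ℝ) / (2 * q)) →
      ∀ τ : Fin k → Equiv.Perm (Fin 2),
        (∀ x : Fin n × Fin s, Integrable (fun ω => OSNAP.ntr (OSNAP.traceProd U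
          (OSNAP.interp t (S₂ ω) (G₂ ω)) (fun i => Z i ω) τ (fun i => Y i ω) x)) P) ∧
        Integrable (fun ω => OSNAP.ntr (OSNAP.Gam U (OSNAP.interp t (S₁ ω) (G₁ ω))
          (OSNAP.interp t (S₂ ω) (G₂ ω)) ^ (2 * q))) P ∧
        ∑ x : Fin n × Fin s, ∫ ω, OSNAP.ntr (OSNAP.traceProd U
          (OSNAP.interp t (S₂ ω) (G₂ ω)) (fun i => Z i ω) τ (fun i => Y i ω) x) ∂P
        ≤ (c * √(max (p * d) q)) ^ ((2 * q * k - 4 * q : ℝ) / (2 * q - 2)) *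
          (∫ ω, OSNAP.ntr (OSNAP.Gam U (OSNAP.interp t (S₁ ω) (G₁ ω))
            (OSNAP.interp t (S₂ ω) (G₂ ω)) ^ (2 * q)) ∂P) ^
              ((1 : ℝ) / q * ((2 * q - k : ℝ) / (2 * q - 2))) *
          ∏ i, OSNAP.schattenNorm (β i) (Y i) P := by
  -- The constant comes from `mul_pow_le_of_log_le`, where the `24` of the row moments and the
  -- factor `s` are absorbed.
  refine ⟨16, by norm_num, ?_⟩
  intro m n d s p hp0 hp1 hs hd U hU q k hqmax hk hkq t ht0 ht1 Ω _ P _ S₁ S₂ G₁ G₂ Z Y hS₁ hS₂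
    hG₁ hG₂ hSG hZ hY hind β hβ τ
  have hq2 : 2 ≤ q := by exact_mod_cast (le_max_left _ _).trans hqmax
  have : NeZero k := ⟨by omega⟩
  have hm : ∀ i, AEMeasurable (![S₁, S₂, G₁, G₂] i) P := by
    intro i
    fin_cases i
    exacts [hS₁.aemeasurable, hS₂.aemeasurable, hG₁.aemeasurable, hG₂.aemeasurable]
  have hT₁a := OSNAP.allMoments_interp (t := t) (OSNAP.allMoments_of_hasLaw_law hs hd hS₁)
    hG₁.allMoments
  have hT₂a := OSNAP.allMoments_interp (t := t) (OSNAP.allMoments_of_hasLaw_law hs hd hS₂)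
    hG₂.allMoments
  have hΓ := (OSNAP.allMoments_ntr (OSNAP.allMoments_matrix_pow
    (OSNAP.allMoments_Gam U hT₁a hT₂a) (2 * q))).integrable
  have hTT : IndepFun (fun ω => OSNAP.interp t (S₁ ω) (G₁ ω))
      (fun ω => OSNAP.interp t (S₂ ω) (G₂ ω)) P :=
    (hSG.indepFun_prodMk_prodMk₀ hm 0 2 1 3 (by decide) (by decide) (by decide) (by decide)).comp
      (OSNAP.measurable_interp t) (OSNAP.measurable_interp t)
  have hS₁G₁ : IndepFun S₁ G₁ P := hSG.indepFun (i := 0) (j := 2) (by decide)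
  have hT : 0 ≤ max (p * d) q := (Nat.cast_nonneg q).trans (le_max_right _ _)
  refine ⟨fun x => (OSNAP.allMoments_traceProd hs hd hZ U hT₂a hY τ x).integrable, hΓ, ?_⟩
  refine OSNAP.sum_integral_traceProd_le hp0 hs hd
    ((OSNAP.measurable_interp t).comp_aemeasurable (hS₁.aemeasurable.prodMk hG₁.aemeasurable))
    ((OSNAP.measurable_interp t).comp_aemeasurable (hS₂.aemeasurable.prodMk hG₂.aemeasurable)) hTT
    (OSNAP.lintegral_interp_sq hp0 hs hd hS₁ hG₁ hS₁G₁ ht0 ht1) hU hq2 hk hkq hY hZ (fun i => ?_) hβ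
    (C := (24 * max (p * d) q) ^ q) (by positivity) (by positivity) ?_
    (OSNAP.lintegral_row_pow_le hp0 hp1 hs hd hS₂ hG₂ hU ht0 ht1 (by omega) (le_max_left _ _)
      (le_max_right _ _)) hΓ τ
  -- Only the joint independence of one `Z i` from `S₂(t)` and all the `Y` is extracted.
  · exact hind.comp (φ := fun z => z i) (ψ := fun v : Matrix (Fin m) (Fin n) ℝ ×
      Matrix (Fin m) (Fin n) ℝ × Matrix (Fin m) (Fin n) ℝ × Matrix (Fin m) (Fin n) ℝ ×
      (Fin k → Matrix (Fin d) (Fin d) ℝ) => (OSNAP.interp t v.2.1 v.2.2.2.1, v.2.2.2.2))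
      (measurable_pi_apply (X := fun _ => OSNAP.Gen m n s) i)
      (((OSNAP.measurable_interp t).comp ((measurable_fst.comp measurable_snd).prodMk
        (measurable_fst.comp (measurable_snd.comp (measurable_snd.comp measurable_snd))))).prodMk
        (measurable_snd.comp (measurable_snd.comp (measurable_snd.comp measurable_snd))))
  · exact OSNAP.mul_pow_le_of_log_le s.cast_nonneg
      (by rw [hs]; exact (le_max_right _ _).trans hqmax) hT
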